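/- **Setting.** Let $Z$ be a random element of a measurable space with law $\nu$, and let $(X,Y)$ be a pair of real random variables with $\operatorname{E}|X|,\operatorname{E}|Y|<\infty$. Put $\mu(z)=\operatorname{E}[X\mid Z=z]$ and $\pi(z)=\operatorname{E}[Y\mid Z=z]$. Let $\alpha,\beta\in(0,1)$. Let $q$ be the $\alpha$-VaR of $\mu(Z)$, i.e. $\Pr\{\mu(Z)\le q\}=\alpha$, and let $\theta$ be the $(\alpha,\beta)$-CoVaR of $(\mu(Z),\pi(Z))$, i.e. $\Pr\{\pi(Z)\le\theta\mid\mu(Z)=q\}=\beta$, where the conditional probability given the null event $\{\mu(Z)=q\}$ is $\lim_{\varepsilon\downarrow0}\Pr\{\pi(Z)\le\theta\mid|\mu(Z)-q|\le\varepsilon\}$. **Estimator.** For positive integers $k,h,l$, generate $n=kh$ independent copies of $Z$, arranged in $k$ batches of $h$. For each copy generate, independently given it, $l$ inner observations $(X_j,Y_j)$ from the conditional law of $(X,Y)$ given $Z$, and form the sample means $\bar X=\frac1l\sum_j X_j$ and $\bar Y=\frac1l\sum_jY_j$. In every batch take the concomitant $\bar Y$ of the $\lceil\alpha h\rceil$-th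 smallest $\bar X$. The naive nested-simulation estimator $\hat\theta_{k,h,l}$ is the $\lceil\beta k\rceil$-th smallest of these $k$ values. Its sampling effort is $\Gamma=khl$, the number of inner observations. **Regularity conditions.** There is a constant $B$ such that, for all sufficiently large $l$, the vector $\bigl(\mu(Z),\pi(Z),\sqrt l(\bar X-\mu(Z)),\sqrt l(\bar Y-\pi(Z))\bigr)$ has a joint density $\varphi_l(s,t,u,v)$ and there is a function $p_l(u,v)$ with the following properties. - The partial derivatives $\partial_s\varphi_l$ and $\partial_t\varphi_l$ exist everywhere. The function $\Phi_l(s,t,u,v)=\int_{-\infty}^t\varphi_l(s,\tau,u,v)\,d\tau$ is finite everywhere, and $\partial_s\Phi_l$ and $\partial_s^2\Phi_l$ exist everywhere. - Each of $\varphi_l$, $|\partial_s\varphi_l|$, $|\partial_t\varphi_l|$, $\Phi_l$, $|\partial_s\Phi_l|$, $|\partial_s^2\Phi_l|$ is at most $p_l(u,v)$ at every $(s,t,u,v)$. - $\iint(1+|u|+|v|)^2p_l(u,v)\,du\,dv\le B$. - The joint density $\iint\varphi_l(\cdot,\cdot,u,v)\,du\,dv$ of $(\mu(Z),\pi(Z))$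 is positive at $(q,\theta)$. **Proposition.** Under these conditions the following hold. 1. For all sufficiently large $k,h,l$ the estimator has a finite second moment, and as $k,h,l\to\infty$ $$\sqrt{\operatorname{E}\bigl[(\hat\theta_{k,h,l}-\theta)^2\bigr]}=\mathcal O\bigl(k^{-1/2}+h^{-1}+l^{-1}\bigr),\qquad \hat\theta_{k,h,l}-\theta=\mathcal O_{\rm P}\bigl(k^{-1/2}+h^{-1}+l^{-1}\bigr).$$ 2. Consequently the optimal rate of convergence is $\Gamma^{-1/4}$, in the following sense. - For all positive integers $k,h,l$ with $\Gamma=khl$ one has $k^{-1/2}+h^{-1}+l^{-1}\ge\Gamma^{-1/4}$. - Let $c_1,c_2>0$, and let $k,h,l$ vary along a sequence with $\Gamma=khl\to\infty$, $l/\Gamma^{1/4}\to c_1$, $h/\Gamma^{1/4}\to c_2$ and $k/\Gamma^{1/2}\to 1/(c_1c_2)$. Then $k^{-1/2}+h^{-1}+l^{-1}$ is of exact order $\Gamma^{-1/4}$, the RMSE is $\mathcal O(\Gamma^{-1/4})$, and $\hat\theta_{k,h,l}-\theta=\mathcal O_{\rm P}(\Gamma^{-1/4})$. -/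

import Mathlib

open MeasureTheory ProbabilityTheory Filter Topology Asymptotics Set

namespace NestedCoVaR

noncomputable section

/-! ### Order statistics, concomitants and the batching estimator -/

/-- `concomitant a b r` : sort `a` increasingly (ties, if any, by index) and return the entry of `b`
that sits at the same index as the `r`-th smallest entry of `a` (`r ≥ 1`, counting from one;
the value is `0` when `r` exceeds the number of entries). -/
def concomitant {n : ℕ} (a b : Fin n → ℝ) (r : ℕ) : ℝ :=
  if hr : r - 1 < n then b (Tuple.sort a ⟨r - 1, hr⟩) else 0

/-- The `r`-th smallest entry of `b`, `r` counting from one. -/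
def orderStat {n : ℕ} (b : Fin n → ℝ) (r : ℕ) : ℝ := concomitant b b r

/-- The batching estimator computed from `k` batches of `h` pairs `(m i j, p i j)`: in each batch
take the concomitant of the `⌈α h⌉`-th order statistic of the first coordinate; return the
`⌈β k⌉`-th order statistic of these `k` numbers. -/
def batchingEstimator (α β : ℝ) {k h : ℕ} (m p : Fin k → Fin h → ℝ) : ℝ :=
  orderStat (fun i => concomitant (m i) (p i) ⌈α * h⌉₊) ⌈β * k⌉₊

/-! ### The two-level sampling scheme -/

section Model

variable {S : Type*} [MeasurableSpace S]

/-- `μ(z) = E[X | Z = z]`, where `κ z` is the joint law of `(X, Y)` given `Z = z`. -/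
def muFun (κ : Kernel S (ℝ × ℝ)) (z : S) : ℝ := ∫ w, w.1 ∂(κ z)

/-- `π(z) = E[Y | Z = z]`. -/
def piFun (κ : Kernel S (ℝ × ℝ)) (z : S) : ℝ := ∫ w, w.2 ∂(κ z)

/-- Given `Z = z`, the `l` inner observations are independent with law `κ z`. -/
def innerKernel (κ : Kernel S (ℝ × ℝ)) [IsMarkovKernel κ] (l : ℕ) :
    Kernel S (Fin l → ℝ × ℝ) where
  toFun z := Measure.pi fun _ => κ z
  measurable' := by
    refine Measurable.measure_of_isPiSystem_of_isProbabilityMeasure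
      generateFrom_pi.symm isPiSystem_pi ?_
    rintro _ ⟨s, hs, rfl⟩
    simp only [Measure.pi_pi]
    exact Finset.measurable_prod _ fun j _ => κ.measurable_coe (hs j (mem_univ j))

instance (κ : Kernel S (ℝ × ℝ)) [IsMarkovKernel κ] (l : ℕ) :
    IsMarkovKernel (innerKernel κ l) :=
  ⟨fun z => by
    change IsProbabilityMeasure (Measure.pi fun _ => κ z)
    infer_instance⟩

/-- The law of one outer-level scenario `Z ∼ ν` with its `l` inner observations `(X_j, Y_j)`. -/
def scenarioLaw (ν : Measure S) (κ : Kernel S (ℝ × ℝ)) [IsMarkovKernel κ] (l : ℕ) :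
    Measure (S × (Fin l → ℝ × ℝ)) :=
  ν ⊗ₘ innerKernel κ l

instance (ν : Measure S) [IsProbabilityMeasure ν] (κ : Kernel S (ℝ × ℝ)) [IsMarkovKernel κ]
    (l : ℕ) : IsProbabilityMeasure (scenarioLaw ν κ l) := by
  unfold scenarioLaw; infer_instance

/-- The data set: `k` batches of `h` scenarios with `l` inner observations each. -/
abbrev Sample (S : Type*) (k h l : ℕ) : Type _ := Fin k → Fin h → S × (Fin l → ℝ × ℝ)

/-- The law of the data: the `k * h` scenarios are independent and identically distributed. -/
def sampleLaw (ν : Measure S) [IsProbabilityMeasure ν] (κ : Kernel S (ℝ × ℝ)) [IsMarkovKernel κ]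
    (k h l : ℕ) : Measure (Sample S k h l) :=
  Measure.pi fun _ => Measure.pi fun _ => scenarioLaw ν κ l

instance (ν : Measure S) [IsProbabilityMeasure ν] (κ : Kernel S (ℝ × ℝ)) [IsMarkovKernel κ]
    (k h l : ℕ) : IsProbabilityMeasure (sampleLaw ν κ k h l) := by
  unfold sampleLaw; infer_instance

/-- Inner-level sample mean of `X` in one scenario. -/
def meanX {l : ℕ} (x : S × (Fin l → ℝ × ℝ)) : ℝ := (1 / (l : ℝ)) * ∑ j, (x.2 j).1

/-- Inner-level sample mean of `Y` in one scenario. -/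
def meanY {l : ℕ} (x : S × (Fin l → ℝ × ℝ)) : ℝ := (1 / (l : ℝ)) * ∑ j, (x.2 j).2

/-- The naive nested estimator with repricing by standard nested simulation: the batching
estimator applied to the inner-level sample means. -/
def nestedEstimator (α β : ℝ) {k h l : ℕ} (ω : Sample S k h l) : ℝ :=
  batchingEstimator α β (fun i j => meanX (ω i j)) (fun i j => meanY (ω i j))

/-- The root mean squared error of the nested estimator as an estimator of `θ`. -/
def rmse (ν : Measure S) [IsProbabilityMeasure ν] (κ : Kernel S (ℝ × ℝ)) [IsMarkovKernel κ]
    (α β θ : ℝ) (k h l : ℕ) : ℝ :=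
  √(∫ ω, (nestedEstimator α β ω - θ) ^ 2 ∂(sampleLaw ν κ k h l))

/-! ### VaR and CoVaR -/

/-- `q` is the `α`-VaR of `m(Z)`: `P(m(Z) ≤ q) = α`. -/
def IsVaR (ν : Measure S) (m : S → ℝ) (α q : ℝ) : Prop := ν.real {z | m z ≤ q} = α

/-- `P(p(Z) ≤ y | m(Z) = x) = b`, the conditional probability given the null event `m(Z) = x`
being the limit of the conditional probabilities given `|m(Z) - x| ≤ ε` as `ε ↓ 0`. -/
def HasCondCDFAt (ν : Measure S) (m p : S → ℝ) (x y b : ℝ) : Prop :=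
  Tendsto (fun ε : ℝ => ν.real {z | p z ≤ y ∧ |m z - x| ≤ ε} / ν.real {z | |m z - x| ≤ ε})
    (𝓝[>] 0) (𝓝 b)

/-- `θ` is the `(α, β)`-CoVaR of `(m(Z), p(Z))`, where `q` is the `α`-VaR of `m(Z)`. -/
def IsCoVaR (ν : Measure S) (m p : S → ℝ) (α β q θ : ℝ) : Prop :=
  IsVaR ν m α q ∧ HasCondCDFAt ν m p q θ β

/-! ### Regularity conditions on the joint density -/

/-- The vector `(μ(Z), π(Z), √l ξ̄, √l ζ̄)`, where `ξ̄ = X̄ - μ(Z)` and `ζ̄ = Ȳ - π(Z)` are the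
average pricing errors of one scenario. -/
def scaledErrors (κ : Kernel S (ℝ × ℝ)) {l : ℕ} (x : S × (Fin l → ℝ × ℝ)) : ℝ × ℝ × ℝ × ℝ :=
  (muFun κ x.1, piFun κ x.1,
    √(l : ℝ) * (meanX x - muFun κ x.1), √(l : ℝ) * (meanY x - piFun κ x.1))

/-- `lowerMass φ s t u v = ∫_{-∞}^t φ(s, τ, u, v) dτ`. -/
def lowerMass (φ : ℝ → ℝ → ℝ → ℝ → ℝ) (s t u v : ℝ) : ℝ := ∫ τ in Iic t, φ s τ u v

/-- Regularity for a given inner sample size `l`: `φ(s, t, u, v)` is a joint density of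
`(μ(Z), π(Z), √l ξ̄, √l ζ̄)`, it is differentiable in `s` and in `t`, its partial integral in `t`
is twice differentiable in `s`, and all of these are dominated by a function `p(u, v)` for which
`∫∫ (1 + |u| + |v|)² p(u, v) du dv` is finite and at most `B`. -/
structure RegularDensity (ν : Measure S) (κ : Kernel S (ℝ × ℝ)) [IsMarkovKernel κ] (l : ℕ)
    (φ : ℝ → ℝ → ℝ → ℝ → ℝ) (p : ℝ → ℝ → ℝ) (B : ℝ) : Prop where
  measurable : Measurable fun x : ℝ × ℝ × ℝ × ℝ => φ x.1 x.2.1 x.2.2.1 x.2.2.2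
  nonneg : ∀ s t u v, 0 ≤ φ s t u v
  law : (scenarioLaw ν κ l).map (scaledErrors κ) =
    volume.withDensity fun x : ℝ × ℝ × ℝ × ℝ => ENNReal.ofReal (φ x.1 x.2.1 x.2.2.1 x.2.2.2)
  diff_s : ∀ t u v, Differentiable ℝ fun s => φ s t u v
  diff_t : ∀ s u v, Differentiable ℝ fun t => φ s t u v
  integrableOn : ∀ s t u v, IntegrableOn (fun τ => φ s τ u v) (Iic t)
  lower_diff_s : ∀ t u v, Differentiable ℝ fun s => lowerMass φ s t u v
  lower_diff_s_s : ∀ t u v, Differentiable ℝ (deriv fun s => lowerMass φ s t u v)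
  le_dom : ∀ s t u v, φ s t u v ≤ p u v
  ds_le_dom : ∀ s t u v, |deriv (fun s' => φ s' t u v) s| ≤ p u v
  dt_le_dom : ∀ s t u v, |deriv (fun t' => φ s t' u v) t| ≤ p u v
  lower_le_dom : ∀ s t u v, lowerMass φ s t u v ≤ p u v
  lower_ds_le_dom : ∀ s t u v, |deriv (fun s' => lowerMass φ s' t u v) s| ≤ p u v
  lower_dss_le_dom : ∀ s t u v, |deriv (deriv fun s' => lowerMass φ s' t u v) s| ≤ p u v
  integrable_dom : Integrable fun w : ℝ × ℝ => (1 + |w.1| + |w.2|) ^ 2 * p w.1 w.2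
  integral_dom_le : ∫ w : ℝ × ℝ, (1 + |w.1| + |w.2|) ^ 2 * p w.1 w.2 ≤ B

/-- The joint density of `(μ(Z), π(Z))` at `(s, t)`, as a marginal of `φ`. -/
def marginalDensity (φ : ℝ → ℝ → ℝ → ℝ → ℝ) (s t : ℝ) : ℝ := ∫ w : ℝ × ℝ, φ s t w.1 w.2

end Model

/-! ### Rates -/

/-- `E a = O_P(r a)` along the filter `L`, where `E a` is a random variable on `(Ω a, P a)`. -/
def IsBigOP {ι : Type*} (L : Filter ι) {Ω : ι → Type*} [∀ a, MeasurableSpace (Ω a)]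
    (P : ∀ a, Measure (Ω a)) (E : ∀ a, Ω a → ℝ) (r : ι → ℝ) : Prop :=
  ∀ ε : ℝ, 0 < ε → ∃ M : ℝ, ∀ᶠ a in L, (P a).real {ω | M * r a < |E a ω|} ≤ ε

/-- `k^{-1/2} + h^{-1} + l^{-1}`. -/
def errorRate (k h l : ℕ) : ℝ := (k : ℝ) ^ (-(1 / 2) : ℝ) + (h : ℝ)⁻¹ + (l : ℝ)⁻¹

/-- The sampling effort `Γ = k h l`, the total number of inner-level observations. -/
def effort (k h l : ℕ) : ℝ := (k : ℝ) * h * l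

end

end NestedCoVaR

/-! Everything reduces to one estimate, E(θ̂ - θ)² ≤ K (1/k + (1/h + 1/l)²) for large k, h, l, which
gives `exists_mse_bound`. Chebyshev's inequality then gives the bound in probability. The statements
about Γ are arithmetic, because 1/Γ is the product of (k^{-1/2})², 1/h and 1/l.

Inner level. The sample means are (μ(Z), π(Z)) plus l^{-1/2} times errors (U, V) that are centred
given Z. Let f be the density of X̄ and H(·, y) its density on the event Ȳ ≤ y. In a Taylor
expansion in l^{-1/2} the first-order terms integrate to zero, so H and f lie within O(1/l) of their
noise-free versions (`abs_smoothLower_sub_zero_le`), and P(X̄ < q) = α + O(1/l)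
(`abs_cdf_perturbed_sub_le`). `RegularDensity.noisyPair` records this with δ = 1/l;
`exists_noisyPair` makes the constants independent of l.

Batch level. Let F(x) = P(X̄ < x) and let w be the Beta density of the uniform order statistic of
rank r = ⌈αh⌉. A batch output has distribution function G(y) = ∫ H(x, y) w(F(x)) dx. The CoVaR
equation says that H(q, θ) = β f(q) without noise, hence H(·, θ) - β f = c₁ f (F - F(q)) + O(f ((F -
F(q))² + δ)). Against f w(F), the function F has mean r/(h+1) and mean square deviation O(1/h + δ)
from F(q). Thus G(θ) = β + O(1/h + 1/l): the fluctuation of order h^{-1/2} enters only through its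
square. Moreover G grows linearly around θ, and its tails decay like y^{-1/2}, which needs only a
first moment and a Lipschitz density.

Outer level. The estimator is an empirical β-quantile of k independent draws from G. Hoeffding's
inequality bounds deviations by exp(-c k y²) once y exceeds a multiple of the bias. For very large y
a fixed fraction of all the draws must lie in a tail, so y^{-1/2} is raised to a power proportional
to k. This is why the second moment is finite for large k although the inner observations are only
assumed integrable. Integrating the deviation bound gives `exists_orderStat_mse`. -/

namespace NestedCoVaR

/-! ### Sorting, order statistics and concomitants -/

theorem measurableSet_sort_eq {n : ℕ} (σ : Equiv.Perm (Fin n)) :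
    MeasurableSet {a : Fin n → ℝ | Tuple.sort a = σ} := by
  have h : {a : Fin n → ℝ | Tuple.sort a = σ} =
      {a | (∀ i j, i ≤ j → a (σ i) ≤ a (σ j)) ∧
        ∀ i j, i < j → a (σ i) = a (σ j) → σ i < σ j} := by
    ext a
    rw [mem_ofPred_eq, eq_comm, Tuple.eq_sort_iff]
    rfl
  rw [h]
  measurability

theorem measurable_concomitant {Ω : Type*} [MeasurableSpace Ω] {n : ℕ} {a b : Ω → Fin n → ℝ}
    (ha : Measurable a) (hb : Measurable b) (r : ℕ) :
    Measurable fun ω => concomitant (a ω) (b ω) r := by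
  unfold concomitant
  split_ifs with hr
  -- The sorting permutation takes finitely many values, so the random index is resolved by a finite
  -- sum of indicators times fixed coordinates.
  · have h : (fun ω => b ω (Tuple.sort (a ω) ⟨r - 1, hr⟩)) =
        fun ω => ∑ σ : Equiv.Perm (Fin n),
          {a : Fin n → ℝ | Tuple.sort a = σ}.indicator 1 (a ω) * b ω (σ ⟨r - 1, hr⟩) := by
      ext ω
      rw [Finset.sum_eq_single (Tuple.sort (a ω))]
      · simp
      · intro σ _ hσ
        rw [indicator_of_notMem (by simpa using hσ.symm), zero_mul]
      · simp
    rw [h]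
    refine Finset.measurable_sum _ fun σ _ => Measurable.mul ?_ ?_
    · exact (measurable_one.indicator (measurableSet_sort_eq σ)).comp ha
    · exact (measurable_pi_apply _).comp hb
  · exact measurable_const

/-- Counting is invariant under the sorting permutation. This turns events about quantiles into
events about numbers of successes. -/
theorem orderStat_le_iff {n : ℕ} (b : Fin n → ℝ) {r : ℕ} (hr : 1 ≤ r) (hrn : r ≤ n) (x : ℝ) :
    orderStat b r ≤ x ↔ r ≤ (Finset.univ.filter fun i => b i ≤ x).card := by
  have hlt : r - 1 < n := by omega
  have h := Tuple.lt_card_le_iff_apply_le_of_monotone (j := ⟨r - 1, hlt⟩) (a := x)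
    (Tuple.monotone_sort b)
  have hc : (Finset.univ.filter fun i => (b ∘ Tuple.sort b) i ≤ x).card =
      (Finset.univ.filter fun i => b i ≤ x).card := by
    refine Finset.card_bij (fun i _ => Tuple.sort b i) ?_ ?_ ?_
    · intro i hi; simpa using hi
    · intro i _ j _ hij; exact (Tuple.sort b).injective hij
    · intro i hi
      exact ⟨(Tuple.sort b).symm i, by simpa using hi, by simp⟩
  rw [hc] at h
  unfold orderStat concomitant
  rw [dif_pos hlt]
  rw [Function.comp_apply] at h
  rw [← h]
  simp only
  omega

/-- Without ties the sorted sequence is strictly increasing, so a position is the number of strictly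
smaller entries. Ranks become counts in which the sorting permutation no longer appears. -/
theorem sort_apply_eq_iff {n : ℕ} {a : Fin n → ℝ} (ha : Function.Injective a) (m i : Fin n) :
    Tuple.sort a m = i ↔ (Finset.univ.filter fun j => a j < a i).card = m := by
  have hs : StrictMono (a ∘ Tuple.sort a) :=
    (Tuple.monotone_sort a).strictMono_of_injective (ha.comp (Tuple.sort a).injective)
  have key : ∀ m : Fin n,
      (Finset.univ.filter fun j => a j < a (Tuple.sort a m)).card = (m : ℕ) := by
    intro m
    rw [← Fin.card_Iio m]
    symm
    refine Finset.card_bij (fun i _ => Tuple.sort a i) ?_ ?_ ?_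
    · intro i hi
      simpa using hs (Finset.mem_Iio.1 hi)
    · intro i _ j _ hij; exact (Tuple.sort a).injective hij
    · intro i hi
      refine ⟨(Tuple.sort a).symm i, ?_, by simp⟩
      rw [Finset.mem_Iio, ← hs.lt_iff_lt]
      simpa using hi
  constructor
  · rintro rfl; exact key m
  · intro h
    have h2 := key ((Tuple.sort a).symm i)
    rw [Equiv.apply_symm_apply, h] at h2
    rw [Fin.ext h2, Equiv.apply_symm_apply]

theorem concomitant_mem_iff {n : ℕ} {a : Fin n → ℝ} (ha : Function.Injective a) (b : Fin n → ℝ)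
    {r : ℕ} (hr : r - 1 < n) (A : Set ℝ) :
    concomitant a b r ∈ A ↔
      ∃ i, b i ∈ A ∧ (Finset.univ.filter fun j => a j < a i).card = r - 1 := by
  unfold concomitant
  rw [dif_pos hr]
  constructor
  · intro h
    exact ⟨_, h, (sort_apply_eq_iff ha ⟨r - 1, hr⟩ _).1 rfl⟩
  · rintro ⟨i, hi, h⟩
    rw [(sort_apply_eq_iff ha ⟨r - 1, hr⟩ i).2 h]
    exact hi

/-! ### Binomial counts under product measures -/

open Classical in
theorem setOf_filter_mem_eq {Ω : Type*} {n : ℕ} (E : Set Ω) (s : Finset (Fin n)) :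
    {ω : Fin n → Ω | (Finset.univ.filter fun j => ω j ∈ E) = s} =
      univ.pi fun j => if j ∈ s then E else Eᶜ := by
  ext ω
  simp only [mem_ofPred_eq, Finset.ext_iff, Finset.mem_filter, Finset.mem_univ, true_and,
    Set.mem_pi, Set.mem_univ, forall_true_left]
  refine forall_congr' fun j => ?_
  by_cases hj : j ∈ s <;> simp [hj]

open Classical in
theorem pi_filter_mem_eq {Ω : Type*} [MeasurableSpace Ω] (ρ : Measure Ω)
    [IsProbabilityMeasure ρ] (n : ℕ) {E : Set Ω} (hE : MeasurableSet E) (s : Finset (Fin n)) :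
    (Measure.pi fun _ : Fin n => ρ).real {ω | (Finset.univ.filter fun j => ω j ∈ E) = s} =
      ρ.real E ^ s.card * (1 - ρ.real E) ^ (n - s.card) := by
  rw [setOf_filter_mem_eq, measureReal_def, Measure.pi_pi, ENNReal.toReal_prod]
  have h2 : ∀ j : Fin n, (ρ (if j ∈ s then E else Eᶜ)).toReal =
      if j ∈ s then ρ.real E else 1 - ρ.real E := by
    intro j
    split_ifs
    · rfl
    · exact probReal_compl_eq_one_sub hE
  simp only [h2]
  rw [Finset.prod_ite]
  simp only [Finset.prod_const]
  congr 2
  · congr 1; ext; simp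
  · rw [Finset.filter_not, Finset.card_sdiff]
    simp

open Classical in
/-- The number of successes in `n` independent trials has the binomial distribution. -/
theorem pi_card_mem_eq {Ω : Type*} [MeasurableSpace Ω] (ρ : Measure Ω)
    [IsProbabilityMeasure ρ] (n m : ℕ) {E : Set Ω} (hE : MeasurableSet E) :
    (Measure.pi fun _ : Fin n => ρ).real
      {ω | (Finset.univ.filter fun j => ω j ∈ E).card = m} =
      (n.choose m : ℝ) * ρ.real E ^ m * (1 - ρ.real E) ^ (n - m) := by
  have h : {ω : Fin n → Ω | (Finset.univ.filter fun j => ω j ∈ E).card = m} =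
      ⋃ s ∈ Finset.powersetCard m (Finset.univ : Finset (Fin n)),
        {ω | (Finset.univ.filter fun j => ω j ∈ E) = s} := by
    ext ω
    simp [Finset.mem_powersetCard]
  have hmeas : ∀ s : Finset (Fin n),
      MeasurableSet {ω : Fin n → Ω | (Finset.univ.filter fun j => ω j ∈ E) = s} := by
    intro s
    rw [setOf_filter_mem_eq]
    refine MeasurableSet.univ_pi fun j => ?_
    split_ifs
    exacts [hE, hE.compl]
  rw [h, measureReal_biUnion_finset]
  · rw [Finset.sum_congr rfl (fun s hs => pi_filter_mem_eq ρ n hE s)]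
    rw [Finset.sum_congr rfl (g := fun _ => ρ.real E ^ m * (1 - ρ.real E) ^ (n - m))]
    · simp [Finset.card_powersetCard, mul_assoc]
    · intro s hs
      rw [(Finset.mem_powersetCard.1 hs).2]
  · intro s _ t _ hst
    refine Set.disjoint_left.2 fun ω h1 h2 => hst ?_
    exact (mem_ofPred_eq ▸ h1).symm.trans h2
  · intro s _
    exact hmeas s

open Classical in
/-- The probability of at least `m` successes in `n` independent trials is at most
`2 ^ n` times the `m`-th power of the success probability. -/
theorem pi_le_card_mem_le {Ω : Type*} [MeasurableSpace Ω] (ρ : Measure Ω)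
    [IsProbabilityMeasure ρ] (n m : ℕ) (E : Set Ω) :
    (Measure.pi fun _ : Fin n => ρ).real
      {ω | m ≤ (Finset.univ.filter fun j => ω j ∈ E).card} ≤ 2 ^ n * ρ.real E ^ m := by
  have h : {ω : Fin n → Ω | m ≤ (Finset.univ.filter fun j => ω j ∈ E).card} ⊆
      -- Union bound over which `m` trials succeed, the others being left free; there are at most `2
      -- ^ n` choices.
      ⋃ s ∈ Finset.powersetCard m (Finset.univ : Finset (Fin n)),
        univ.pi fun j => if j ∈ s then E else univ := by
    intro ω hω
    obtain ⟨s, hs, hm⟩ := Finset.exists_subset_card_eq hω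
    simp only [mem_iUnion, Finset.mem_powersetCard]
    refine ⟨s, ⟨Finset.subset_univ _, hm⟩, fun j _ => ?_⟩
    dsimp only
    split_ifs with hj
    · exact (Finset.mem_filter.1 (hs hj)).2
    · trivial
  refine (measureReal_mono h (measure_ne_top _ _)).trans
    ((measureReal_biUnion_finset_le _ _).trans ?_)
  rw [Finset.sum_congr rfl (g := fun _ => ρ.real E ^ m)]
  · rw [Finset.sum_const, Finset.card_powersetCard, nsmul_eq_mul, Finset.card_univ,
      Fintype.card_fin]
    gcongr
    exact_mod_cast Nat.choose_le_two_pow n m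
  · intro s hs
    rw [measureReal_def, Measure.pi_pi, ENNReal.toReal_prod]
    have h2 : ∀ j : Fin n, (ρ (if j ∈ s then E else univ)).toReal =
        if j ∈ s then ρ.real E else 1 := by
      intro j
      split_ifs
      · rfl
      · simp
    simp only [h2]
    rw [Finset.prod_ite]
    simp only [Finset.prod_const, one_pow, mul_one]
    congr 1
    rw [← (Finset.mem_powersetCard.1 hs).2]
    congr 1; ext; simp

/-! ### The law of the concomitant in one batch -/

/-- The density at `u` of the `r`-th order statistic of `h` independent uniform variables. -/
noncomputable def orderWeight (h r : ℕ) (u : ℝ) : ℝ :=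
  h * (h - 1).choose (r - 1) * u ^ (r - 1) * (1 - u) ^ (h - r)

theorem measurable_card_lt {Ω : Type*} [MeasurableSpace Ω] {n : ℕ} {a : Ω → Fin n → ℝ}
    {b : Ω → ℝ} (ha : Measurable a) (hb : Measurable b) :
    Measurable fun ω => (Finset.univ.filter fun j => a ω j < b ω).card := by
  simp only [Finset.card_filter]
  refine Finset.measurable_sum _ fun j _ => ?_
  refine Measurable.ite ?_ measurable_const measurable_const
  exact measurableSet_lt ((measurable_pi_apply j).comp ha) hb

/-- An entry is not smaller than itself. Its rank is therefore a count over the other entries, which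
are independent of it. -/
theorem card_filter_lt_succAbove {n : ℕ} (a : Fin (n + 1) → ℝ) (i : Fin (n + 1)) :
    (Finset.univ.filter fun j => a j < a i).card =
      (Finset.univ.filter fun j : Fin n => a (i.succAbove j) < a i).card := by
  rw [Fin.univ_succAbove n i, Finset.filter_cons]
  simp only [lt_irrefl, if_false, Finset.filter_map, Finset.card_map]
  rfl

section
variable (ρ : Measure (ℝ × ℝ)) [IsProbabilityMeasure ρ]

theorem ae_injective_fst (hρ : ∀ x : ℝ, ρ {w | w.1 = x} = 0) (h : ℕ) :
    ∀ᵐ w ∂(Measure.pi fun _ : Fin h => ρ), Function.Injective fun j => (w j).1 := by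
  obtain _ | n := h
  · exact Eventually.of_forall fun w i => i.elim0
  have key : ∀ i : Fin (n + 1), ∀ᵐ w ∂(Measure.pi fun _ : Fin (n + 1) => ρ),
      ∀ j : Fin n, (w (i.succAbove j)).1 ≠ (w i).1 := by
    intro i
    rw [ae_all_iff]
    intro j
    have hmp := measurePreserving_piFinSuccAbove (fun _ : Fin (n + 1) => ρ) i
    have hS : MeasurableSet {z : (ℝ × ℝ) × (Fin n → ℝ × ℝ) | ¬ (z.2 j).1 ≠ z.1.1} := by
      simp only [ne_eq, not_not]
      exact measurableSet_eq_fun (by fun_prop) (by fun_prop)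
    have h0 : (ρ.prod (Measure.pi fun _ : Fin n => ρ))
        {z : (ℝ × ℝ) × (Fin n → ℝ × ℝ) | ¬ (z.2 j).1 ≠ z.1.1} = 0 := by
      rw [Measure.measure_prod_null hS]
      refine Eventually.of_forall fun w => ?_
      have he := (measurePreserving_eval (fun _ : Fin n => ρ) j).measure_preimage
        (s := {w' : ℝ × ℝ | w'.1 = w.1})
        (measurableSet_eq_fun measurable_fst measurable_const).nullMeasurableSet
      rw [hρ] at he
      simp only [ne_eq, not_not]
      exact he
    have h1 := hmp.measure_preimage hS.nullMeasurableSet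
    rw [h0] at h1
    exact h1
  filter_upwards [ae_all_iff.2 key] with w hw i j hij
  by_contra hne
  obtain ⟨m, rfl⟩ := Fin.exists_succAbove_eq (Ne.symm hne)
  exact hw i m hij.symm

/-- By Fubini, freeze the pair at index `i`: the other `n` first coordinates fall below it
independently with the same probability, so its rank is binomial. -/
theorem pi_rank_eq {n m : ℕ} (i : Fin (n + 1)) {A : Set ℝ} (hA : MeasurableSet A) :
    (Measure.pi fun _ : Fin (n + 1) => ρ).real
      {w | (w i).2 ∈ A ∧ (Finset.univ.filter fun j => (w j).1 < (w i).1).card = m} =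
    ∫ w, A.indicator 1 w.2 * ((n.choose m : ℝ) * ρ.real {w' | w'.1 < w.1} ^ m *
      (1 - ρ.real {w' | w'.1 < w.1}) ^ (n - m)) ∂ρ := by
  classical
  have hmp := measurePreserving_piFinSuccAbove (fun _ : Fin (n + 1) => ρ) i
  set S : Set ((ℝ × ℝ) × (Fin n → ℝ × ℝ)) :=
    {z | z.1.2 ∈ A ∧ (Finset.univ.filter fun j => (z.2 j).1 < z.1.1).card = m} with hSdef
  have hS : MeasurableSet S := by
    refine MeasurableSet.inter (hA.preimage (by fun_prop)) ?_
    have := measurable_card_lt (a := fun z : (ℝ × ℝ) × (Fin n → ℝ × ℝ) => fun j => (z.2 j).1)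
      (b := fun z => z.1.1) (by fun_prop) (by fun_prop)
    exact this (measurableSet_singleton m)
  have hpre : {w : Fin (n + 1) → ℝ × ℝ | (w i).2 ∈ A ∧
      (Finset.univ.filter fun j => (w j).1 < (w i).1).card = m} =
      (MeasurableEquiv.piFinSuccAbove (fun _ => ℝ × ℝ) i) ⁻¹' S := by
    ext w
    have := card_filter_lt_succAbove (fun j => (w j).1) i
    simp only [hSdef, mem_ofPred_eq, this, mem_preimage]
    rfl
  rw [hpre, measureReal_def, hmp.measure_preimage hS.nullMeasurableSet,
    Measure.prod_apply hS, ← integral_toReal]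
  · refine integral_congr_ae (Eventually.of_forall fun w => ?_)
    dsimp only
    have hb := pi_card_mem_eq ρ n m (E := {w' : ℝ × ℝ | w'.1 < w.1})
      (measurableSet_lt measurable_fst measurable_const)
    by_cases hw : w.2 ∈ A
    · rw [indicator_of_mem hw, Pi.one_apply, one_mul, ← hb, measureReal_def]
      congr 2
      ext w'
      simp [hSdef, hw]
    · rw [indicator_of_notMem hw, zero_mul]
      have : Prod.mk w ⁻¹' S = ∅ := by
        ext w'
        simp [hSdef, hw]
      rw [this]
      simp
  · exact (measurable_measure_prodMk_left hS).aemeasurable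
  · exact Eventually.of_forall fun w => measure_lt_top _ _

/-- The law of the concomitant of the `r`-th order statistic in a batch of size `h`. -/
theorem pi_concomitant_mem (hρ : ∀ x : ℝ, ρ {w | w.1 = x} = 0) {h r : ℕ} (hr : 1 ≤ r)
    (hrh : r ≤ h) {A : Set ℝ} (hA : MeasurableSet A) :
    (Measure.pi fun _ : Fin h => ρ).real
      {w | concomitant (fun j => (w j).1) (fun j => (w j).2) r ∈ A} =
    ∫ w, A.indicator 1 w.2 * orderWeight h r (ρ.real {w' | w'.1 < w.1}) ∂ρ := by
  obtain _ | n := h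
  · omega
  set P := Measure.pi fun _ : Fin (n + 1) => ρ with hP
  set B : Fin (n + 1) → Set (Fin (n + 1) → ℝ × ℝ) := fun i =>
    {w | (w i).2 ∈ A ∧ (Finset.univ.filter fun j => (w j).1 < (w i).1).card = r - 1} with hB
  have hinj := ae_injective_fst ρ hρ (n + 1)
  have h1 : P.real {w | concomitant (fun j => (w j).1) (fun j => (w j).2) r ∈ A} =
      P.real (⋃ i ∈ Finset.univ, B i) := by
    refine measureReal_congr ?_
    filter_upwards [hinj] with w hw
    have := concomitant_mem_iff hw (fun j => (w j).2) (r := r) (by omega) A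
    refine propext ?_
    refine this.trans ?_
    have h3 : (w ∈ ⋃ i ∈ Finset.univ, B i) ↔ ∃ i, w ∈ B i := by simp
    exact h3.symm
  have hBm : ∀ i, MeasurableSet (B i) := by
    intro i
    refine MeasurableSet.inter (hA.preimage (by fun_prop)) ?_
    have := measurable_card_lt (a := fun w : Fin (n + 1) → ℝ × ℝ => fun j => (w j).1)
      (b := fun w => (w i).1) (by fun_prop) (by fun_prop)
    exact this (measurableSet_singleton (r - 1))
  -- Off the null set of ties only one index can have rank `r - 1`. The events are thus almost
  -- disjoint, and their `h` equal probabilities add up to the factor `h` in `orderWeight`.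
  have hdisj : Pairwise (Function.onFun (AEDisjoint P) B) := by
    intro i j hij
    refine measure_mono_null ?_ (show P {w | ¬ Function.Injective fun j => (w j).1} = 0 from hinj)
    rintro w ⟨hi, hj⟩ hw
    have e1 := (sort_apply_eq_iff hw ⟨r - 1, by omega⟩ i).2 hi.2
    have e2 := (sort_apply_eq_iff hw ⟨r - 1, by omega⟩ j).2 hj.2
    exact hij (e1.symm.trans e2)
  rw [h1, measureReal_def, measure_biUnion_finset₀ (fun i _ j _ hij => hdisj hij)
    (fun i _ => (hBm i).nullMeasurableSet), ENNReal.toReal_sum (fun i _ => measure_ne_top _ _)]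
  have h2 : ∀ i, (P (B i)).toReal = _ := fun i => pi_rank_eq ρ (m := r - 1) i hA
  simp only [h2]
  rw [Finset.sum_const, Finset.card_univ, Fintype.card_fin, nsmul_eq_mul, ← integral_const_mul]
  refine integral_congr_ae (Eventually.of_forall fun w => ?_)
  have : n - (r - 1) = n + 1 - r := by omega
  simp only [orderWeight, this, Nat.add_sub_cancel]
  ring

end

/-! ### Identities and bounds for the order statistic density -/

theorem orderWeight_nonneg {h r : ℕ} {u : ℝ} (h0 : 0 ≤ u) (h1 : u ≤ 1) :
    0 ≤ orderWeight h r u := by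
  have : 0 ≤ 1 - u := by linarith
  unfold orderWeight
  positivity

/-- Multiplying a Beta density by its variable raises its first parameter. Moments therefore follow
from normalisation alone, without evaluating Beta integrals. -/
theorem mul_orderWeight {h r : ℕ} (hr : 1 ≤ r) (hrh : r ≤ h) (u : ℝ) :
    u * orderWeight h r u = r / (h + 1) * orderWeight (h + 1) (r + 1) u := by
  obtain ⟨r, rfl⟩ : ∃ s, r = s + 1 := ⟨r - 1, by omega⟩
  obtain ⟨h, rfl⟩ : ∃ s, h = s + 1 := ⟨h - 1, by omega⟩
  unfold orderWeight
  simp only [Nat.add_sub_cancel, Nat.add_sub_add_right]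
  have hc : ((h + 1 : ℕ) : ℝ) * h.choose r = (h + 1).choose (r + 1) * (r + 1 : ℕ) := by
    exact_mod_cast Nat.add_one_mul_choose_eq h r
  push_cast at hc ⊢
  rw [pow_succ u r]
  field_simp
  linear_combination u * u ^ r * (1 - u) ^ (h - r) * hc

theorem orderWeight_continuous (h r : ℕ) : Continuous (orderWeight h r) := by
  unfold orderWeight; fun_prop

/-- Binomial probabilities far from the mean, by Chebyshev's inequality. -/
theorem choose_mul_le (n m : ℕ) (hm : m ≤ n) {u : ℝ} (h0 : 0 ≤ u) (h1 : u ≤ 1) :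
    (n * u - m) ^ 2 * (n.choose m * u ^ m * (1 - u) ^ (n - m)) ≤ n * u * (1 - u) := by
  -- The variance identity for Bernstein polynomials writes `n u (1 - u)` as a sum of nonnegative
  -- terms, of which one is kept.
  have hv := congrArg (Polynomial.eval u) (bernsteinPolynomial.variance ℝ n)
  have h1' : 0 ≤ 1 - u := by linarith
  simp only [Polynomial.eval_finsetSum, bernsteinPolynomial, Polynomial.eval_mul,
    Polynomial.eval_pow, Polynomial.eval_sub, Polynomial.eval_X, Polynomial.eval_one,
    Polynomial.eval_natCast, nsmul_eq_mul] at hv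
  rw [← hv]
  refine Finset.single_le_sum
    (f := fun ν : ℕ => (n * u - ν) ^ 2 * (n.choose ν * u ^ ν * (1 - u) ^ (n - ν)))
    (fun i _ => by positivity) (Finset.mem_range.2 (by omega))

/-- The weight is `h` times a binomial probability for `h - 1` trials. Chebyshev bounds the latter
by a multiple of `1 / (η² (h - 1))` away from the peak, which offsets the factor `h` and leaves a
bound uniform in `h`. -/
theorem orderWeight_le {h r : ℕ} (hr : 1 ≤ r) (hrh : r ≤ h) (hh : 2 ≤ h) {u η : ℝ} (h0 : 0 ≤ u)
    (h1 : u ≤ 1) (hη : 0 < η) (hu : η * (h - 1) ≤ |(h - 1) * u - (r - 1)|) :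
    orderWeight h r u ≤ 1 / η ^ 2 := by
  obtain ⟨m, rfl⟩ : ∃ s, r = s + 1 := ⟨r - 1, by omega⟩
  obtain ⟨n, rfl⟩ : ∃ s, h = s + 1 := ⟨h - 1, by omega⟩
  have h1' : 0 ≤ 1 - u := by linarith
  have hn : (1 : ℝ) ≤ n := by exact_mod_cast (by omega : 1 ≤ n)
  have key := choose_mul_le n m (by omega) h0 h1
  unfold orderWeight
  simp only [Nat.add_sub_cancel, Nat.add_sub_add_right]
  push_cast at hu ⊢
  simp only [add_sub_cancel_right] at hu
  set w : ℝ := n.choose m * u ^ m * (1 - u) ^ (n - m) with hw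
  have hw0 : 0 ≤ w := by positivity
  have e1 : (η * n) ^ 2 ≤ (n * u - m) ^ 2 := by
    rw [← sq_abs (n * u - m)]
    exact pow_le_pow_left₀ (by positivity) hu 2
  have e2 : (η * n) ^ 2 * w ≤ n * (1 / 4) := by
    refine (mul_le_mul_of_nonneg_right e1 hw0).trans (key.trans ?_)
    nlinarith [sq_nonneg (u - 1 / 2)]
  have e3 : η ^ 2 * n * w ≤ 1 / 4 := by
    have hn0 : (0 : ℝ) < n := by linarith
    nlinarith
  have e4 : ((n : ℝ) + 1) * n.choose m * u ^ m * (1 - u) ^ (n - m) = (n + 1) * w := by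
    rw [hw]; ring
  rw [e4, le_div_iff₀ (by positivity)]
  have : 0 ≤ η ^ 2 * w := by positivity
  nlinarith

/-! ### Noisy pairs and their local analysis at `q` -/

/-- Quantitative regularity of the law `ρ` of a noisy pair `(M, P)` near `(q, θ)`: `f` is the
density of `M` and `H · y` the density of `M` on the event `P ≤ y`; `δ` is the size of the
perturbation from the noise-free pair. -/
structure NoisyPair (ρ : Measure (ℝ × ℝ)) (f : ℝ → ℝ) (H : ℝ → ℝ → ℝ)
    (α β q θ C c ε δ : ℝ) : Prop where
  measurable_H : ∀ y, Measurable fun x => H x y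
  H_nonneg : ∀ x y, 0 ≤ H x y
  H_mono : ∀ x, Monotone (H x)
  H_le : ∀ x y, H x y ≤ f x
  f_le : ∀ x, f x ≤ C
  law_H : ∀ y, (ρ.restrict {w | w.2 ≤ y}).map Prod.fst =
    volume.withDensity fun x => ENNReal.ofReal (H x y)
  law_f : ρ.map Prod.fst = volume.withDensity fun x => ENNReal.ofReal (f x)
  lower : ∀ x, |x - q| ≤ ε → c ≤ f x
  lipschitz : ∀ x y, |f x - f y| ≤ C * |x - y|
  slope : ∀ x b, |x - q| ≤ ε → 0 ≤ b → b ≤ ε →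
    c * b ≤ H x (θ + b) - H x θ ∧ c * b ≤ H x θ - H x (θ - b)
  taylor : ∃ d, |d| ≤ C ∧ ∀ x, |H x θ - β * f x - d * (x - q)| ≤ C * ((x - q) ^ 2 + δ)
  level : |ρ.real {w | w.1 < q} - α| ≤ C * δ
  tail : ∀ x y, 1 ≤ y → H x (θ - y) ≤ C / √y ∧ f x - H x (θ + y) ≤ C / √y
  tail_mass : ∀ y, 1 ≤ y → ρ.real {w | w.2 ≤ θ - y} ≤ C / y ∧
    ρ.real {w | θ + y < w.2} ≤ C / y

/-- The distribution function of the first coordinate. -/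
noncomputable def cdfFst (ρ : Measure (ℝ × ℝ)) (x : ℝ) : ℝ := ρ.real {w | w.1 < x}

theorem cdfFst_nonneg (ρ : Measure (ℝ × ℝ)) (x : ℝ) : 0 ≤ cdfFst ρ x := measureReal_nonneg

theorem cdfFst_le_one (ρ : Measure (ℝ × ℝ)) [IsProbabilityMeasure ρ] (x : ℝ) :
    cdfFst ρ x ≤ 1 := measureReal_le_one

theorem cdfFst_mono (ρ : Measure (ℝ × ℝ)) [IsProbabilityMeasure ρ] : Monotone (cdfFst ρ) :=
  fun _ _ h => measureReal_mono (fun _ hw => lt_of_lt_of_le hw h) (measure_ne_top _ _)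

theorem abs_orderWeight_cdfFst_le (ρ : Measure (ℝ × ℝ)) [IsProbabilityMeasure ρ] (h r : ℕ)
    (x : ℝ) : |orderWeight h r (cdfFst ρ x)| ≤ h * (h - 1).choose (r - 1) := by
  have h0 := cdfFst_nonneg ρ x
  have h1 := cdfFst_le_one ρ x
  rw [abs_of_nonneg (orderWeight_nonneg h0 h1)]
  unfold orderWeight
  have e1 : cdfFst ρ x ^ (r - 1) ≤ 1 := pow_le_one₀ h0 h1
  have e2 : (1 - cdfFst ρ x) ^ (h - r) ≤ 1 := pow_le_one₀ (by linarith) (by linarith)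
  have e3 : 0 ≤ cdfFst ρ x ^ (r - 1) := by positivity
  calc _ = (h * (h - 1).choose (r - 1) : ℝ) *
        (cdfFst ρ x ^ (r - 1) * (1 - cdfFst ρ x) ^ (h - r)) := by ring
    _ ≤ (h * (h - 1).choose (r - 1) : ℝ) * 1 := by
        gcongr
        exact mul_le_one₀ e1 (pow_nonneg (by linarith) _) e2
    _ = _ := mul_one _

theorem measurable_orderWeight_cdfFst (ρ : Measure (ℝ × ℝ)) [IsProbabilityMeasure ρ] (h r : ℕ) :
    Measurable fun x => orderWeight h r (cdfFst ρ x) :=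
  (orderWeight_continuous h r).measurable.comp (cdfFst_mono ρ).measurable

theorem NoisyPair.mono {ρ : Measure (ℝ × ℝ)} {f : ℝ → ℝ} {H : ℝ → ℝ → ℝ}
    {α β q θ C C' c ε δ : ℝ} (N : NoisyPair ρ f H α β q θ C c ε δ) (hC : C ≤ C') (hδ : 0 ≤ δ) :
    NoisyPair ρ f H α β q θ C' c ε δ where
  measurable_H := N.measurable_H
  H_nonneg := N.H_nonneg
  H_mono := N.H_mono
  H_le := N.H_le
  f_le x := (N.f_le x).trans hC
  law_H := N.law_H
  law_f := N.law_f
  lower := N.lower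
  lipschitz x y := (N.lipschitz x y).trans (by gcongr)
  slope := N.slope
  taylor := by
    obtain ⟨d, hd, h⟩ := N.taylor
    exact ⟨d, hd.trans hC, fun x => (h x).trans (by gcongr)⟩
  level := N.level.trans (by gcongr)
  tail x y hy := ⟨(N.tail x y hy).1.trans (by gcongr), (N.tail x y hy).2.trans (by gcongr)⟩
  tail_mass y hy := ⟨(N.tail_mass y hy).1.trans (by gcongr),
    (N.tail_mass y hy).2.trans (by gcongr)⟩

namespace NoisyPair

set_option linter.unusedSectionVars false

variable {ρ : Measure (ℝ × ℝ)} [IsProbabilityMeasure ρ] {f : ℝ → ℝ} {H : ℝ → ℝ → ℝ}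
  {α β q θ C c ε δ : ℝ} (N : NoisyPair ρ f H α β q θ C c ε δ)

include N

theorem f_nonneg (x : ℝ) : 0 ≤ f x := (N.H_nonneg x 0).trans (N.H_le x 0)

theorem continuous_f : Continuous f := by
  have hC : 0 ≤ C := (N.f_nonneg 0).trans (N.f_le 0)
  refine (LipschitzWith.of_dist_le_mul (K := ⟨C, hC⟩) fun x y => ?_).continuous
  exact N.lipschitz x y

/-- The first coordinate has a density. Ties within a batch are therefore negligible and the formula
for the law of the concomitant applies. -/
theorem atomless (x : ℝ) : ρ {w | w.1 = x} = 0 := by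
  have h : ρ {w | w.1 = x} = ρ.map Prod.fst {x} := by
    rw [Measure.map_apply measurable_fst (measurableSet_singleton x)]
    rfl
  rw [h, N.law_f, withDensity_apply _ (measurableSet_singleton x)]
  simp

theorem integrable_f : Integrable f := by
  refine ⟨N.continuous_f.aestronglyMeasurable, ?_⟩
  rw [hasFiniteIntegral_iff_ofReal (Eventually.of_forall N.f_nonneg)]
  have h := congrArg (fun m => m univ) N.law_f
  rw [withDensity_apply _ MeasurableSet.univ, Measure.restrict_univ] at h
  rw [← h]
  exact measure_lt_top _ _

theorem integral_fst (g : ℝ → ℝ) (hg : Measurable g) : ∫ w, g w.1 ∂ρ = ∫ x, f x * g x := by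
  have h : ∫ w, g w.1 ∂ρ = ∫ x, g x ∂(ρ.map Prod.fst) :=
    (integral_map measurable_fst.aemeasurable hg.aestronglyMeasurable).symm
  rw [h, N.law_f, integral_withDensity_eq_integral_toReal_smul]
  · simp [ENNReal.toReal_ofReal (N.f_nonneg _)]
  · exact N.continuous_f.measurable.ennreal_ofReal
  · simp

theorem integral_indicator_snd (y : ℝ) (g : ℝ → ℝ) (hg : Measurable g) :
    ∫ w, (Iic y).indicator 1 w.2 * g w.1 ∂ρ = ∫ x, H x y * g x := by
  have hm : MeasurableSet {w : ℝ × ℝ | w.2 ≤ y} := measurableSet_le measurable_snd measurable_const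
  have h : ∫ x, g x ∂((ρ.restrict {w | w.2 ≤ y}).map Prod.fst) =
      ∫ w, g w.1 ∂(ρ.restrict {w | w.2 ≤ y}) :=
    integral_map measurable_fst.aemeasurable hg.aestronglyMeasurable
  have h2 : ∫ w, (Iic y).indicator 1 w.2 * g w.1 ∂ρ = ∫ w, g w.1 ∂(ρ.restrict {w | w.2 ≤ y}) := by
    rw [← integral_indicator hm]
    refine integral_congr_ae (Eventually.of_forall fun w => ?_)
    by_cases hw : w.2 ≤ y <;> simp [indicator, hw]
  rw [h2, ← h, N.law_H, integral_withDensity_eq_integral_toReal_smul]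
  · simp [ENNReal.toReal_ofReal (N.H_nonneg _ _)]
  · exact (N.measurable_H y).ennreal_ofReal
  · simp

theorem integrable_mul {g u : ℝ → ℝ} (hg : Measurable g) (hu : Measurable u) {K K' : ℝ}
    (hgK : ∀ x, |g x| ≤ K * f x) (huK : ∀ x, |u x| ≤ K') : Integrable fun x => g x * u x := by
  refine Integrable.mono' ((N.integrable_f.const_mul (K * K')))
    (hg.mul hu).aestronglyMeasurable (Eventually.of_forall fun x => ?_)
  rw [Real.norm_eq_abs, abs_mul]
  have h0 := (abs_nonneg _).trans (hgK x)
  calc |g x| * |u x| ≤ (K * f x) * K' := by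
        gcongr
        · exact hgK x
        · exact huK x
    _ = _ := by ring

theorem cdf_sub (x y : ℝ) : cdfFst ρ y - cdfFst ρ x = ∫ t in x..y, f t := by
  have hle : ∀ x y, x ≤ y → cdfFst ρ y - cdfFst ρ x = ∫ t in x..y, f t := by
    intro x y hxy
    have hd : {w : ℝ × ℝ | w.1 < y} \ {w | w.1 < x} = Prod.fst ⁻¹' (Ico x y) := by
      ext w; simp [and_comm]
    have hsub : {w : ℝ × ℝ | w.1 < x} ⊆ {w | w.1 < y} := fun _ hw => lt_of_lt_of_le hw hxy
    unfold cdfFst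
    rw [← measureReal_sdiff hsub (measurableSet_lt measurable_fst measurable_const), hd,
      measureReal_def, ← Measure.map_apply measurable_fst measurableSet_Ico, N.law_f,
      withDensity_apply _ measurableSet_Ico,
      intervalIntegral.integral_of_le hxy, ← integral_Ico_eq_integral_Ioc,
      integral_eq_lintegral_of_nonneg_ae (Eventually.of_forall N.f_nonneg)
        N.continuous_f.aestronglyMeasurable]
  rcases le_total x y with h | h
  · exact hle x y h
  · rw [intervalIntegral.integral_symm, ← hle y x h]; ring

theorem abs_cdf_sub_le (x : ℝ) : |cdfFst ρ x - cdfFst ρ q| ≤ C * |x - q| := by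
  rw [N.cdf_sub]
  exact intervalIntegral.norm_integral_le_of_norm_le_const fun t _ => by
    rw [Real.norm_of_nonneg (N.f_nonneg t)]; exact N.f_le t

theorem abs_cdf_sub_sub_le (x : ℝ) :
    |cdfFst ρ x - cdfFst ρ q - f q * (x - q)| ≤ C * (x - q) ^ 2 := by
  have hi : ∀ a b, IntervalIntegrable f volume a b := fun a b =>
    N.continuous_f.intervalIntegrable a b
  have hC : 0 ≤ C := (N.f_nonneg 0).trans (N.f_le 0)
  have h : cdfFst ρ x - cdfFst ρ q - f q * (x - q) = ∫ t in q..x, (f t - f q) := by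
    rw [intervalIntegral.integral_sub (hi _ _) (by simp), N.cdf_sub]
    simp; ring
  rw [h]
  have := intervalIntegral.norm_integral_le_of_norm_le_const (a := q) (b := x)
    (f := fun t => f t - f q) (C := C * |x - q|) fun t ht => by
      refine (N.lipschitz t q).trans ?_
      refine mul_le_mul_of_nonneg_left ?_ hC
      rcases le_total q x with hqx | hqx
      · rw [uIoc_of_le hqx] at ht
        rw [abs_of_pos (by linarith [ht.1]), abs_of_nonneg (by linarith)]
        linarith [ht.2]
      · rw [uIoc_of_ge hqx] at ht
        rw [abs_of_nonpos (by linarith [ht.2]), abs_of_nonpos (by linarith)]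
        linarith [ht.1]
  rw [Real.norm_eq_abs] at this
  calc _ ≤ _ := this
    _ = C * (x - q) ^ 2 := by rw [← sq_abs (x - q)]; ring

theorem le_abs_cdf_sub {x : ℝ} (hx : |x - q| ≤ ε) :
    c * |x - q| ≤ |cdfFst ρ x - cdfFst ρ q| := by
  have hi : ∀ a b, IntervalIntegrable f volume a b := fun a b =>
    N.continuous_f.intervalIntegrable a b
  have hx' := abs_le.1 hx
  rcases le_total q x with hqx | hqx
  · have := intervalIntegral.integral_mono_on hqx (μ := volume) (f := fun _ => c) (by simp)
      (hi q x) fun t ht => N.lower t (by rw [abs_le]; constructor <;> linarith [ht.1, ht.2])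
    rw [← N.cdf_sub, intervalIntegral.integral_const, smul_eq_mul] at this
    rw [abs_of_nonneg (by linarith : 0 ≤ x - q)]
    refine le_trans ?_ (le_abs_self _)
    linarith
  · have := intervalIntegral.integral_mono_on hqx (μ := volume) (f := fun _ => c) (by simp)
      (hi x q) fun t ht => N.lower t (by rw [abs_le]; constructor <;> linarith [ht.1, ht.2])
    rw [← N.cdf_sub, intervalIntegral.integral_const, smul_eq_mul] at this
    rw [abs_of_nonpos (by linarith : x - q ≤ 0)]
    refine le_trans ?_ (neg_le_abs _)
    linarith

theorem far_le_abs_cdf_sub (hε : 0 < ε) {x : ℝ} (hx : ε < |x - q|) :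
    c * ε ≤ |cdfFst ρ x - cdfFst ρ q| := by
  rcases le_total q x with hqx | hqx
  · rw [abs_of_nonneg (by linarith : 0 ≤ x - q)] at hx
    have h := N.le_abs_cdf_sub (x := q + ε) (by simp [abs_of_pos hε])
    have m1 := cdfFst_mono ρ (by linarith : q ≤ q + ε)
    have m2 := cdfFst_mono ρ (by linarith : q + ε ≤ x)
    rw [abs_of_nonneg (by linarith : 0 ≤ cdfFst ρ (q + ε) - cdfFst ρ q), add_sub_cancel_left,
      abs_of_pos hε] at h
    rw [abs_of_nonneg (by linarith)]
    linarith
  · rw [abs_of_nonpos (by linarith : x - q ≤ 0)] at hx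
    have h := N.le_abs_cdf_sub (x := q - ε) (by simp [abs_of_pos hε])
    have m1 := cdfFst_mono ρ (by linarith : q - ε ≤ q)
    have m2 := cdfFst_mono ρ (by linarith : x ≤ q - ε)
    rw [abs_of_nonpos (by linarith : cdfFst ρ (q - ε) - cdfFst ρ q ≤ 0), sub_sub_cancel_left,
      abs_neg, abs_of_pos hε] at h
    rw [abs_of_nonpos (by linarith)]
    linarith

/-- On the scale of `cdfFst ρ`, the defect `H · θ - β f` is linear up to a quadratic error. -/
theorem exists_linearization (hε : 0 < ε) (hc : 0 < c) (hδ : 0 ≤ δ) (hβ : β ∈ Ioo (0 : ℝ) 1) :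
    ∃ c₁, |c₁| ≤ C / c ^ 2 ∧ ∀ x, |H x θ - β * f x - c₁ * f x * (cdfFst ρ x - cdfFst ρ q)| ≤
      ((C + 2 * C ^ 3 / c ^ 2) / c ^ 3 + C / c + (1 + C / c ^ 2) / (c * ε) ^ 2) *
        (f x * ((cdfFst ρ x - cdfFst ρ q) ^ 2 + δ)) := by
  obtain ⟨d, hd, hD⟩ := N.taylor
  have hfq : c ≤ f q := N.lower q (by simp [hε.le])
  have hfq0 : 0 < f q := hc.trans_le hfq
  have hC : 0 < C := hfq0.trans_le (N.f_le q)
  have hc1 : |d / f q ^ 2| ≤ C / c ^ 2 := by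
    rw [abs_div, abs_of_pos (by positivity : (0 : ℝ) < f q ^ 2)]
    gcongr
  -- Near `q` the increment of `cdfFst ρ` is about `f q * (x - q)`, and `f x` is about `f q`;
  -- dividing `d` by `f q ^ 2` makes the two linear terms agree.
  refine ⟨d / f q ^ 2, hc1, fun x => ?_⟩
  set c₁ := d / f q ^ 2 with hc₁
  set u := cdfFst ρ x - cdfFst ρ q with hu
  have hfx := N.f_nonneg x
  have hu1 : |u| ≤ 1 := by
    have := cdfFst_nonneg ρ x
    have := cdfFst_nonneg ρ q
    have := cdfFst_le_one ρ x
    have := cdfFst_le_one ρ q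
    rw [abs_le]; constructor <;> linarith
  rcases le_or_gt |x - q| ε with hx | hx
  · have a1 := N.abs_cdf_sub_le x
    have a2 := N.abs_cdf_sub_sub_le x
    have a3 := N.le_abs_cdf_sub hx
    have a4 := N.lipschitz x q
    have hfc := N.lower x hx
    rw [← hu] at a1 a2 a3
    have hdd : d = c₁ * f q ^ 2 := by rw [hc₁]; field_simp
    have e : H x θ - β * f x - c₁ * f x * u =
        (H x θ - β * f x - d * (x - q)) - c₁ * ((f x - f q) * u) -
          c₁ * (f q * (u - f q * (x - q))) := by
      rw [hdd]; ring
    have b1 : |(f x - f q) * u| ≤ C ^ 2 * (x - q) ^ 2 := by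
      rw [abs_mul]
      calc _ ≤ (C * |x - q|) * (C * |x - q|) := by gcongr
        _ = _ := by rw [← sq_abs (x - q)]; ring
    have b2 : |f q * (u - f q * (x - q))| ≤ C ^ 2 * (x - q) ^ 2 := by
      rw [abs_mul, abs_of_pos hfq0]
      calc _ ≤ C * (C * (x - q) ^ 2) := by
            gcongr
            exact N.f_le q
        _ = _ := by ring
    -- The lower bound on `f` lets distances to `q` be measured by `u`. Together with `hone` it puts
    -- the error in the form `f x * (...)`, whose integral against the weight is explicit.
    have hsq : (x - q) ^ 2 ≤ u ^ 2 / c ^ 2 := by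
      rw [le_div_iff₀ (by positivity), ← sq_abs (x - q), ← sq_abs u, ← mul_pow, mul_comm]
      gcongr
    have hone : 1 ≤ f x / c := by rwa [le_div_iff₀ hc, one_mul]
    have main : |H x θ - β * f x - c₁ * f x * u| ≤
        (C + 2 * C ^ 3 / c ^ 2) * (x - q) ^ 2 + C * δ := by
      rw [e]
      refine (abs_sub _ _).trans ((add_le_add_left (abs_sub _ _) _).trans ?_)
      rw [abs_mul c₁, abs_mul c₁]
      calc _ ≤ C * ((x - q) ^ 2 + δ) + C / c ^ 2 * (C ^ 2 * (x - q) ^ 2) +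
            C / c ^ 2 * (C ^ 2 * (x - q) ^ 2) := by
            gcongr
            exact hD x
        _ = _ := by ring
    have hz : 0 ≤ (1 + C / c ^ 2) / (c * ε) ^ 2 * (f x * (u ^ 2 + δ)) := by positivity
    calc _ ≤ (C + 2 * C ^ 3 / c ^ 2) * (x - q) ^ 2 + C * δ := main
      _ ≤ ((C + 2 * C ^ 3 / c ^ 2) * (u ^ 2 / c ^ 2) + C * δ) * 1 := by
          rw [mul_one]; gcongr
      _ ≤ ((C + 2 * C ^ 3 / c ^ 2) * (u ^ 2 / c ^ 2) + C * δ) * (f x / c) := by gcongr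
      _ = (C + 2 * C ^ 3 / c ^ 2) / c ^ 3 * (f x * u ^ 2) + C / c * (f x * δ) := by
          field_simp
      _ ≤ (C + 2 * C ^ 3 / c ^ 2) / c ^ 3 * (f x * (u ^ 2 + δ)) +
          C / c * (f x * (u ^ 2 + δ)) := by
          gcongr
          · linarith
          · linarith [sq_nonneg u]
      _ ≤ _ := by
          linarith
  -- Away from `q` no expansion is needed: `u ^ 2` is bounded below by `(c * ε) ^ 2`, so the crude
  -- bound by a multiple of `f x` is absorbed in the quadratic error.
  · have hfar := N.far_le_abs_cdf_sub hε hx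
    rw [← hu] at hfar
    have h1 : 1 ≤ u ^ 2 / (c * ε) ^ 2 := by
      rw [le_div_iff₀ (by positivity), one_mul, ← sq_abs u]
      gcongr
    have hD1 : |H x θ - β * f x| ≤ f x := by
      have := N.H_nonneg x θ
      have := N.H_le x θ
      rw [abs_le]
      constructor <;> nlinarith [hβ.1, hβ.2]
    have hz : 0 ≤ ((C + 2 * C ^ 3 / c ^ 2) / c ^ 3 + C / c) * (f x * (u ^ 2 + δ)) := by positivity
    calc |H x θ - β * f x - c₁ * f x * u| ≤ |H x θ - β * f x| + |c₁| * f x * |u| := by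
          refine (abs_sub _ _).trans ?_
          rw [abs_mul, abs_mul, abs_of_nonneg hfx]
      _ ≤ f x + C / c ^ 2 * f x * 1 := by gcongr
      _ = (1 + C / c ^ 2) * f x * 1 := by ring
      _ ≤ (1 + C / c ^ 2) * f x * (u ^ 2 / (c * ε) ^ 2) := by gcongr
      _ = (1 + C / c ^ 2) / (c * ε) ^ 2 * (f x * u ^ 2) := by field_simp
      _ ≤ (1 + C / c ^ 2) / (c * ε) ^ 2 * (f x * (u ^ 2 + δ)) := by
          gcongr
          linarith
      _ ≤ _ := by linarith

end NoisyPair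

/-! ### Bias, growth and tails of the batch output -/

/-- The law of the concomitant of the `r`-th order statistic in a batch of `h` pairs. -/
noncomputable def concomitantLaw (ρ : Measure (ℝ × ℝ)) (h r : ℕ) : Measure ℝ :=
  (Measure.pi fun _ : Fin h => ρ).map
    fun w => concomitant (fun j => (w j).1) (fun j => (w j).2) r

theorem measurable_concomitant_pairs (h r : ℕ) :
    Measurable fun w : Fin h → ℝ × ℝ => concomitant (fun j => (w j).1) (fun j => (w j).2) r :=
  measurable_concomitant (by fun_prop) (by fun_prop) r

instance (ρ : Measure (ℝ × ℝ)) [IsProbabilityMeasure ρ] (h r : ℕ) :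
    IsProbabilityMeasure (concomitantLaw ρ h r) :=
  Measure.isProbabilityMeasure_map (measurable_concomitant_pairs h r).aemeasurable

/-- The rank `⌈α h⌉` is within one of `α h`. -/
theorem ceil_rank_bounds {α : ℝ} (hα : α ∈ Ioo (0 : ℝ) 1) {h : ℕ} (hh : 1 ≤ h) :
    1 ≤ ⌈α * h⌉₊ ∧ ⌈α * h⌉₊ ≤ h ∧ α * h ≤ ⌈α * h⌉₊ ∧ (⌈α * h⌉₊ : ℝ) < α * h + 1 := by
  have h0 : (0 : ℝ) < h := by exact_mod_cast hh
  refine ⟨Nat.one_le_iff_ne_zero.2 (Nat.ceil_pos.2 (mul_pos hα.1 h0)).ne', ?_, Nat.le_ceil _,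
    Nat.ceil_lt_add_one (mul_pos hα.1 h0).le⟩
  refine Nat.ceil_le.2 ?_
  nlinarith [hα.2]

namespace NoisyPair

set_option linter.unusedSectionVars false

variable {ρ : Measure (ℝ × ℝ)} [IsProbabilityMeasure ρ] {f : ℝ → ℝ} {H : ℝ → ℝ → ℝ}
  {α β q θ C c ε δ : ℝ} (N : NoisyPair ρ f H α β q θ C c ε δ)

include N

theorem concomitantLaw_Iic {h r : ℕ} (hr : 1 ≤ r) (hrh : r ≤ h) (y : ℝ) :
    (concomitantLaw ρ h r).real (Iic y) = ∫ x, H x y * orderWeight h r (cdfFst ρ x) := by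
  rw [← N.integral_indicator_snd y _ (measurable_orderWeight_cdfFst ρ h r), concomitantLaw,
    measureReal_def, Measure.map_apply (measurable_concomitant_pairs h r) measurableSet_Iic]
  exact pi_concomitant_mem ρ N.atomless hr hrh measurableSet_Iic

/-- The concomitant has some value with probability one. Taking the sure event in its law normalises
the Beta density. -/
theorem integral_orderWeight {h r : ℕ} (hr : 1 ≤ r) (hrh : r ≤ h) :
    ∫ x, f x * orderWeight h r (cdfFst ρ x) = 1 := by
  rw [← N.integral_fst _ (measurable_orderWeight_cdfFst ρ h r)]
  have := pi_concomitant_mem ρ N.atomless hr hrh MeasurableSet.univ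
  simp only [mem_univ, ofPred_true, probReal_univ, indicator_univ, Pi.one_apply, one_mul] at this
  exact this.symm

theorem integrable_mul_orderWeight {g : ℝ → ℝ} (hg : Measurable g) {K : ℝ}
    (hgK : ∀ x, |g x| ≤ K * f x) (h r : ℕ) :
    Integrable fun x => g x * orderWeight h r (cdfFst ρ x) :=
  N.integrable_mul hg (measurable_orderWeight_cdfFst ρ h r) hgK (abs_orderWeight_cdfFst_le ρ h r)

theorem integrable_f_mul_orderWeight (h r : ℕ) :
    Integrable fun x => f x * orderWeight h r (cdfFst ρ x) :=
  N.integrable_mul_orderWeight (K := 1) N.continuous_f.measurable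
    (fun x => by rw [abs_of_nonneg (N.f_nonneg x), one_mul]) h r

theorem integrable_H_mul_orderWeight (y : ℝ) (h r : ℕ) :
    Integrable fun x => H x y * orderWeight h r (cdfFst ρ x) :=
  N.integrable_mul_orderWeight (K := 1) (N.measurable_H y)
    (fun x => by rw [abs_of_nonneg (N.H_nonneg x y), one_mul]; exact N.H_le x y) h r

theorem integrable_cdf_mul_orderWeight (h r : ℕ) :
    Integrable fun x => f x * cdfFst ρ x * orderWeight h r (cdfFst ρ x) :=
  N.integrable_mul_orderWeight (K := 1)
    (N.continuous_f.measurable.mul (cdfFst_mono ρ).measurable)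
    (fun x => by
      change |f x * cdfFst ρ x| ≤ _
      rw [abs_of_nonneg (mul_nonneg (N.f_nonneg x) (cdfFst_nonneg ρ x)), one_mul]
      exact mul_le_of_le_one_right (N.f_nonneg x) (cdfFst_le_one ρ x)) h r

theorem integrable_cdf_sq_mul_orderWeight (h r : ℕ) :
    Integrable fun x => f x * cdfFst ρ x ^ 2 * orderWeight h r (cdfFst ρ x) :=
  N.integrable_mul_orderWeight (K := 1)
    (N.continuous_f.measurable.mul ((cdfFst_mono ρ).measurable.pow_const 2))
    (fun x => by
      change |f x * cdfFst ρ x ^ 2| ≤ _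
      rw [abs_of_nonneg (mul_nonneg (N.f_nonneg x) (sq_nonneg _)), one_mul]
      exact mul_le_of_le_one_right (N.f_nonneg x)
        (pow_le_one₀ (cdfFst_nonneg ρ x) (cdfFst_le_one ρ x))) h r

theorem integral_cdf_mul_orderWeight {h r : ℕ} (hr : 1 ≤ r) (hrh : r ≤ h) :
    ∫ x, f x * cdfFst ρ x * orderWeight h r (cdfFst ρ x) = r / (h + 1) := by
  have : (fun x => f x * cdfFst ρ x * orderWeight h r (cdfFst ρ x)) =
      fun x => r / (h + 1) * (f x * orderWeight (h + 1) (r + 1) (cdfFst ρ x)) := by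
    ext x
    rw [mul_assoc, mul_orderWeight hr hrh]
    ring
  rw [this, integral_const_mul, N.integral_orderWeight (by omega) (by omega), mul_one]

theorem integral_cdf_sq_mul_orderWeight {h r : ℕ} (hr : 1 ≤ r) (hrh : r ≤ h) :
    ∫ x, f x * cdfFst ρ x ^ 2 * orderWeight h r (cdfFst ρ x) =
      r / (h + 1) * ((r + 1) / (h + 2)) := by
  have : (fun x => f x * cdfFst ρ x ^ 2 * orderWeight h r (cdfFst ρ x)) =
      fun x => r / (h + 1) *
        (f x * cdfFst ρ x * orderWeight (h + 1) (r + 1) (cdfFst ρ x)) := by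
    ext x
    have := mul_orderWeight hr hrh (cdfFst ρ x)
    linear_combination f x * cdfFst ρ x * this
  rw [this, integral_const_mul, N.integral_cdf_mul_orderWeight (by omega) (by omega)]
  push_cast
  ring

theorem integrable_sq_mul_orderWeight (a : ℝ) (h r : ℕ) :
    Integrable fun x => f x * (cdfFst ρ x - a) ^ 2 * orderWeight h r (cdfFst ρ x) := by
  have := ((N.integrable_cdf_sq_mul_orderWeight h r).sub
    ((N.integrable_cdf_mul_orderWeight h r).const_mul (2 * a))).add
    ((N.integrable_f_mul_orderWeight h r).const_mul (a ^ 2))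
  refine this.congr (Eventually.of_forall fun x => ?_)
  simp only [Pi.add_apply, Pi.sub_apply]
  ring

/-- The mean square deviation of a uniform order statistic from a given level. -/
theorem integral_sq_mul_orderWeight (a : ℝ) {h r : ℕ} (hr : 1 ≤ r) (hrh : r ≤ h) :
    ∫ x, f x * (cdfFst ρ x - a) ^ 2 * orderWeight h r (cdfFst ρ x) =
      (r / (h + 1) - a) ^ 2 + r * (h + 1 - r) / ((h + 1) ^ 2 * (h + 2)) := by
  have e : (fun x => f x * (cdfFst ρ x - a) ^ 2 * orderWeight h r (cdfFst ρ x)) = fun x =>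
      (f x * cdfFst ρ x ^ 2 * orderWeight h r (cdfFst ρ x) -
        2 * a * (f x * cdfFst ρ x * orderWeight h r (cdfFst ρ x))) +
        a ^ 2 * (f x * orderWeight h r (cdfFst ρ x)) := by
    ext x; ring
  rw [e, integral_add, integral_sub, integral_const_mul, integral_const_mul,
    N.integral_cdf_sq_mul_orderWeight hr hrh, N.integral_cdf_mul_orderWeight hr hrh,
    N.integral_orderWeight hr hrh]
  · field_simp
    ring
  · exact N.integrable_cdf_sq_mul_orderWeight h r
  · exact (N.integrable_cdf_mul_orderWeight h r).const_mul _
  · exact (N.integrable_cdf_sq_mul_orderWeight h r).sub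
      ((N.integrable_cdf_mul_orderWeight h r).const_mul _)
  · exact (N.integrable_f_mul_orderWeight h r).const_mul _

theorem abs_rank_sub_le (hα : α ∈ Ioo (0 : ℝ) 1) {h : ℕ} (hh : 1 ≤ h) :
    |(⌈α * h⌉₊ : ℝ) / (h + 1) - cdfFst ρ q| ≤ 1 / h + C * δ := by
  obtain ⟨-, -, r3, r4⟩ := ceil_rank_bounds hα hh
  have hl := N.level
  have h0 : (0 : ℝ) < h := by exact_mod_cast hh
  have h1 : |(⌈α * h⌉₊ : ℝ) / (h + 1) - α| ≤ 1 / h := by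
    have : (⌈α * h⌉₊ : ℝ) / (h + 1) - α = (⌈α * h⌉₊ - α * h - α) / (h + 1) := by
      field_simp; ring
    rw [this, abs_div, abs_of_pos (by linarith : (0 : ℝ) < h + 1)]
    refine div_le_div₀ zero_le_one ?_ h0 (by linarith)
    rw [abs_le]
    constructor <;> linarith [hα.1, hα.2]
  calc _ = |((⌈α * h⌉₊ : ℝ) / (h + 1) - α) - (cdfFst ρ q - α)| := by congr 1; ring
    _ ≤ _ := (abs_sub _ _).trans (add_le_add h1 hl)

/-- Squared bias plus variance of a uniform order statistic. The variance is of order `1 / h`; the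
bias combines rank rounding with the shift of level caused by the noise. -/
theorem integral_sq_mul_orderWeight_le (hα : α ∈ Ioo (0 : ℝ) 1) {h : ℕ} (hh : 1 ≤ h)
    (hδ : 0 ≤ δ) (hδ1 : δ ≤ 1) :
    ∫ x, f x * (cdfFst ρ x - cdfFst ρ q) ^ 2 * orderWeight h ⌈α * h⌉₊ (cdfFst ρ x) ≤
      (3 + 2 * C ^ 2) * (1 / h + δ) := by
  obtain ⟨r1, r2, r3, r4⟩ := ceil_rank_bounds hα hh
  rw [N.integral_sq_mul_orderWeight _ r1 r2]
  have ha := N.abs_rank_sub_le hα hh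
  set r := ⌈α * h⌉₊
  have h1 : (1 : ℝ) ≤ h := by exact_mod_cast hh
  have hr2 : (r : ℝ) ≤ h := by exact_mod_cast r2
  have hr0 : (0 : ℝ) ≤ r := by positivity
  have e1 : ((r : ℝ) / (h + 1) - cdfFst ρ q) ^ 2 ≤ (1 / h + C * δ) ^ 2 := by
    rw [← sq_abs]
    gcongr
  have e2 : (r : ℝ) * (h + 1 - r) / ((h + 1) ^ 2 * (h + 2)) ≤ 1 / h := by
    rw [div_le_div_iff₀ (by positivity) (by linarith)]
    have : (r : ℝ) * (h + 1 - r) ≤ (h + 1) ^ 2 := by nlinarith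
    have h3 : (h : ℝ) ≤ h + 2 := by linarith
    nlinarith [mul_le_mul this h3 (by linarith) (by positivity)]
  have e3 : (1 / (h : ℝ) + C * δ) ^ 2 ≤ 2 * (1 / h) + 2 * C ^ 2 * δ := by
    have hi : 1 / (h : ℝ) ≤ 1 := by rw [div_le_one (by linarith)]; exact h1
    have hi0 : 0 ≤ 1 / (h : ℝ) := by positivity
    have a1 : (1 / (h : ℝ)) ^ 2 ≤ 1 / h := by nlinarith
    have a2 : δ ^ 2 ≤ δ := by nlinarith
    have a3 : C ^ 2 * δ ^ 2 ≤ C ^ 2 * δ := by gcongr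
    nlinarith [sq_nonneg (1 / (h : ℝ) - C * δ)]
  have hi0 : 0 ≤ 1 / (h : ℝ) := by positivity
  have : 0 ≤ C ^ 2 * (1 / (h : ℝ)) := by positivity
  nlinarith

/-- The bias of the batch distribution function at `θ`. -/
theorem exists_bias_le (hα : α ∈ Ioo (0 : ℝ) 1) (hβ : β ∈ Ioo (0 : ℝ) 1) (hε : 0 < ε)
    (hc : 0 < c) (hδ : 0 ≤ δ) (hδ1 : δ ≤ 1) {h : ℕ} (hh : 1 ≤ h) :
    |(concomitantLaw ρ h ⌈α * h⌉₊).real (Iic θ) - β| ≤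
      (((C + 2 * C ^ 3 / c ^ 2) / c ^ 3 + C / c + (1 + C / c ^ 2) / (c * ε) ^ 2) *
        (4 + 2 * C ^ 2) + C / c ^ 2 * (1 + C)) * (1 / h + δ) := by
  obtain ⟨c₁, hc1, hlin⟩ := N.exists_linearization hε hc hδ hβ
  obtain ⟨r1, r2, r3, r4⟩ := ceil_rank_bounds hα hh
  have hC : 0 < C := hc.trans_le ((N.lower q (by simp [hε.le])).trans (N.f_le q))
  have hV := N.integral_sq_mul_orderWeight_le hα hh hδ hδ1
  have hR := N.abs_rank_sub_le hα hh
  rw [N.concomitantLaw_Iic r1 r2]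
  set r := ⌈α * h⌉₊
  set K := (C + 2 * C ^ 3 / c ^ 2) / c ^ 3 + C / c + (1 + C / c ^ 2) / (c * ε) ^ 2 with hK
  have hK0 : 0 ≤ K := by positivity
  set w : ℝ → ℝ := fun x => orderWeight h r (cdfFst ρ x) with hw
  have hw0 : ∀ x, 0 ≤ w x := fun x => orderWeight_nonneg (cdfFst_nonneg ρ x) (cdfFst_le_one ρ x)
  have i1 := N.integrable_H_mul_orderWeight θ h r
  have i2 := N.integrable_f_mul_orderWeight h r
  have i3 := N.integrable_cdf_mul_orderWeight h r
  have i4 := N.integrable_sq_mul_orderWeight (cdfFst ρ q) h r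
  -- The linear part of the expansion is subtracted inside the integral, so that only the quadratic
  -- error of `exists_linearization` is estimated in absolute value.
  have key : |∫ x, (H x θ * w x - β * (f x * w x) - (c₁ * (f x * cdfFst ρ x * w x) -
      c₁ * cdfFst ρ q * (f x * w x)))| ≤
      ∫ x, K * (f x * (cdfFst ρ x - cdfFst ρ q) ^ 2 * w x + δ * (f x * w x)) := by
    refine abs_integral_le_integral_abs.trans (integral_mono_of_nonneg
      (Eventually.of_forall fun x => abs_nonneg _) ((i4.add (i2.const_mul δ)).const_mul K)
      (Eventually.of_forall fun x => ?_))
    have e : H x θ * w x - β * (f x * w x) - (c₁ * (f x * cdfFst ρ x * w x) -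
      c₁ * cdfFst ρ q * (f x * w x)) =
      (H x θ - β * f x - c₁ * f x * (cdfFst ρ x - cdfFst ρ q)) * w x := by ring
    dsimp only
    rw [e, abs_mul, abs_of_nonneg (hw0 x)]
    calc _ ≤ (K * (f x * ((cdfFst ρ x - cdfFst ρ q) ^ 2 + δ))) * w x :=
          mul_le_mul_of_nonneg_right (hlin x) (hw0 x)
      _ = _ := by ring
  rw [integral_sub (f := fun x => H x θ * w x - β * (f x * w x))
      (g := fun x => c₁ * (f x * cdfFst ρ x * w x) - c₁ * cdfFst ρ q * (f x * w x))
      (i1.sub (i2.const_mul β)) ((i3.const_mul c₁).sub (i2.const_mul _)),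
    integral_sub i1 (i2.const_mul β), integral_sub (i3.const_mul c₁) (i2.const_mul _),
    integral_const_mul, integral_const_mul, integral_const_mul, integral_const_mul,
    integral_add i4 (i2.const_mul δ), integral_const_mul,
    N.integral_cdf_mul_orderWeight r1 r2, N.integral_orderWeight r1 r2] at key
  set I := ∫ x, H x θ * w x
  have hi0 : 0 ≤ 1 / (h : ℝ) := by positivity
  -- The linear part is integrated exactly. Its mean is of order `1 / h + δ`, whereas an absolute
  -- value under the integral would only give `h^{-1/2}`.
  have k1 : |c₁ * (r / (h + 1) - cdfFst ρ q)| ≤ C / c ^ 2 * ((1 + C) * (1 / h + δ)) := by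
    rw [abs_mul]
    refine mul_le_mul hc1 (hR.trans ?_) (abs_nonneg _) (by positivity)
    have : 0 ≤ C * (1 / (h : ℝ)) := by positivity
    nlinarith
  calc |I - β| = |(I - β * 1 - (c₁ * (r / (h + 1)) - c₁ * cdfFst ρ q * 1)) +
        c₁ * (r / (h + 1) - cdfFst ρ q)| := by congr 1; ring
    _ ≤ K * ((3 + 2 * C ^ 2) * (1 / h + δ) + δ * 1) + C / c ^ 2 * ((1 + C) * (1 / h + δ)) := by
        refine (abs_add_le _ _).trans (add_le_add (key.trans ?_) k1)
        gcongr
    _ ≤ K * ((3 + 2 * C ^ 2) * (1 / h + δ) + (1 / h + δ)) +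
        C / c ^ 2 * ((1 + C) * (1 / h + δ)) := by
        gcongr
        linarith
    _ = _ := by ring

/-- A function that is large near `q` has a large mean against the order statistic density. -/
theorem le_integral_mul_orderWeight (hα : α ∈ Ioo (0 : ℝ) 1) (hε : 0 < ε) (hc : 0 < c)
    (hδ : 0 ≤ δ) (hδ1 : δ ≤ 1) {h : ℕ} (hh : 1 ≤ h)
    (hsmall : (3 + 2 * C ^ 2) * (1 / h + δ) ≤ (c * ε) ^ 2 / 2) {g : ℝ → ℝ} (hg : Measurable g)
    {K m : ℝ} (hgK : ∀ x, |g x| ≤ K * f x) (hg0 : ∀ x, 0 ≤ g x) (hm : 0 ≤ m)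
    (hgm : ∀ x, |x - q| ≤ ε → m ≤ g x) :
    m / (2 * C) ≤ ∫ x, g x * orderWeight h ⌈α * h⌉₊ (cdfFst ρ x) := by
  obtain ⟨r1, r2, r3, r4⟩ := ceil_rank_bounds hα hh
  have hC : 0 < C := hc.trans_le ((N.lower q (by simp [hε.le])).trans (N.f_le q))
  have hV := N.integral_sq_mul_orderWeight_le hα hh hδ hδ1
  set r := ⌈α * h⌉₊
  set w : ℝ → ℝ := fun x => orderWeight h r (cdfFst ρ x) with hw
  have hw0 : ∀ x, 0 ≤ w x := fun x => orderWeight_nonneg (cdfFst_nonneg ρ x) (cdfFst_le_one ρ x)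
  have i2 := N.integrable_f_mul_orderWeight h r
  have i4 := N.integrable_sq_mul_orderWeight (cdfFst ρ q) h r
  -- The comparison function is at most `m` near `q`, because `f ≤ C`, and nonpositive elsewhere,
  -- because there `cdfFst ρ` differs from its value at `q` by at least `c * ε`. Its integral is
  -- explicit.
  have hmono : ∫ x, m / C * (f x * w x -
      1 / (c * ε) ^ 2 * (f x * (cdfFst ρ x - cdfFst ρ q) ^ 2 * w x)) ≤ ∫ x, g x * w x := by
    refine integral_mono ((i2.sub (i4.const_mul _)).const_mul _)
      (N.integrable_mul_orderWeight hg hgK h r) fun x => ?_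
    have hfx := N.f_nonneg x
    have e : m / C * (f x * w x -
      1 / (c * ε) ^ 2 * (f x * (cdfFst ρ x - cdfFst ρ q) ^ 2 * w x)) =
      m / C * f x * (1 - (cdfFst ρ x - cdfFst ρ q) ^ 2 / (c * ε) ^ 2) * w x := by ring
    dsimp only
    rw [e]
    refine mul_le_mul_of_nonneg_right ?_ (hw0 x)
    rcases le_or_gt |x - q| ε with hx | hx
    · refine le_trans ?_ (hgm x hx)
      calc _ ≤ m / C * f x * 1 := by
            gcongr
            linarith [show 0 ≤ (cdfFst ρ x - cdfFst ρ q) ^ 2 / (c * ε) ^ 2 by positivity]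
        _ ≤ m / C * C * 1 := by gcongr; exact N.f_le x
        _ = m := by field_simp
    · refine le_trans ?_ (hg0 x)
      refine mul_nonpos_of_nonneg_of_nonpos (by positivity) ?_
      have := N.far_le_abs_cdf_sub hε hx
      have h1 : 1 ≤ (cdfFst ρ x - cdfFst ρ q) ^ 2 / (c * ε) ^ 2 := by
        rw [le_div_iff₀ (by positivity), one_mul, ← sq_abs (cdfFst ρ x - _)]
        gcongr
      linarith
  refine le_trans ?_ hmono
  rw [integral_const_mul, integral_sub i2 (i4.const_mul _), integral_const_mul,
    N.integral_orderWeight r1 r2]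
  have h1 : 1 / (c * ε) ^ 2 * (∫ x, f x * (cdfFst ρ x - cdfFst ρ q) ^ 2 * w x) ≤ 1 / 2 := by
    rw [one_div_mul_eq_div, div_le_iff₀ (by positivity)]
    linarith
  calc m / (2 * C) = m / C * (1 - 1 / 2) := by field_simp; norm_num
    _ ≤ _ := by gcongr

/-- A function that is small near `q` and has a small integral has a small mean against the
order statistic density. -/
theorem integral_mul_orderWeight_le (hα : α ∈ Ioo (0 : ℝ) 1) (hε : 0 < ε) (hc : 0 < c)
    {h : ℕ} (hh : 2 ≤ h) (hh' : 1 / ((h : ℝ) - 1) ≤ c * ε / 4) (hCδ : C * δ ≤ c * ε / 4)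
    {g : ℝ → ℝ} (hg : Measurable g) (hg0 : ∀ x, 0 ≤ g x) {K m s : ℝ}
    (hgK : ∀ x, |g x| ≤ K * f x) (hm : 0 ≤ m) (hgm : ∀ x, |x - q| ≤ ε → g x ≤ m)
    (hgs : ∫ x, g x ≤ s) :
    ∫ x, g x * orderWeight h ⌈α * h⌉₊ (cdfFst ρ x) ≤ m / c + 4 / (c * ε) ^ 2 * s := by
  obtain ⟨r1, r2, r3, r4⟩ := ceil_rank_bounds hα (by omega : 1 ≤ h)
  set r := ⌈α * h⌉₊
  set w : ℝ → ℝ := fun x => orderWeight h r (cdfFst ρ x) with hw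
  have hw0 : ∀ x, 0 ≤ w x := fun x => orderWeight_nonneg (cdfFst_nonneg ρ x) (cdfFst_le_one ρ x)
  have i2 := N.integrable_f_mul_orderWeight h r
  have hgi : Integrable g := by
    have := N.integrable_mul hg (measurable_const (a := (1 : ℝ))) hgK (K' := 1) (by simp)
    simpa using this
  have hh2 : (2 : ℝ) ≤ h := by exact_mod_cast hh
  -- The value `η = c ε / 2` is the separation `c ε` less two quarters of it, one for rounding the
  -- rank and one for the error in the level.
  have hfar : ∀ x, ε < |x - q| → w x ≤ 4 / (c * ε) ^ 2 := by
    intro x hx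
    have h1 := N.far_le_abs_cdf_sub hε hx
    have hl := N.level
    change |cdfFst ρ q - α| ≤ C * δ at hl
    have := orderWeight_le r1 r2 hh (cdfFst_nonneg ρ x) (cdfFst_le_one ρ x)
      (η := c * ε / 2) (by positivity) (by
        have e : ((h : ℝ) - 1) * cdfFst ρ x - (r - 1) =
          (h - 1) * (cdfFst ρ x - cdfFst ρ q) + ((h - 1) * (cdfFst ρ q - α) -
            (r - 1 - α * (h - 1))) := by ring
        have b1 : |(r : ℝ) - 1 - α * (h - 1)| ≤ (h - 1) * (c * ε / 4) := by
          rw [div_le_iff₀ (by linarith)] at hh'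
          rw [abs_le]
          constructor <;> nlinarith [hα.1, hα.2]
        have b2 : |((h : ℝ) - 1) * (cdfFst ρ q - α)| ≤ (h - 1) * (c * ε / 4) := by
          rw [abs_mul, abs_of_pos (by linarith : (0 : ℝ) < h - 1)]
          refine mul_le_mul_of_nonneg_left (hl.trans hCδ) (by linarith)
        have b3 : (h - 1) * (c * ε) ≤ |((h : ℝ) - 1) * (cdfFst ρ x - cdfFst ρ q)| := by
          rw [abs_mul, abs_of_pos (by linarith : (0 : ℝ) < h - 1)]
          refine mul_le_mul_of_nonneg_left h1 (by linarith)
        rw [e]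
        have t1 := abs_sub (((h : ℝ) - 1) * (cdfFst ρ q - α)) (r - 1 - α * (h - 1))
        have t2 := abs_sub_abs_le_abs_add (((h : ℝ) - 1) * (cdfFst ρ x - cdfFst ρ q))
          ((h - 1) * (cdfFst ρ q - α) - (r - 1 - α * (h - 1)))
        nlinarith)
    refine this.trans (le_of_eq ?_)
    field_simp
    norm_num
  have hmono : ∫ x, g x * w x ≤ ∫ x, (m / c * (f x * w x) + 4 / (c * ε) ^ 2 * g x) := by
    refine integral_mono (N.integrable_mul_orderWeight hg hgK h r)
      ((i2.const_mul _).add (hgi.const_mul _)) fun x => ?_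
    have hfx := N.f_nonneg x
    have := hg0 x
    have := hw0 x
    dsimp only
    rcases le_or_gt |x - q| ε with hx | hx
    · have h1 : g x ≤ m / c * f x := by
        calc g x ≤ m / c * c := by
              rw [div_mul_cancel₀ _ hc.ne']; exact hgm x hx
          _ ≤ _ := by
              gcongr
              exact N.lower x hx
      have h2 : 0 ≤ 4 / (c * ε) ^ 2 * g x := by positivity
      nlinarith [mul_le_mul_of_nonneg_right h1 (hw0 x)]
    · have h1 := mul_le_mul_of_nonneg_left (hfar x hx) (hg0 x)
      have h2 : 0 ≤ m / c * (f x * w x) := by positivity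
      linarith
  refine hmono.trans ?_
  rw [integral_add (i2.const_mul _) (hgi.const_mul _), integral_const_mul, integral_const_mul,
    N.integral_orderWeight r1 r2, mul_one]
  gcongr

end NoisyPair

/-! ### From noisy pairs to batch laws -/

/-- Regularity of the law `τ` of one batch output: its distribution function is `s`-close to `β`
at `θ`, grows at rate `a` around `θ`, and its tails decay like an inverse square root. -/
structure BatchLaw (τ : Measure ℝ) (β θ A a ε s : ℝ) : Prop where
  near : ∀ b, 0 ≤ b → b ≤ ε →
    β + a * b - A * s ≤ τ.real (Iic (θ + b)) ∧ τ.real (Iic (θ - b)) ≤ β - a * b + A * s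
  tail : ∀ y, 1 ≤ y → τ.real (Iic (θ - y)) ≤ A / √y ∧ 1 - τ.real (Iic (θ + y)) ≤ A / √y

/-- Bias at `θ`, growth around `θ` and tails are three means against the same weight. All constants
are fixed before the law `ρ`, hence serve every inner sample size and every large batch size. -/
theorem NoisyPair.exists_batchLaw {α β q θ C c ε : ℝ} (hα : α ∈ Ioo (0 : ℝ) 1)
    (hβ : β ∈ Ioo (0 : ℝ) 1) (hε : 0 < ε) (hc : 0 < c) (hC : 0 < C) :
    ∃ A a, 0 < A ∧ 0 < a ∧ ∃ h₀ : ℕ, ∃ δ₀ > 0, ∀ h ≥ h₀, ∀ δ, 0 ≤ δ → δ ≤ δ₀ →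
      ∀ (ρ : Measure (ℝ × ℝ)) [IsProbabilityMeasure ρ] (f : ℝ → ℝ) (H : ℝ → ℝ → ℝ),
        NoisyPair ρ f H α β q θ C c ε δ →
        BatchLaw (concomitantLaw ρ h ⌈α * h⌉₊) β θ A a ε (1 / h + δ) := by
  set A₁ := ((C + 2 * C ^ 3 / c ^ 2) / c ^ 3 + C / c + (1 + C / c ^ 2) / (c * ε) ^ 2) *
        (4 + 2 * C ^ 2) + C / c ^ 2 * (1 + C) with hA₁
  set A₂ := C / c + 4 / (c * ε) ^ 2 * C with hA₂
  have hA1 : 0 < A₁ := by positivity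
  have hA2 : 0 < A₂ := by positivity
  -- The summands ensure, in order, `2 ≤ h`, the rank rounding bound `e1`, and half of the smallness
  -- condition `hsmall`; the other half comes from `δ₀`.
  obtain ⟨n, hn⟩ := exists_nat_ge (2 + 4 / (c * ε) + 4 * (3 + 2 * C ^ 2) / (c * ε) ^ 2)
  refine ⟨A₁ + A₂, c / (2 * C), by positivity, by positivity, n,
    min 1 (min (c * ε / (4 * C)) ((c * ε) ^ 2 / (4 * (3 + 2 * C ^ 2)))), by positivity,
    fun h hh δ hδ hδ' ρ _ f H N => ?_⟩
  have hh' : 2 + 4 / (c * ε) + 4 * (3 + 2 * C ^ 2) / (c * ε) ^ 2 ≤ h :=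
    hn.trans (by exact_mod_cast hh)
  have p1 : 0 < 4 / (c * ε) := by positivity
  have p2 : 0 < 4 * (3 + 2 * C ^ 2) / (c * ε) ^ 2 := by positivity
  have h2 : 2 ≤ h := by
    have : (2 : ℝ) ≤ h := by linarith
    exact_mod_cast this
  have h1 : 1 ≤ h := by omega
  have h0 : (0 : ℝ) < h := by exact_mod_cast h1
  have d1 : δ ≤ 1 := hδ'.trans (min_le_left _ _)
  have d2 : C * δ ≤ c * ε / 4 := by
    have := hδ'.trans ((min_le_right _ _).trans (min_le_left _ _))
    rw [le_div_iff₀ (by positivity)] at this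
    linarith
  have d3 : (3 + 2 * C ^ 2) * δ ≤ (c * ε) ^ 2 / 4 := by
    have := hδ'.trans ((min_le_right _ _).trans (min_le_right _ _))
    rw [le_div_iff₀ (by positivity)] at this
    linarith
  have e1 : 1 / ((h : ℝ) - 1) ≤ c * ε / 4 := by
    rw [div_le_iff₀ (by linarith)]
    have : 4 / (c * ε) ≤ h - 1 := by linarith
    rw [div_le_iff₀ (by positivity)] at this
    linarith
  have e2 : (3 + 2 * C ^ 2) * (1 / h) ≤ (c * ε) ^ 2 / 4 := by
    have : 4 * (3 + 2 * C ^ 2) / (c * ε) ^ 2 ≤ h := by linarith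
    rw [div_le_iff₀ (by positivity)] at this
    rw [mul_one_div, div_le_iff₀ h0]
    linarith
  have hsmall : (3 + 2 * C ^ 2) * (1 / h + δ) ≤ (c * ε) ^ 2 / 2 := by linarith
  obtain ⟨r1, r2, r3, r4⟩ := ceil_rank_bounds hα h1
  have hbias := abs_le.1 (N.exists_bias_le hα hβ hε hc hδ d1 h1)
  rw [← hA₁] at hbias
  have hs : 0 ≤ 1 / h + δ := by positivity
  have hA2s : 0 ≤ A₂ * (1 / h + δ) := by positivity
  have hfm := N.continuous_f.measurable
  constructor
  · intro b hb hbε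
    have i := fun y => N.integrable_H_mul_orderWeight y h ⌈α * h⌉₊
    have u1 := N.le_integral_mul_orderWeight hα hε hc hδ d1 h1 hsmall
      (g := fun x => H x (θ + b) - H x θ) ((N.measurable_H _).sub (N.measurable_H _)) (K := 1)
      (fun x => by
        have := N.H_nonneg x θ
        have := N.H_le x (θ + b)
        have := N.H_mono x (by linarith : θ ≤ θ + b)
        rw [abs_of_nonneg (by linarith)]; linarith)
      (fun x => sub_nonneg.2 (N.H_mono x (by linarith))) (m := c * b) (by positivity)
      (fun x hx => (N.slope x b hx hb hbε).1)
    have u2 := N.le_integral_mul_orderWeight hα hε hc hδ d1 h1 hsmall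
      (g := fun x => H x θ - H x (θ - b)) ((N.measurable_H _).sub (N.measurable_H _)) (K := 1)
      (fun x => by
        have := N.H_nonneg x (θ - b)
        have := N.H_le x θ
        have := N.H_mono x (by linarith : θ - b ≤ θ)
        rw [abs_of_nonneg (by linarith)]; linarith)
      (fun x => sub_nonneg.2 (N.H_mono x (by linarith))) (m := c * b) (by positivity)
      (fun x hx => (N.slope x b hx hb hbε).2)
    simp only [sub_mul] at u1 u2
    rw [integral_sub (i _) (i _), ← N.concomitantLaw_Iic r1 r2, ← N.concomitantLaw_Iic r1 r2]
      at u1 u2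
    have e : c / (2 * C) * b = c * b / (2 * C) := by ring
    rw [e]
    constructor <;> linarith [hbias.1, hbias.2]
  · intro y hy
    have hy0 : 0 < y := by linarith
    -- Pointwise tail bounds control the region near `q` and total tail masses the rest; the slower
    -- decay `1 / √y` covers both.
    have hsq : C / y ≤ C / √y := by
      have : √y ≤ y := by
        rw [Real.sqrt_le_left hy0.le]
        nlinarith
      have : 0 < √y := Real.sqrt_pos.2 hy0
      gcongr
    have hint : ∀ t, ∫ x, H x t = ρ.real {w | w.2 ≤ t} := by
      intro t
      have := N.integral_indicator_snd t (fun _ => 1) measurable_const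
      simp only [mul_one] at this
      rw [← this, ← integral_indicator_one (measurableSet_le measurable_snd measurable_const)]
      rfl
    have hHi : ∀ t, Integrable fun x => H x t := fun t => by
      simpa using N.integrable_mul (N.measurable_H t) (measurable_const (a := (1 : ℝ))) (K := 1)
        (K' := 1) (fun x => by rw [abs_of_nonneg (N.H_nonneg x t), one_mul]; exact N.H_le x t)
        (by simp)
    have v1 := N.integral_mul_orderWeight_le hα hε hc h2 e1 d2
      (g := fun x => H x (θ - y)) (N.measurable_H _) (fun x => N.H_nonneg x _) (K := 1)
      (fun x => by rw [abs_of_nonneg (N.H_nonneg x _), one_mul]; exact N.H_le x _)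
      (m := C / √y) (by positivity) (fun x _ => (N.tail x y hy).1) (s := C / √y)
      ((hint _).le.trans ((N.tail_mass y hy).1.trans hsq))
    have v2 := N.integral_mul_orderWeight_le hα hε hc h2 e1 d2
      (g := fun x => f x - H x (θ + y)) (hfm.sub (N.measurable_H _))
      (fun x => sub_nonneg.2 (N.H_le x _)) (K := 1)
      (fun x => by
        rw [abs_of_nonneg (sub_nonneg.2 (N.H_le x _)), one_mul]
        linarith [N.H_nonneg x (θ + y)])
      (m := C / √y) (by positivity) (fun x _ => (N.tail x y hy).2) (s := C / √y) (by
        refine le_trans (le_of_eq ?_) ((N.tail_mass y hy).2.trans hsq)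
        have hf1 := N.integral_fst (fun _ => 1) measurable_const
        simp only [mul_one, integral_const, probReal_univ, smul_eq_mul] at hf1
        rw [integral_sub N.integrable_f (hHi _), ← hf1, hint, ← probReal_compl_eq_one_sub
          (measurableSet_le measurable_snd measurable_const)]
        congr 1
        ext w
        simp)
    rw [← N.concomitantLaw_Iic r1 r2] at v1
    simp only [sub_mul] at v2
    rw [integral_sub (N.integrable_f_mul_orderWeight h _) (N.integrable_H_mul_orderWeight _ h _),
      N.integral_orderWeight r1 r2, ← N.concomitantLaw_Iic r1 r2] at v2
    have e : C / √y / c + 4 / (c * ε) ^ 2 * (C / √y) = A₂ / √y := by rw [hA₂]; ring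
    rw [e] at v1 v2
    have : A₂ / √y ≤ (A₁ + A₂) / √y := by gcongr; linarith
    exact ⟨v1.trans this, v2.trans this⟩

/-! ### Concentration of the quantile of independent draws -/

section Hoeffding

open Classical in
/-- Hoeffding's inequality for the number of successes in `k` independent trials. -/
theorem pi_card_ge_le (τ : Measure ℝ) [IsProbabilityMeasure τ] (k : ℕ) {E : Set ℝ}
    (hE : MeasurableSet E) {t : ℝ} (ht : 0 ≤ t) :
    (Measure.pi fun _ : Fin k => τ).real
      {T | k * τ.real E + t ≤ (Finset.univ.filter fun i => T i ∈ E).card} ≤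
      Real.exp (-(2 * t ^ 2 / k)) := by
  set P := Measure.pi fun _ : Fin k => τ
  have hind : iIndepFun (fun (i : Fin k) (T : Fin k → ℝ) => E.indicator (1 : ℝ → ℝ) (T i) - τ.real E)
      P :=
    iIndepFun_pi (X := fun (_ : Fin k) x => E.indicator (1 : ℝ → ℝ) x - τ.real E)
      (μ := fun _ => τ)
      fun i => ((measurable_one.indicator hE).sub_const _).aemeasurable
  have hsub : ∀ i ∈ (Finset.univ : Finset (Fin k)),
      HasSubgaussianMGF (fun T : Fin k → ℝ => E.indicator (1 : ℝ → ℝ) (T i) - τ.real E)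
        ((‖(1 : ℝ) - 0‖₊ / 2) ^ 2) P := by
    intro i _
    have hm : Measurable fun T : Fin k → ℝ => E.indicator (1 : ℝ → ℝ) (T i) :=
      (measurable_one.indicator hE).comp (measurable_pi_apply i)
    have h := hasSubgaussianMGF_of_mem_Icc (μ := P) (a := 0) (b := 1) hm.aemeasurable
      (Eventually.of_forall fun T => by
        by_cases hT : T i ∈ E <;> simp [indicator, hT])
    have hi : ∫ T, E.indicator (1 : ℝ → ℝ) (T i) ∂P = τ.real E := by
      have hmp := measurePreserving_eval (fun _ : Fin k => τ) i
      rw [← integral_indicator_one hE]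
      have hm := integral_map (μ := P) hmp.measurable.aemeasurable (f := E.indicator (1 : ℝ → ℝ))
        (measurable_one.indicator hE).aestronglyMeasurable
      rw [hmp.map_eq] at hm
      exact hm.symm
    rwa [hi] at h
  have h := HasSubgaussianMGF.measure_sum_ge_le_of_iIndepFun hind hsub ht
  refine le_trans (measureReal_mono ?_ (measure_ne_top _ _)) (h.trans (le_of_eq ?_))
  · intro T hT
    simp only [mem_ofPred_eq] at hT ⊢
    rw [Finset.sum_sub_distrib, Finset.sum_const, Finset.card_univ, Fintype.card_fin, nsmul_eq_mul]
    have : ∑ i, E.indicator (1 : ℝ → ℝ) (T i) = (Finset.univ.filter fun i => T i ∈ E).card := by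
      simp [indicator]
    rw [this]
    linarith
  · congr 1
    simp
    ring_nf

end Hoeffding

theorem card_filter_mem_Iic_compl {k : ℕ} (T : Fin k → ℝ) (x : ℝ) :
    (Finset.univ.filter fun i => T i ≤ x).card + (Finset.univ.filter fun i => x < T i).card = k := by
  have := Finset.card_filter_add_card_filter_not (s := (Finset.univ : Finset (Fin k)))
    (fun i => T i ≤ x)
  simpa using this

theorem probReal_Ioi (τ : Measure ℝ) [IsProbabilityMeasure τ] (x : ℝ) :
    τ.real (Ioi x) = 1 - τ.real (Iic x) := by
  rw [← compl_Iic, probReal_compl_eq_one_sub measurableSet_Iic]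

section
variable (τ : Measure ℝ) [IsProbabilityMeasure τ] {β : ℝ} (hβ : β ∈ Ioo (0 : ℝ) 1) {k : ℕ}
  (hk : 1 ≤ k) (x : ℝ)
include hβ hk

/-- The event requires at least `β k` draws below `x` when the expected number is at most `(β - t)
k`: an excess of `k t`. -/
theorem orderStat_le_exp {t : ℝ} (ht : 0 ≤ t) (h : τ.real (Iic x) ≤ β - t) :
    (Measure.pi fun _ : Fin k => τ).real {T | orderStat T ⌈β * k⌉₊ ≤ x} ≤
      Real.exp (-(2 * t ^ 2 * k)) := by
  classical
  obtain ⟨r1, r2, r3, r4⟩ := ceil_rank_bounds hβ hk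
  have hk0 : (0 : ℝ) < k := by exact_mod_cast hk
  have := pi_card_ge_le τ k (measurableSet_Iic (a := x)) (t := k * t) (by positivity)
  refine (measureReal_mono ?_ (measure_ne_top _ _)).trans (this.trans (le_of_eq ?_))
  · intro T hT
    rw [mem_ofPred_eq, orderStat_le_iff T r1 r2] at hT
    have h2 : (⌈β * k⌉₊ : ℝ) ≤ (Finset.univ.filter fun i => T i ≤ x).card := by exact_mod_cast hT
    change k * τ.real (Iic x) + k * t ≤ ((Finset.univ.filter fun i => T i ≤ x).card : ℝ)
    nlinarith
  · congr 1
    field_simp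

theorem lt_orderStat_le_exp {t : ℝ} (ht : 0 ≤ t) (h : β + t ≤ τ.real (Iic x)) :
    (Measure.pi fun _ : Fin k => τ).real {T | x < orderStat T ⌈β * k⌉₊} ≤
      Real.exp (-(2 * t ^ 2 * k)) := by
  classical
  obtain ⟨r1, r2, r3, r4⟩ := ceil_rank_bounds hβ hk
  have hk0 : (0 : ℝ) < k := by exact_mod_cast hk
  have := pi_card_ge_le τ k (measurableSet_Ioi (a := x)) (t := k * t) (by positivity)
  refine (measureReal_mono ?_ (measure_ne_top _ _)).trans (this.trans (le_of_eq ?_))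
  · intro T hT
    -- Fewer than `⌈β k⌉` draws below `x` means strictly fewer than `β k`, so the rounding costs
    -- nothing in the Hoeffding excess.
    rw [mem_ofPred_eq, ← not_le, orderStat_le_iff T r1 r2, not_le, Nat.lt_ceil] at hT
    have h3 : ((Finset.univ.filter fun i => T i ≤ x).card : ℝ) +
      (Finset.univ.filter fun i => x < T i).card = k := by
      exact_mod_cast card_filter_mem_Iic_compl T x
    change k * τ.real (Ioi x) + k * t ≤ ((Finset.univ.filter fun i => x < T i).card : ℝ)
    rw [probReal_Ioi]
    nlinarith
  · congr 1
    field_simp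

/-- Hoeffding's bound does not improve as `x` moves into the tail. Here a fixed fraction of the
draws must fall in the tail, so its mass `z` appears to a power proportional to `k`. -/
theorem orderStat_le_pow {z : ℝ} (hz : 0 < z) (hz1 : z ≤ 1) (h : τ.real (Iic x) ≤ z) :
    (Measure.pi fun _ : Fin k => τ).real {T | orderStat T ⌈β * k⌉₊ ≤ x} ≤
      2 ^ k * z ^ (β * k) := by
  classical
  obtain ⟨r1, r2, r3, r4⟩ := ceil_rank_bounds hβ hk
  refine (measureReal_mono ?_ (measure_ne_top _ _)).trans
    ((pi_le_card_mem_le τ k ⌈β * k⌉₊ (Iic x)).trans ?_)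
  · intro T hT
    rw [mem_ofPred_eq, orderStat_le_iff T r1 r2] at hT
    exact hT
  · gcongr
    calc _ ≤ z ^ ⌈β * k⌉₊ := by gcongr
      _ = z ^ (⌈β * k⌉₊ : ℝ) := (Real.rpow_natCast _ _).symm
      _ ≤ _ := Real.rpow_le_rpow_of_exponent_ge hz hz1 r3

theorem lt_orderStat_le_pow {z : ℝ} (hz : 0 < z) (hz1 : z ≤ 1) (h : 1 - τ.real (Iic x) ≤ z) :
    (Measure.pi fun _ : Fin k => τ).real {T | x < orderStat T ⌈β * k⌉₊} ≤
      2 ^ k * z ^ ((1 - β) * k) := by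
  classical
  obtain ⟨r1, r2, r3, r4⟩ := ceil_rank_bounds hβ hk
  refine (measureReal_mono ?_ (measure_ne_top _ _)).trans
    ((pi_le_card_mem_le τ k (k + 1 - ⌈β * k⌉₊) (Ioi x)).trans ?_)
  · intro T hT
    rw [mem_ofPred_eq, ← not_le, orderStat_le_iff T r1 r2, not_le] at hT
    have h3 := card_filter_mem_Iic_compl T x
    -- At most `⌈β k⌉ - 1` draws lie below `x`; the extra one keeps the number above at least `(1 -
    -- β) k` after rounding.
    change k + 1 - ⌈β * k⌉₊ ≤ (Finset.univ.filter fun i => x < T i).card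
    omega
  · rw [probReal_Ioi]
    have h0 : 0 ≤ 1 - τ.real (Iic x) := sub_nonneg.2 measureReal_le_one
    gcongr
    calc _ ≤ z ^ (k + 1 - ⌈β * k⌉₊) := by gcongr
      _ = z ^ ((k + 1 - ⌈β * k⌉₊ : ℕ) : ℝ) := (Real.rpow_natCast _ _).symm
      _ ≤ _ := Real.rpow_le_rpow_of_exponent_ge hz hz1 (by
        rw [Nat.cast_sub (by omega)]
        push_cast
        linarith)

end

/-! ### Deviation bound and mean squared error of the quantile -/

/-- Puts the Gaussian regime in the same form as the polynomial tail regime, so that a single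
integrable function bounds all deviations. -/
theorem exp_neg_le_div_sq {c x : ℝ} (hc : 0 < c) (hx : 0 ≤ x) :
    Real.exp (-(c * x)) ≤ (1 + 2 / c) ^ 2 / (1 + x) ^ 2 := by
  have h1 : 1 + x ≤ (1 + 2 / c) * Real.exp (c * x / 2) := by
    have h2 := Real.add_one_le_exp (c * x / 2)
    have h3 : 1 ≤ Real.exp (c * x / 2) := Real.one_le_exp (by positivity)
    have h4 : x ≤ 2 / c * Real.exp (c * x / 2) := by
      calc x = 2 / c * (c * x / 2) := by field_simp
        _ ≤ _ := by gcongr; linarith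
    linarith
  rw [le_div_iff₀ (by positivity), Real.exp_neg, inv_mul_le_iff₀ (Real.exp_pos _)]
  calc (1 + x) ^ 2 ≤ ((1 + 2 / c) * Real.exp (c * x / 2)) ^ 2 := by gcongr
    _ = _ := by
      rw [mul_pow, ← Real.exp_nat_mul, mul_comm]
      congr 2
      push_cast; ring

/-- Deviation bound for the order statistic of `k` independent batch outputs, uniform in the
bias level `s`. -/
theorem exists_deviation_bound {β θ A a ε : ℝ} (hβ : β ∈ Ioo (0 : ℝ) 1) (hA : 0 < A) (ha : 0 < a)
    (hε : 0 < ε) :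
    ∃ B, 0 < B ∧ ∃ k₀ : ℕ, ∃ s₀ > 0, ∀ k ≥ k₀, 1 ≤ k ∧ ∀ s, 0 ≤ s → s ≤ s₀ →
      ∀ (τ : Measure ℝ) [IsProbabilityMeasure τ], BatchLaw τ β θ A a ε s →
      ∀ y, 2 * A * s / a < y → (Measure.pi fun _ : Fin k => τ).real
        {T | y < |orderStat T ⌈β * k⌉₊ - θ|} ≤ B / (1 + k * y ^ 2) ^ 2 := by
  set γ := min β (1 - β) with hγ
  have hγ0 : 0 < γ := lt_min hβ.1 (by linarith [hβ.2])
  -- beyond `Y` the tail bound is effective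
  obtain ⟨Y, hY1, hYA, hYz⟩ : ∃ Y : ℝ, 1 ≤ Y ∧ A ^ 2 ≤ Y ∧ (A ^ 2 / Y) ^ (γ / 4) ≤ 1 / 8 := by
    set z : ℝ := (1 / 8) ^ (4 / γ)
    have hz : 0 < z := by positivity
    refine ⟨max (max 1 (A ^ 2)) (A ^ 2 / z), (le_max_left _ _).trans (le_max_left _ _),
      (le_max_right _ _).trans (le_max_left _ _), ?_⟩
    have hM : A ^ 2 / max (max 1 (A ^ 2)) (A ^ 2 / z) ≤ z := by
      rw [div_le_iff₀ (by positivity)]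
      calc A ^ 2 = z * (A ^ 2 / z) := by field_simp
        _ ≤ _ := by gcongr; exact le_max_right _ _
    calc _ ≤ z ^ (γ / 4) := by gcongr
      _ = 1 / 8 := by
        rw [← Real.rpow_mul (by norm_num)]
        have : 4 / γ * (γ / 4) = 1 := by field_simp
        rw [this, Real.rpow_one]
  -- For `ε < y ≤ Y` only the bound at `ε` is available; the factor `ε² / Y²` pays for replacing `ε`
  -- by `y` in the exponent.
  set c₁ := a ^ 2 / 2 * (min 1 (ε ^ 2 / Y ^ 2)) with hc₁
  have hc₁0 : 0 < c₁ := by positivity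
  -- This makes `γ k / 4 ≥ 4`, which provides a decay of order `y^{-4}` beyond `Y`.
  obtain ⟨k₀, hk₀⟩ := exists_nat_ge (1 + 16 / γ)
  -- The bound on `s` keeps `2 A s / a` below `ε`, so the bias threshold lies where `near` is valid.
  refine ⟨2 * (1 + 2 / c₁) ^ 2 + 8 * A ^ 8, by positivity, k₀, a * ε / (2 * A) / 2, by positivity,
    fun k hk => ?_⟩
  have hkk : 1 + 16 / γ ≤ k := hk₀.trans (by exact_mod_cast hk)
  have p1 : 0 < 16 / γ := by positivity
  have hk1 : 1 ≤ k := by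
    have : (1 : ℝ) ≤ k := by linarith
    exact_mod_cast this
  have hk1' : (1 : ℝ) ≤ k := by exact_mod_cast hk1
  refine ⟨hk1, fun s hs hs' τ _ hτ y hy => ?_⟩
  have hy0 : 0 < y := lt_of_le_of_lt (by positivity) hy
  set P := Measure.pi fun _ : Fin k => τ with hP
  have hsplit : ∀ y : ℝ, P.real {T | y < |orderStat T ⌈β * k⌉₊ - θ|} ≤
      P.real {T | orderStat T ⌈β * k⌉₊ ≤ θ - y} + P.real {T | θ + y < orderStat T ⌈β * k⌉₊} := by
    intro y
    refine (measureReal_mono ?_ (measure_ne_top _ _)).trans (measureReal_union_le _ _)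
    intro T hT
    rcases lt_abs.1 (mem_ofPred_eq ▸ hT) with h | h
    · right; change θ + y < _; linarith
    · left; change _ ≤ θ - y; linarith
  have hnear : ∀ b, 2 * A * s / a ≤ b → b ≤ ε →
      P.real {T | b < |orderStat T ⌈β * k⌉₊ - θ|} ≤ 2 * Real.exp (-(a ^ 2 / 2 * (k * b ^ 2))) := by
    intro b hb hbε
    have hb0 : 0 ≤ b := le_trans (by positivity) hb
    obtain ⟨n1, n2⟩ := hτ.near b hb0 hbε
    -- Beyond the threshold the bias consumes at most half of the growth `a b`; the other half is
    -- the Hoeffding margin.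
    have h1 : A * s ≤ a * b / 2 := by
      rw [div_le_iff₀ ha] at hb
      linarith
    have e1 := orderStat_le_exp τ hβ hk1 (θ - b) (t := a * b / 2) (by positivity) (by linarith)
    have e2 := lt_orderStat_le_exp τ hβ hk1 (θ + b) (t := a * b / 2) (by positivity) (by linarith)
    have e3 : 2 * (a * b / 2) ^ 2 * k = a ^ 2 / 2 * (k * b ^ 2) := by ring
    rw [e3] at e1 e2
    linarith [hsplit b]
  rcases le_or_gt y Y with hyY | hyY
  · have hexp : P.real {T | y < |orderStat T ⌈β * k⌉₊ - θ|} ≤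
        2 * Real.exp (-(c₁ * (k * y ^ 2))) := by
      rcases le_or_gt y ε with hyε | hyε
      · refine (hnear y hy.le hyε).trans ?_
        gcongr
        calc c₁ ≤ a ^ 2 / 2 * 1 := by rw [hc₁]; gcongr; exact min_le_left _ _
          _ = _ := mul_one _
      · have hb : 2 * A * s / a ≤ ε := by
          rw [div_le_iff₀ ha]
          rw [le_div_iff₀ (by norm_num), le_div_iff₀ (by positivity)] at hs'
          nlinarith [mul_nonneg hA.le hs]
        refine (measureReal_mono (fun T hT => hyε.trans hT) (measure_ne_top _ _)).trans
          ((hnear ε hb le_rfl).trans ?_)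
        gcongr 2 * Real.exp (-?_)
        calc c₁ * (k * y ^ 2) ≤ a ^ 2 / 2 * (ε ^ 2 / Y ^ 2) * (k * Y ^ 2) := by
              rw [hc₁]
              gcongr
              exact min_le_right _ _
          _ = _ := by field_simp
    refine hexp.trans ?_
    have := exp_neg_le_div_sq hc₁0 (x := k * y ^ 2) (by positivity)
    calc _ ≤ 2 * ((1 + 2 / c₁) ^ 2 / (1 + k * y ^ 2) ^ 2) := by gcongr
      _ = 2 * (1 + 2 / c₁) ^ 2 / (1 + k * y ^ 2) ^ 2 := by ring
      _ ≤ _ := by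
        gcongr
        linarith [show 0 ≤ 8 * A ^ 8 by positivity]
  · have hy1 : 1 ≤ y := hY1.trans hyY.le
    obtain ⟨t1, t2⟩ := hτ.tail y hy1
    have hsy : 0 < √y := Real.sqrt_pos.2 hy0
    have hz0 : 0 < A / √y := by positivity
    have hz1 : A / √y ≤ 1 := by
      rw [div_le_one hsy]
      exact Real.le_sqrt_of_sq_le (hYA.trans hyY.le)
    set z := A ^ 2 / y with hz
    have hzpos : 0 < z := by positivity
    have hzle1 : z ≤ 1 := by rw [hz, div_le_one hy0]; exact hYA.trans hyY.le
    have hzz : A / √y = z ^ (1 / 2 : ℝ) := by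
      rw [← Real.sqrt_eq_rpow, hz, Real.sqrt_div (by positivity), Real.sqrt_sq hA.le]
    -- With `z = A² / y` the power is at most `z ^ (γ k / 2)`. One half of the exponent yields `(1 /
    -- 8) ^ k`, to beat the factor `2 ^ k` of the union bound; the other yields `z ^ 4`.
    have main : ∀ e, γ ≤ e → (A / √y) ^ (e * k) ≤ (1 / 8) ^ k * z ^ 4 := by
      intro e he
      have s1 : (A / √y) ^ (e * k) ≤ (A / √y) ^ (γ * k) :=
        Real.rpow_le_rpow_of_exponent_ge hz0 hz1 (by gcongr)
      refine s1.trans ?_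
      rw [hzz, ← Real.rpow_mul hzpos.le]
      have : (1 / 2 : ℝ) * (γ * k) = γ / 4 * k + γ / 4 * k := by ring
      rw [this, Real.rpow_add hzpos]
      have f1 : z ^ (γ / 4 * k) ≤ (1 / 8) ^ k := by
        rw [Real.rpow_mul hzpos.le, Real.rpow_natCast]
        refine pow_le_pow_left₀ (by positivity) ?_ k
        refine le_trans ?_ hYz
        rw [hz]
        gcongr
      have f2 : z ^ (γ / 4 * k) ≤ z ^ 4 := by
        rw [← Real.rpow_natCast z 4]
        refine Real.rpow_le_rpow_of_exponent_ge hzpos hzle1 ?_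
        have : 16 / γ ≤ k := by linarith
        rw [div_le_iff₀ hγ0] at this
        push_cast
        linarith
      exact mul_le_mul f1 f2 (by positivity) (by positivity)
    have e1 := orderStat_le_pow τ hβ hk1 (θ - y) hz0 hz1 t1
    have e2 := lt_orderStat_le_pow τ hβ hk1 (θ + y) hz0 hz1 t2
    have m1 := main β (min_le_left _ _)
    have m2 := main (1 - β) (min_le_right _ _)
    have e4 : (2 : ℝ) ^ k * ((1 / 8) ^ k * z ^ 4) ≤ A ^ 8 / (k ^ 2 * y ^ 4) := by
      have : (2 : ℝ) ^ k * ((1 / 8) ^ k * z ^ 4) = A ^ 8 / y ^ 4 * (1 / 4 ^ k) := by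
        rw [← mul_assoc, ← mul_pow, hz, div_pow, ← one_div_pow]
        norm_num
        ring
      rw [this]
      -- The surplus geometric decay is traded for `1 / k²`, to match `(1 + k y²)^{-2}`.
      have h4 : (k : ℝ) ^ 2 ≤ 4 ^ k := by
        have : (k : ℝ) ≤ 2 ^ k := by exact_mod_cast Nat.lt_two_pow_self.le
        calc (k : ℝ) ^ 2 ≤ (2 ^ k) ^ 2 := by gcongr
          _ = 4 ^ k := by rw [← pow_mul, mul_comm, pow_mul]; norm_num
      calc _ ≤ A ^ 8 / y ^ 4 * (1 / k ^ 2) := by gcongr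
        _ = _ := by field_simp
    have e5 : (2 : ℝ) ^ k * (A / √y) ^ (β * k) ≤ A ^ 8 / (k ^ 2 * y ^ 4) :=
      le_trans (by gcongr) e4
    have e6 : (2 : ℝ) ^ k * (A / √y) ^ ((1 - β) * k) ≤ A ^ 8 / (k ^ 2 * y ^ 4) :=
      le_trans (by gcongr) e4
    have hky : (1 + k * y ^ 2) ^ 2 ≤ 4 * (k ^ 2 * y ^ 4) := by
      have : 1 ≤ k * y ^ 2 := by nlinarith
      nlinarith
    calc _ ≤ A ^ 8 / (k ^ 2 * y ^ 4) + A ^ 8 / (k ^ 2 * y ^ 4) := by linarith [hsplit y]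
      _ = 8 * A ^ 8 / (4 * (k ^ 2 * y ^ 4)) := by field_simp; norm_num
      _ ≤ 8 * A ^ 8 / (1 + k * y ^ 2) ^ 2 := by gcongr
      _ ≤ _ := by
        gcongr
        linarith [show 0 ≤ 2 * (1 + 2 / c₁) ^ 2 by positivity]

theorem lintegral_one_div_sq {k : ℝ} (hk : 0 < k) {B : ℝ} (hB : 0 ≤ B) :
    ∫⁻ t in Ioi (0 : ℝ), ENNReal.ofReal (B / (1 + k * t) ^ 2) = ENNReal.ofReal (B / k) := by
  have hd : ∀ t ∈ Ioi (0 : ℝ), HasDerivAt (fun t => -(B / k) * (1 + k * t)⁻¹)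
      (B / (1 + k * t) ^ 2) t := by
    intro t ht
    have hpos : 0 < 1 + k * t := by
      have : 0 < k * t := mul_pos hk ht
      linarith
    have h := (((hasDerivAt_id t).const_mul k).const_add 1).inv (by simpa using hpos.ne')
    refine (h.const_mul (-(B / k))).congr_deriv ?_
    simp only [id, mul_one]
    field_simp
  have hnn : ∀ t ∈ Ioi (0 : ℝ), 0 ≤ B / (1 + k * t) ^ 2 := fun t _ => by positivity
  have hlim : Tendsto (fun t => -(B / k) * (1 + k * t)⁻¹) atTop (𝓝 (-(B / k) * 0)) := by
    refine Tendsto.const_mul _ (tendsto_inv_atTop_zero.comp ?_)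
    exact tendsto_atTop_add_const_left _ _ (tendsto_id.const_mul_atTop hk)
  have hc : ContinuousWithinAt (fun t => -(B / k) * (1 + k * t)⁻¹) (Ici 0) 0 := by
    refine ContinuousAt.continuousWithinAt ?_
    have : (1 + k * (0 : ℝ)) ≠ 0 := by simp
    fun_prop (disch := assumption)
  have hi := integrableOn_Ioi_deriv_of_nonneg hc hd hnn hlim
  have he := integral_Ioi_of_hasDerivAt_of_nonneg hc hd hnn hlim
  rw [← ofReal_integral_eq_lintegral_ofReal hi
    ((ae_restrict_iff' measurableSet_Ioi).2 (Eventually.of_forall hnn)), he]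
  simp

/-- Mean square error of the order statistic of `k` independent batch outputs. -/
theorem exists_orderStat_mse {β θ A a ε : ℝ} (hβ : β ∈ Ioo (0 : ℝ) 1) (hA : 0 < A) (ha : 0 < a)
    (hε : 0 < ε) :
    ∃ B, 0 < B ∧ ∃ k₀ : ℕ, ∃ s₀ > 0, ∀ k ≥ k₀, 1 ≤ k ∧ ∀ s, 0 ≤ s → s ≤ s₀ →
      ∀ (τ : Measure ℝ) [IsProbabilityMeasure τ], BatchLaw τ β θ A a ε s →
      ∫⁻ T, ENNReal.ofReal ((orderStat T ⌈β * k⌉₊ - θ) ^ 2) ∂(Measure.pi fun _ : Fin k => τ) ≤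
        ENNReal.ofReal (B * (s ^ 2 + 1 / k)) := by
  obtain ⟨B, hB, k₀, s₀, hs₀, h⟩ := exists_deviation_bound (θ := θ) hβ hA ha hε
  refine ⟨B + (2 * A / a) ^ 2, by positivity, k₀, s₀, hs₀, fun k hk => ?_⟩
  obtain ⟨hk1, h⟩ := h k hk
  refine ⟨hk1, fun s hs hs' τ _ hτ => ?_⟩
  have hk0 : (0 : ℝ) < k := by exact_mod_cast hk1
  have hm : Measurable fun T : Fin k → ℝ => (orderStat T ⌈β * k⌉₊ - θ) ^ 2 :=
    ((measurable_concomitant measurable_id measurable_id _).sub_const _).pow_const 2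
  rw [lintegral_eq_lintegral_meas_lt _ (Eventually.of_forall fun T => sq_nonneg _) hm.aemeasurable]
  -- In the layer-cake integral, levels below `t₀` are bounded by probability one and contribute the
  -- squared bias; levels above it contribute the term `1 / k`.
  set t₀ := (2 * A * s / a) ^ 2 with ht₀
  have hpt : ∀ t ∈ Ioi (0 : ℝ), (Measure.pi fun _ : Fin k => τ)
      {T | t < (orderStat T ⌈β * k⌉₊ - θ) ^ 2} ≤
      (Iic t₀).indicator 1 t + ENNReal.ofReal (B / (1 + k * t) ^ 2) := by
    intro t ht
    rcases le_or_gt t t₀ with h1 | h1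
    · rw [indicator_of_mem (mem_Iic.2 h1)]
      exact prob_le_one.trans le_self_add
    · rw [indicator_of_notMem (by simpa using h1), zero_add]
      have hq : 2 * A * s / a < √t := Real.lt_sqrt_of_sq_lt h1
      have := h s hs hs' τ hτ _ hq
      rw [Real.sq_sqrt (le_of_lt ht)] at this
      rw [← ofReal_measureReal]
      refine ENNReal.ofReal_le_ofReal (le_trans (measureReal_mono ?_ (measure_ne_top _ _)) this)
      intro T hT
      rw [mem_ofPred_eq, ← sq_abs] at hT
      exact (Real.sqrt_lt_sqrt (le_of_lt ht) hT).trans_eq (Real.sqrt_sq (abs_nonneg _))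
  refine (setLIntegral_mono' measurableSet_Ioi hpt).trans ?_
  rw [lintegral_add_left (measurable_one.indicator measurableSet_Iic), lintegral_one_div_sq hk0 hB.le,
    lintegral_indicator_one measurableSet_Iic, Measure.restrict_apply measurableSet_Iic,
    Iic_inter_Ioi, Real.volume_Ioc, sub_zero, ← ENNReal.ofReal_add (by positivity) (by positivity)]
  refine ENNReal.ofReal_le_ofReal ?_
  have e1 : t₀ = (2 * A / a) ^ 2 * s ^ 2 := by rw [ht₀]; ring
  rw [e1]
  have e2 : 0 ≤ B * s ^ 2 := by positivity
  have e3 : 0 ≤ (2 * A / a) ^ 2 * (1 / k) := by positivity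
  have e4 : B / k = B * (1 / k) := by ring
  rw [e4]
  nlinarith

/-! ### Taylor bounds for the joint density -/

theorem abs_sub_le_of_abs_deriv_le {g : ℝ → ℝ} {K : ℝ} (hg : Differentiable ℝ g)
    (hK : ∀ x, |deriv g x| ≤ K) (x y : ℝ) : |g y - g x| ≤ K * |y - x| :=
  Convex.norm_image_sub_le_of_norm_deriv_le (s := univ) (fun z _ => hg z) (fun z _ => hK z)
    convex_univ trivial trivial

/-- The mean value inequality is applied to `z ↦ g (x + z) - z g'(x)`. The second derivative only
has to exist and be bounded, at the price of the constant `K` in place of `K / 2`. -/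
theorem abs_taylor_le {g : ℝ → ℝ} {K : ℝ} (hg : Differentiable ℝ g)
    (hg' : Differentiable ℝ (deriv g)) (hK : ∀ x, |deriv (deriv g) x| ≤ K) (x a : ℝ) :
    |g (x + a) - g x - a * deriv g x| ≤ K * a ^ 2 := by
  have hK0 : 0 ≤ K := (abs_nonneg _).trans (hK 0)
  set u : ℝ → ℝ := fun z => g (x + z) - z * deriv g x with hu
  have hd : ∀ z, HasDerivAt u (deriv g (x + z) - deriv g x) z := by
    intro z
    have h1 : HasDerivAt (fun z => g (x + z)) (deriv g (x + z)) z :=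
      HasDerivAt.comp_const_add x z (hg (x + z)).hasDerivAt
    have h2 := (hasDerivAt_id z).mul_const (deriv g x)
    rw [one_mul] at h2
    exact h1.sub h2
  have h := Convex.norm_image_sub_le_of_norm_hasDerivWithin_le (s := uIcc 0 a) (f := u)
    (f' := fun z => deriv g (x + z) - deriv g x) (C := K * |a|) (x := 0) (y := a)
    (fun z _ => (hd z).hasDerivWithinAt) (fun z hz => by
      refine (abs_sub_le_of_abs_deriv_le hg' hK x (x + z)).trans ?_
      refine mul_le_mul_of_nonneg_left ?_ hK0
      rw [add_sub_cancel_left]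
      have := abs_sub_left_of_mem_uIcc hz
      simpa using this) (convex_uIcc 0 a) left_mem_uIcc right_mem_uIcc
  simp only [hu, Real.norm_eq_abs, add_zero, zero_mul, sub_zero] at h
  calc _ = |g (x + a) - a * deriv g x - g x| := by congr 1; ring
    _ ≤ _ := h
    _ = _ := by rw [mul_assoc, abs_mul_abs_self]; ring

namespace RegularDensity

set_option linter.unusedSectionVars false

variable {S : Type*} [MeasurableSpace S] {ν : Measure S} {κ : Kernel S (ℝ × ℝ)} [IsMarkovKernel κ]
  {l : ℕ} {φ : ℝ → ℝ → ℝ → ℝ → ℝ} {p : ℝ → ℝ → ℝ} {B : ℝ} (R : RegularDensity ν κ l φ p B)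

include R

theorem p_nonneg (u v : ℝ) : 0 ≤ p u v := (R.nonneg 0 0 u v).trans (R.le_dom 0 0 u v)

theorem mono_bound {B' : ℝ} (h : B ≤ B') : RegularDensity ν κ l φ p B' where
  __ := R
  integral_dom_le := R.integral_dom_le.trans h

theorem lower_nonneg (s t u v : ℝ) : 0 ≤ lowerMass φ s t u v :=
  setIntegral_nonneg measurableSet_Iic fun τ _ => R.nonneg s τ u v

theorem lower_mono (s u v : ℝ) : Monotone fun t => lowerMass φ s t u v := fun _ t' h =>
  setIntegral_mono_set (R.integrableOn s t' u v) (Eventually.of_forall fun τ => R.nonneg s τ u v)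
    (Iic_subset_Iic.2 h).eventuallyLE

theorem lower_sub (s t t' u v : ℝ) :
    lowerMass φ s t' u v - lowerMass φ s t u v = ∫ τ in t..t', φ s τ u v :=
  intervalIntegral.integral_Iic_sub_Iic (R.integrableOn s t u v) (R.integrableOn s t' u v)

theorem abs_sub_s_le (s s' t u v : ℝ) : |φ s' t u v - φ s t u v| ≤ p u v * |s' - s| :=
  abs_sub_le_of_abs_deriv_le (R.diff_s t u v) (fun x => R.ds_le_dom x t u v) s s'

theorem abs_sub_t_le (s t t' u v : ℝ) : |φ s t' u v - φ s t u v| ≤ p u v * |t' - t| :=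
  abs_sub_le_of_abs_deriv_le (R.diff_t s u v) (fun x => R.dt_le_dom s x u v) t t'

theorem abs_lower_sub_s_le (s s' t u v : ℝ) :
    |lowerMass φ s' t u v - lowerMass φ s t u v| ≤ p u v * |s' - s| :=
  abs_sub_le_of_abs_deriv_le (R.lower_diff_s t u v) (fun x => R.lower_ds_le_dom x t u v) s s'

theorem abs_lower_taylor_s_le (s a t u v : ℝ) :
    |lowerMass φ (s + a) t u v - lowerMass φ s t u v -
      a * deriv (fun s' => lowerMass φ s' t u v) s| ≤ p u v * a ^ 2 :=
  abs_taylor_le (R.lower_diff_s t u v) (R.lower_diff_s_s t u v)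
    (fun x => R.lower_dss_le_dom x t u v) s a

theorem abs_lower_taylor_t_le (s t b u v : ℝ) :
    |lowerMass φ s (t + b) u v - lowerMass φ s t u v - b * φ s t u v| ≤ p u v * b ^ 2 := by
  have hc : Continuous fun τ => φ s τ u v := (R.diff_t s u v).continuous
  have e : lowerMass φ s (t + b) u v - lowerMass φ s t u v - b * φ s t u v =
      ∫ τ in t..(t + b), (φ s τ u v - φ s t u v) := by
    rw [intervalIntegral.integral_sub (hc.intervalIntegrable _ _) (by simp), R.lower_sub]
    simp
  rw [e]
  have := intervalIntegral.norm_integral_le_of_norm_le_const (a := t) (b := t + b)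
    (f := fun τ => φ s τ u v - φ s t u v) (C := p u v * |b|) fun τ hτ => by
      refine (R.abs_sub_t_le s t τ u v).trans (mul_le_mul_of_nonneg_left ?_ (R.p_nonneg u v))
      have := abs_sub_left_of_mem_uIcc (uIoc_subset_uIcc hτ)
      simpa using this
  refine this.trans (le_of_eq ?_)
  rw [add_sub_cancel_left, mul_assoc, abs_mul_abs_self]
  ring

/-- Second order expansion of the partial integral in both variables. -/
theorem abs_lower_taylor_le (s a t b u v : ℝ) :
    |lowerMass φ (s + a) (t + b) u v - lowerMass φ s t u v -
      a * deriv (fun s' => lowerMass φ s' t u v) s - b * φ s t u v| ≤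
      p u v * (|a| + |b|) ^ 2 := by
  have h1 := R.abs_lower_taylor_t_le (s + a) t b u v
  have h2 := R.abs_lower_taylor_s_le s a t u v
  -- Expanding in `t` from `s + a` and in `s` from `t` leaves this cross term; the Lipschitz bound
  -- of `φ` in `s` handles it without a second-order expansion in mixed variables.
  have h3 : |b * (φ (s + a) t u v - φ s t u v)| ≤ p u v * (|a| * |b|) := by
    rw [abs_mul]
    have := R.abs_sub_s_le s (s + a) t u v
    rw [add_sub_cancel_left] at this
    calc _ ≤ |b| * (p u v * |a|) := by gcongr
      _ = _ := by ring
  have hp := R.p_nonneg u v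
  calc _ = |(lowerMass φ (s + a) (t + b) u v - lowerMass φ (s + a) t u v - b * φ (s + a) t u v) +
        (lowerMass φ (s + a) t u v - lowerMass φ s t u v -
          a * deriv (fun s' => lowerMass φ s' t u v) s) +
        b * (φ (s + a) t u v - φ s t u v)| := by congr 1; ring
    _ ≤ p u v * b ^ 2 + p u v * a ^ 2 + p u v * (|a| * |b|) :=
        (abs_add_le _ _).trans (add_le_add ((abs_add_le _ _).trans (add_le_add h1 h2)) h3)
    _ ≤ _ := by
        rw [← sq_abs a, ← sq_abs b]
        nlinarith [mul_nonneg hp (mul_nonneg (abs_nonneg a) (abs_nonneg b))]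

theorem measurable_lower :
    Measurable fun x : ℝ × ℝ × ℝ × ℝ => lowerMass φ x.1 x.2.1 x.2.2.1 x.2.2.2 := by
  have h : (fun x : ℝ × ℝ × ℝ × ℝ => lowerMass φ x.1 x.2.1 x.2.2.1 x.2.2.2) =
      fun x => ∫ τ, {z : (ℝ × ℝ × ℝ × ℝ) × ℝ | z.2 ≤ z.1.2.1}.indicator
        (fun z => φ z.1.1 z.2 z.1.2.2.1 z.1.2.2.2) (x, τ) := by
    ext x
    unfold lowerMass
    rw [← integral_indicator measurableSet_Iic]
    rfl
  rw [h]
  refine (StronglyMeasurable.integral_prod_right' (Measurable.stronglyMeasurable ?_)).measurable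
  refine Measurable.indicator ?_ (measurableSet_le (by fun_prop) (by fun_prop))
  exact R.measurable.comp (f := fun z : (ℝ × ℝ × ℝ × ℝ) × ℝ => (z.1.1, z.2, z.1.2.2)) (by fun_prop)

theorem measurable_lower_comp {Ω : Type*} [MeasurableSpace Ω] {a b : Ω → ℝ} {w : Ω → ℝ × ℝ}
    (ha : Measurable a) (hb : Measurable b) (hw : Measurable w) :
    Measurable fun ω => lowerMass φ (a ω) (b ω) (w ω).1 (w ω).2 :=
  R.measurable_lower.comp (f := fun ω => (a ω, b ω, w ω)) (by fun_prop)

theorem measurable_density_comp {Ω : Type*} [MeasurableSpace Ω] {a b : Ω → ℝ} {w : Ω → ℝ × ℝ}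
    (ha : Measurable a) (hb : Measurable b) (hw : Measurable w) :
    Measurable fun ω => φ (a ω) (b ω) (w ω).1 (w ω).2 :=
  R.measurable.comp (f := fun ω => (a ω, b ω, w ω)) (by fun_prop)

/-- A pointwise limit of difference quotients along `1 / (n + 1)`. Measurability in the error
variables permits integrating the derivative over them. -/
theorem measurable_deriv_lower (s t : ℝ) :
    Measurable fun w : ℝ × ℝ => deriv (fun s' => lowerMass φ s' t w.1 w.2) s := by
  refine measurable_of_tendsto_metrizable (f := fun (n : ℕ) (w : ℝ × ℝ) =>
    (1 / ((n : ℝ) + 1))⁻¹ * (lowerMass φ (s + 1 / ((n : ℝ) + 1)) t w.1 w.2 -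
      lowerMass φ s t w.1 w.2)) (fun n => ?_) (tendsto_pi_nhds.2 fun w => ?_)
  · exact ((R.measurable_lower_comp (by fun_prop) (by fun_prop) measurable_id).sub
      (R.measurable_lower_comp (by fun_prop) (by fun_prop) measurable_id)).const_mul _
  · have hd := (R.lower_diff_s t w.1 w.2 s).hasDerivAt.tendsto_slope_zero
    have hn : Tendsto (fun n : ℕ => 1 / ((n : ℝ) + 1)) atTop (𝓝[≠] 0) :=
      tendsto_nhdsWithin_iff.2 ⟨tendsto_one_div_add_atTop_nhds_zero_nat,
        Eventually.of_forall fun n => by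
          have : (0 : ℝ) < 1 / ((n : ℝ) + 1) := by positivity
          exact this.ne'⟩
    exact hd.comp hn

theorem integrable_of_le {G : ℝ × ℝ → ℝ} (hG : AEStronglyMeasurable G) {K : ℝ}
    (h : ∀ w, |G w| ≤ K * ((1 + |w.1| + |w.2|) ^ 2 * p w.1 w.2)) : Integrable G :=
  (R.integrable_dom.const_mul K).mono' hG (Eventually.of_forall h)

theorem abs_integral_le {G : ℝ × ℝ → ℝ} {K : ℝ} (hK : 0 ≤ K)
    (h : ∀ w, |G w| ≤ K * ((1 + |w.1| + |w.2|) ^ 2 * p w.1 w.2)) : |∫ w, G w| ≤ K * B := by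
  refine (norm_integral_le_of_norm_le (R.integrable_dom.const_mul K)
    (Eventually.of_forall fun w => (Real.norm_eq_abs _).trans_le (h w))).trans ?_
  rw [integral_const_mul]
  exact mul_le_mul_of_nonneg_left R.integral_dom_le hK

omit R in
theorem one_le_weight (w : ℝ × ℝ) : 1 ≤ (1 + |w.1| + |w.2|) ^ 2 := by
  have := abs_nonneg w.1
  have := abs_nonneg w.2
  nlinarith

omit R in
theorem add_abs_le_weight (w : ℝ × ℝ) : 1 + |w.1| + |w.2| ≤ (1 + |w.1| + |w.2|) ^ 2 := by
  have := abs_nonneg w.1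
  have := abs_nonneg w.2
  nlinarith

theorem abs_le_of_le_p {x K : ℝ} (hK : 0 ≤ K) {w : ℝ × ℝ} (h : |x| ≤ K * p w.1 w.2) :
    |x| ≤ K * ((1 + |w.1| + |w.2|) ^ 2 * p w.1 w.2) :=
  h.trans (mul_le_mul_of_nonneg_left (le_mul_of_one_le_left (R.p_nonneg _ _) (one_le_weight w)) hK)

theorem abs_lower_le (s t u v : ℝ) : |lowerMass φ s t u v| ≤ p u v := by
  rw [abs_of_nonneg (R.lower_nonneg s t u v)]
  exact R.lower_le_dom s t u v

theorem integrable_lower {a b : ℝ × ℝ → ℝ} (ha : Measurable a) (hb : Measurable b) :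
    Integrable fun w : ℝ × ℝ => lowerMass φ (a w) (b w) w.1 w.2 :=
  R.integrable_of_le (K := 1) (R.measurable_lower_comp ha hb measurable_id).aestronglyMeasurable
    fun w => R.abs_le_of_le_p zero_le_one (by rw [one_mul]; exact R.abs_lower_le _ _ _ _)

theorem integrable_density {a b : ℝ × ℝ → ℝ} (ha : Measurable a) (hb : Measurable b) :
    Integrable fun w : ℝ × ℝ => φ (a w) (b w) w.1 w.2 :=
  R.integrable_of_le (K := 1) (R.measurable_density_comp ha hb measurable_id).aestronglyMeasurable
    fun w => R.abs_le_of_le_p zero_le_one (by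
      rw [one_mul, abs_of_nonneg (R.nonneg _ _ _ _)]; exact R.le_dom _ _ _ _)

theorem B_nonneg : 0 ≤ B := by
  have h : |∫ w : ℝ × ℝ, lowerMass φ 0 0 w.1 w.2| ≤ 1 * B := R.abs_integral_le zero_le_one
    fun w => R.abs_le_of_le_p zero_le_one (by rw [one_mul]; exact R.abs_lower_le _ _ _ _)
  linarith [abs_nonneg (∫ w : ℝ × ℝ, lowerMass φ 0 0 w.1 w.2)]

end RegularDensity

/-! ### The perturbed pair and its densities -/

section
variable {S : Type*} [MeasurableSpace S] (κ : Kernel S (ℝ × ℝ)) [IsMarkovKernel κ]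

set_option linter.unusedSectionVars false

theorem measurable_muFun : Measurable (muFun κ) :=
  (StronglyMeasurable.integral_kernel (κ := κ) (f := Prod.fst)
    measurable_fst.stronglyMeasurable).measurable

theorem measurable_piFun : Measurable (piFun κ) :=
  (StronglyMeasurable.integral_kernel (κ := κ) (f := Prod.snd)
    measurable_snd.stronglyMeasurable).measurable

omit [IsMarkovKernel κ] in
theorem measurable_meanX (l : ℕ) : Measurable (meanX (S := S) (l := l)) := by
  unfold meanX; fun_prop

omit [IsMarkovKernel κ] in
theorem measurable_meanY (l : ℕ) : Measurable (meanY (S := S) (l := l)) := by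
  unfold meanY; fun_prop

theorem measurable_scaledErrors (l : ℕ) : Measurable (scaledErrors κ (l := l)) := by
  have h1 := measurable_muFun κ
  have h2 := measurable_piFun κ
  have h3 := measurable_meanX (S := S) l
  have h4 := measurable_meanY (S := S) l
  unfold scaledErrors
  fun_prop

/-- The noise-free pair perturbed by `e₁` and `e₂` times the scaled pricing errors. -/
noncomputable def perturbedPair (e₁ e₂ : ℝ) {l : ℕ} (x : S × (Fin l → ℝ × ℝ)) : ℝ × ℝ :=
  ((scaledErrors κ x).1 + e₁ * (scaledErrors κ x).2.2.1,
    (scaledErrors κ x).2.1 + e₂ * (scaledErrors κ x).2.2.2)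

theorem measurable_perturbedPair (e₁ e₂ : ℝ) (l : ℕ) :
    Measurable (perturbedPair κ e₁ e₂ (l := l)) := by
  have h : Measurable fun e : ℝ × ℝ × ℝ × ℝ => (e.1 + e₁ * e.2.2.1, e.2.1 + e₂ * e.2.2.2) := by
    fun_prop
  exact h.comp (measurable_scaledErrors κ l)

end

/-- The density at `x` of the first coordinate of the perturbed pair on the event that the second
coordinate is at most `y`. -/
noncomputable def smoothLower (φ : ℝ → ℝ → ℝ → ℝ → ℝ) (e₁ e₂ x y : ℝ) : ℝ :=
  ∫ w : ℝ × ℝ, lowerMass φ (x - e₁ * w.1) (y - e₂ * w.2) w.1 w.2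

namespace RegularDensity

set_option linter.unusedSectionVars false

variable {S : Type*} [MeasurableSpace S] {ν : Measure S} [IsProbabilityMeasure ν]
  {κ : Kernel S (ℝ × ℝ)} [IsMarkovKernel κ]
  {l : ℕ} {φ : ℝ → ℝ → ℝ → ℝ → ℝ} {p : ℝ → ℝ → ℝ} {B : ℝ} (R : RegularDensity ν κ l φ p B)

include R

theorem lintegral_Iic (s t u v : ℝ) :
    ∫⁻ τ in Iic t, ENNReal.ofReal (φ s τ u v) = ENNReal.ofReal (lowerMass φ s t u v) :=
  (ofReal_integral_eq_lintegral_ofReal (R.integrableOn s t u v)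
    (Eventually.of_forall fun τ => R.nonneg s τ u v)).symm

/-- The law of `(μ(Z), U, V)` on the event `π(Z) ≤ c(U, V)`. -/
theorem map_restrict_eq {c : ℝ × ℝ → ℝ} (hc : Measurable c) :
    (((scenarioLaw ν κ l).map (scaledErrors κ)).restrict
      {e : ℝ × ℝ × ℝ × ℝ | e.2.1 ≤ c e.2.2}).map (fun e => (e.1, e.2.2)) =
    (volume : Measure (ℝ × ℝ × ℝ)).withDensity
      fun z => ENNReal.ofReal (lowerMass φ z.1 (c z.2) z.2.1 z.2.2) := by
  rw [R.law]
  have hE : MeasurableSet {e : ℝ × ℝ × ℝ × ℝ | e.2.1 ≤ c e.2.2} :=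
    measurableSet_le (by fun_prop) (by fun_prop)
  have hpr : Measurable fun e : ℝ × ℝ × ℝ × ℝ => (e.1, e.2.2) := by fun_prop
  ext A hA
  rw [Measure.map_apply hpr hA, Measure.restrict_apply (hpr hA),
    withDensity_apply _ ((hpr hA).inter hE), withDensity_apply _ hA,
    ← lintegral_indicator ((hpr hA).inter hE), ← lintegral_indicator hA]
  have hφ := R.measurable
  set F := (((fun e : ℝ × ℝ × ℝ × ℝ => (e.1, e.2.2)) ⁻¹' A ∩
      {e : ℝ × ℝ × ℝ × ℝ | e.2.1 ≤ c e.2.2}).indicator fun x : ℝ × ℝ × ℝ × ℝ =>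
      ENNReal.ofReal (φ x.1 x.2.1 x.2.2.1 x.2.2.2)) with hF
  have hm : Measurable F :=
    hφ.ennreal_ofReal.indicator ((hpr hA).inter hE)
  have hm2 : Measurable (A.indicator fun z : ℝ × ℝ × ℝ =>
      ENNReal.ofReal (lowerMass φ z.1 (c z.2) z.2.1 z.2.2)) :=
    (R.measurable_lower_comp measurable_fst (hc.comp measurable_snd)
      measurable_snd).ennreal_ofReal.indicator hA
  rw [Measure.volume_eq_prod, lintegral_prod _ hm.aemeasurable, Measure.volume_eq_prod ℝ (ℝ × ℝ),
    lintegral_prod _ hm2.aemeasurable]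
  refine lintegral_congr fun s => ?_
  rw [lintegral_prod_symm (fun y : ℝ × ℝ × ℝ => F (s, y))
    (hm.comp measurable_prodMk_left).aemeasurable]
  refine lintegral_congr fun w => ?_
  by_cases hw : (s, w) ∈ A
  · rw [indicator_of_mem hw, ← R.lintegral_Iic, ← lintegral_indicator measurableSet_Iic]
    refine lintegral_congr fun τ => ?_
    by_cases hτ : τ ≤ c w <;> simp [hF, indicator, hw, hτ]
  · rw [indicator_of_notMem hw]
    simp [hF, hw]

theorem smoothLower_nonneg (e₁ e₂ x y : ℝ) : 0 ≤ smoothLower φ e₁ e₂ x y :=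
  integral_nonneg fun _ => R.lower_nonneg _ _ _ _

theorem smoothLower_integrable (e₁ e₂ x y : ℝ) : Integrable fun w : ℝ × ℝ =>
    lowerMass φ (x - e₁ * w.1) (y - e₂ * w.2) w.1 w.2 :=
  R.integrable_lower (by fun_prop) (by fun_prop)

theorem smoothLower_mono (e₁ e₂ x : ℝ) : Monotone (smoothLower φ e₁ e₂ x) := fun _ _ h =>
  integral_mono (R.smoothLower_integrable _ _ _ _) (R.smoothLower_integrable _ _ _ _)
    fun _ => R.lower_mono _ _ _ (by linarith)

theorem smoothLower_le (e₁ e₂ x y : ℝ) : smoothLower φ e₁ e₂ x y ≤ B := by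
  have := R.abs_integral_le (G := fun w => lowerMass φ (x - e₁ * w.1) (y - e₂ * w.2) w.1 w.2)
    zero_le_one
    fun w => R.abs_le_of_le_p zero_le_one (by rw [one_mul]; exact R.abs_lower_le _ _ _ _)
  rw [one_mul] at this
  exact (le_abs_self _).trans this

theorem abs_smoothLower_sub_le (e₁ e₂ x x' y : ℝ) :
    |smoothLower φ e₁ e₂ x' y - smoothLower φ e₁ e₂ x y| ≤ B * |x' - x| := by
  unfold smoothLower
  rw [← integral_sub (R.smoothLower_integrable _ _ _ _) (R.smoothLower_integrable _ _ _ _),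
    mul_comm]
  refine R.abs_integral_le (abs_nonneg _) fun w => R.abs_le_of_le_p (abs_nonneg _) ?_
  have := R.abs_lower_sub_s_le (x - e₁ * w.1) (x' - e₁ * w.1) (y - e₂ * w.2) w.1 w.2
  rw [sub_sub_sub_cancel_right] at this
  linarith

theorem continuous_smoothLower (e₁ e₂ y : ℝ) : Continuous fun x => smoothLower φ e₁ e₂ x y :=
  (LipschitzWith.of_dist_le_mul (K := ⟨B, R.B_nonneg⟩) fun x x' =>
    R.abs_smoothLower_sub_le e₁ e₂ x' x y).continuous

/-- `smoothLower` is the density of the first coordinate of the perturbed pair on the event that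
the second coordinate is at most `y`. -/
theorem map_fst_restrict_eq (e₁ e₂ y : ℝ) :
    (((scenarioLaw ν κ l).map (perturbedPair κ e₁ e₂)).restrict {w | w.2 ≤ y}).map Prod.fst =
      volume.withDensity fun x => ENNReal.ofReal (smoothLower φ e₁ e₂ x y) := by
  have hse := measurable_scaledErrors κ l
  have hpp := measurable_perturbedPair κ e₁ e₂ l
  have hy : MeasurableSet {w : ℝ × ℝ | w.2 ≤ y} := measurableSet_le measurable_snd measurable_const
  have hc : Measurable fun w : ℝ × ℝ => y - e₂ * w.2 := by fun_prop
  have hK := R.map_restrict_eq hc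
  ext A hA
  have hg : Measurable fun z : ℝ × ℝ × ℝ => z.1 + e₁ * z.2.1 := by fun_prop
  -- The event on the perturbed second coordinate bounds `π(Z)` by a threshold depending on the
  -- error, which is why `map_restrict_eq` allows a function `c`.
  have h1 : (((scenarioLaw ν κ l).map (perturbedPair κ e₁ e₂)).restrict
      {w | w.2 ≤ y}).map Prod.fst A =
      ((((scenarioLaw ν κ l).map (scaledErrors κ)).restrict
      {e : ℝ × ℝ × ℝ × ℝ | e.2.1 ≤ y - e₂ * e.2.2.2}).map (fun e => (e.1, e.2.2)))
        ((fun z : ℝ × ℝ × ℝ => z.1 + e₁ * z.2.1) ⁻¹' A) := by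
    rw [Measure.map_apply measurable_fst hA, Measure.restrict_apply (measurable_fst hA),
      Measure.map_apply hpp ((measurable_fst hA).inter hy), Measure.map_apply (by fun_prop) (hg hA),
      Measure.restrict_apply ((hg hA).preimage (by fun_prop)), Measure.map_apply hse]
    · congr 1
      ext x
      simp [perturbedPair, le_sub_iff_add_le]
    · exact ((hg hA).preimage (by fun_prop)).inter (measurableSet_le (by fun_prop) (by fun_prop))
  rw [h1, hK, withDensity_apply _ (hg hA), withDensity_apply _ hA, ← lintegral_indicator (hg hA),
    ← lintegral_indicator hA]
  have hm : Measurable (((fun z : ℝ × ℝ × ℝ => z.1 + e₁ * z.2.1) ⁻¹' A).indicator fun z =>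
      ENNReal.ofReal (lowerMass φ z.1 (y - e₂ * z.2.2) z.2.1 z.2.2)) :=
    (R.measurable_lower_comp measurable_fst (by fun_prop)
      measurable_snd).ennreal_ofReal.indicator (hg hA)
  rw [Measure.volume_eq_prod, lintegral_prod_symm _ hm.aemeasurable]
  -- For fixed errors, perturbing the first coordinate is a translation, and Lebesgue measure is
  -- invariant.
  have h2 : ∀ w : ℝ × ℝ, ∫⁻ s, ((fun z : ℝ × ℝ × ℝ => z.1 + e₁ * z.2.1) ⁻¹' A).indicator (fun z =>
      ENNReal.ofReal (lowerMass φ z.1 (y - e₂ * z.2.2) z.2.1 z.2.2)) (s, w) =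
      ∫⁻ x, A.indicator (fun x => ENNReal.ofReal
        (lowerMass φ (x - e₁ * w.1) (y - e₂ * w.2) w.1 w.2)) x := by
    intro w
    rw [← lintegral_add_right_eq_self (fun x => A.indicator (fun x => ENNReal.ofReal
        (lowerMass φ (x - e₁ * w.1) (y - e₂ * w.2) w.1 w.2)) x) (e₁ * w.1)]
    refine lintegral_congr fun s => ?_
    by_cases hs : s + e₁ * w.1 ∈ A <;> simp [indicator, hs]
  rw [lintegral_congr h2, lintegral_lintegral_swap]
  · refine lintegral_congr fun x => ?_
    by_cases hx : x ∈ A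
    · simp only [indicator_of_mem hx]
      rw [smoothLower, ofReal_integral_eq_lintegral_ofReal (R.smoothLower_integrable _ _ _ _)
        (Eventually.of_forall fun _ => R.lower_nonneg _ _ _ _)]
    · simp [indicator_of_notMem hx]
  · refine Measurable.aemeasurable ?_
    have : Measurable fun z : (ℝ × ℝ) × ℝ =>
        ENNReal.ofReal (lowerMass φ (z.2 - e₁ * z.1.1) (y - e₂ * z.1.2) z.1.1 z.1.2) :=
      (R.measurable_lower_comp (by fun_prop) (by fun_prop) measurable_fst).ennreal_ofReal
    exact this.indicator (hA.preimage measurable_snd)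

/-- The density of the first coordinate of the perturbed pair. -/
theorem tendsto_smoothLower (e₁ e₂ x : ℝ) :
    Tendsto (fun n : ℕ => smoothLower φ e₁ e₂ x n) atTop
      (𝓝 (⨆ n : ℕ, smoothLower φ e₁ e₂ x n)) :=
  tendsto_atTop_ciSup ((R.smoothLower_mono e₁ e₂ x).comp Nat.mono_cast)
    ⟨B, by rintro _ ⟨n, rfl⟩; exact R.smoothLower_le _ _ _ _⟩

theorem smoothLower_le_iSup (e₁ e₂ x y : ℝ) :
    smoothLower φ e₁ e₂ x y ≤ ⨆ n : ℕ, smoothLower φ e₁ e₂ x n := by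
  obtain ⟨n, hn⟩ := exists_nat_ge y
  exact (R.smoothLower_mono e₁ e₂ x hn).trans
    (le_ciSup (f := fun n : ℕ => smoothLower φ e₁ e₂ x n)
      ⟨B, by rintro _ ⟨n, rfl⟩; exact R.smoothLower_le _ _ _ _⟩ n)

/-- Monotone convergence over the events that the second coordinate is at most `n`. Writing the
marginal density as a supremum lets every uniform bound on `smoothLower` pass to it as a limit. -/
theorem map_fst_eq (e₁ e₂ : ℝ) :
    ((scenarioLaw ν κ l).map (perturbedPair κ e₁ e₂)).map Prod.fst =
      volume.withDensity fun x => ENNReal.ofReal (⨆ n : ℕ, smoothLower φ e₁ e₂ x n) := by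
  have hpp := measurable_perturbedPair κ e₁ e₂ l
  set ρ := (scenarioLaw ν κ l).map (perturbedPair κ e₁ e₂)
  ext A hA
  have hn : ∀ n : ℕ, ρ ({w | w.1 ∈ A} ∩ {w | w.2 ≤ n}) =
      ∫⁻ x in A, ENNReal.ofReal (smoothLower φ e₁ e₂ x n) := by
    intro n
    have := congrArg (fun m => m A) (R.map_fst_restrict_eq e₁ e₂ n)
    rw [Measure.map_apply measurable_fst hA, Measure.restrict_apply (measurable_fst hA),
      withDensity_apply _ hA] at this
    exact this
  have hU : {w : ℝ × ℝ | w.1 ∈ A} = ⋃ n : ℕ, {w | w.1 ∈ A} ∩ {w : ℝ × ℝ | w.2 ≤ n} := by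
    ext w
    simp only [mem_iUnion, mem_inter_iff, mem_ofPred_eq, exists_and_left]
    exact ⟨fun h => ⟨h, exists_nat_ge _⟩, fun h => h.1⟩
  have hmono : Monotone fun n : ℕ => {w : ℝ × ℝ | w.1 ∈ A} ∩ {w | w.2 ≤ (n : ℝ)} :=
    fun n m hnm => inter_subset_inter_right _ fun w hw =>
      le_trans (mem_ofPred_eq ▸ hw) (by exact_mod_cast hnm)
  have t1 := tendsto_measure_iUnion_atTop (μ := ρ) hmono
  rw [← hU] at t1
  have t2 : Tendsto (fun n : ℕ => ∫⁻ x in A, ENNReal.ofReal (smoothLower φ e₁ e₂ x n)) atTop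
      (𝓝 (∫⁻ x in A, ENNReal.ofReal (⨆ n : ℕ, smoothLower φ e₁ e₂ x n))) := by
    refine lintegral_tendsto_of_tendsto_of_monotone
      (fun n => (R.continuous_smoothLower e₁ e₂ n).measurable.ennreal_ofReal.aemeasurable)
      (Eventually.of_forall fun x n m hnm => ?_) (Eventually.of_forall fun x => ?_)
    · exact ENNReal.ofReal_le_ofReal (R.smoothLower_mono _ _ _ (by exact_mod_cast hnm))
    · exact (ENNReal.continuous_ofReal.tendsto _).comp (R.tendsto_smoothLower e₁ e₂ x)
  simp only [Function.comp_def, hn] at t1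
  rw [Measure.map_apply measurable_fst hA, withDensity_apply _ hA]
  exact tendsto_nhds_unique t1 t2

end RegularDensity

/-! ### Moments of the inner sample means -/

section Sampling

variable {S : Type*} [MeasurableSpace S] (ν : Measure S) [IsProbabilityMeasure ν]
  (κ : Kernel S (ℝ × ℝ)) [IsMarkovKernel κ]

theorem innerKernel_map_eval {l : ℕ} (j : Fin l) :
    (innerKernel κ l).map (fun w => w j) = κ := by
  ext1 z
  rw [Kernel.map_apply _ (measurable_pi_apply j)]
  exact (measurePreserving_eval (fun _ : Fin l => κ z) j).map_eq

/-- By linearity, the joint law of the scenario and a single observation suffices for the mean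
computations below. -/
theorem scenarioLaw_map_eval {l : ℕ} (j : Fin l) :
    (scenarioLaw ν κ l).map (fun x => (x.1, x.2 j)) = ν ⊗ₘ κ := by
  conv_rhs => rw [← innerKernel_map_eval κ j]
  rw [Measure.compProd_map (measurable_pi_apply j)]
  rfl

theorem scenarioLaw_map_fst (l : ℕ) : (scenarioLaw ν κ l).map Prod.fst = ν :=
  Measure.fst_compProd ν (innerKernel κ l)

variable {ν κ} {g : ℝ × ℝ → ℝ}
  (hgi : Integrable (fun x : S × (ℝ × ℝ) => g x.2) (ν ⊗ₘ κ))

include hgi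

theorem integrable_observation {l : ℕ} (j : Fin l) :
    Integrable (fun x : S × (Fin l → ℝ × ℝ) => g (x.2 j)) (scenarioLaw ν κ l) := by
  have h := hgi
  rw [← scenarioLaw_map_eval ν κ j] at h
  exact h.comp_measurable (f := fun x : S × (Fin l → ℝ × ℝ) => (x.1, x.2 j)) (by fun_prop)

theorem integrable_condMean_base : Integrable (fun z => ∫ w, g w ∂(κ z)) ν := by
  have h := hgi
  rw [Measure.compProd] at h
  simpa using h.integral_compProd

theorem integrable_condMean (l : ℕ) :
    Integrable (fun x : S × (Fin l → ℝ × ℝ) => ∫ w, g w ∂(κ x.1)) (scenarioLaw ν κ l) := by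
  have h : Integrable (fun z => ∫ w, g w ∂(κ z)) ν := integrable_condMean_base hgi
  have h2 := h
  rw [← scenarioLaw_map_fst ν κ l] at h2
  exact h2.comp_measurable measurable_fst

theorem integrable_meanError (l : ℕ) : Integrable (fun x : S × (Fin l → ℝ × ℝ) =>
    (1 / (l : ℝ)) * ∑ j, g (x.2 j) - ∫ w, g w ∂(κ x.1)) (scenarioLaw ν κ l) :=
  ((integrable_finsetSum _ fun j _ => integrable_observation hgi j).const_mul _).sub
    (integrable_condMean hgi l)

/-- The average pricing error has conditional mean zero. -/
theorem setIntegral_meanError {l : ℕ} (hl : 1 ≤ l) {C : Set S} (hC : MeasurableSet C) :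
    ∫ x in Prod.fst ⁻¹' C, ((1 / (l : ℝ)) * ∑ j, g (x.2 j) - ∫ w, g w ∂(κ x.1))
      ∂(scenarioLaw ν κ l) = 0 := by
  have hl0 : (0 : ℝ) < l := by exact_mod_cast hl
  set m : S → ℝ := fun z => ∫ w, g w ∂(κ z) with hm
  have hmi : Integrable m ν := integrable_condMean_base hgi
  have h1 : ∫ x in Prod.fst ⁻¹' C, m x.1 ∂(scenarioLaw ν κ l) = ∫ z in C, m z ∂ν := by
    have h := hmi.aestronglyMeasurable
    conv at h => arg 2; rw [← scenarioLaw_map_fst ν κ l]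
    have := setIntegral_map hC h measurable_fst.aemeasurable
    rw [scenarioLaw_map_fst] at this
    exact this.symm
  have h2 : ∀ j : Fin l, ∫ x in Prod.fst ⁻¹' C, g (x.2 j) ∂(scenarioLaw ν κ l) =
      ∫ z in C, m z ∂ν := by
    intro j
    have hj : Measurable fun x : S × (Fin l → ℝ × ℝ) => (x.1, x.2 j) := by fun_prop
    have h := hgi.aestronglyMeasurable
    rw [← scenarioLaw_map_eval ν κ j] at h
    have := setIntegral_map (hC.prod MeasurableSet.univ) h hj.aemeasurable
    rw [scenarioLaw_map_eval, Measure.setIntegral_compProd hC MeasurableSet.univ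
      hgi.integrableOn] at this
    simp only [Measure.restrict_univ] at this
    rw [hm, this]
    congr 2
    ext x
    simp
  rw [integral_sub, integral_const_mul, integral_finsetSum, h1, Finset.sum_congr rfl
    fun j _ => h2 j]
  · simp
    field_simp
    ring
  · exact fun j _ => (integrable_observation hgi j).integrableOn
  · exact (((integrable_finsetSum _ fun j _ => integrable_observation hgi j).const_mul _)).integrableOn
  · exact (integrable_condMean hgi l).integrableOn

/-- The triangle inequality; it supplies a first moment bound that does not depend on `l`. -/
theorem integral_abs_mean_le {l : ℕ} (hl : 1 ≤ l) :
    ∫ x, |(1 / (l : ℝ)) * ∑ j, g (x.2 j)| ∂(scenarioLaw ν κ l) ≤ ∫ x, |g x.2| ∂(ν ⊗ₘ κ) := by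
  have hl0 : (0 : ℝ) < l := by exact_mod_cast hl
  have hj : ∀ j : Fin l, ∫ x, |g (x.2 j)| ∂(scenarioLaw ν κ l) = ∫ x, |g x.2| ∂(ν ⊗ₘ κ) := by
    intro j
    have hj : Measurable fun x : S × (Fin l → ℝ × ℝ) => (x.1, x.2 j) := by fun_prop
    have h := hgi.abs.aestronglyMeasurable
    rw [← scenarioLaw_map_eval ν κ j] at h
    have := integral_map hj.aemeasurable h
    rw [scenarioLaw_map_eval] at this
    exact this.symm
  have hs : ∫ x, (1 / (l : ℝ)) * ∑ j, |g (x.2 j)| ∂(scenarioLaw ν κ l) =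
      ∫ x, |g x.2| ∂(ν ⊗ₘ κ) := by
    rw [integral_const_mul, integral_finsetSum _ fun j _ => (integrable_observation hgi j).abs,
      Finset.sum_congr rfl fun j _ => hj j]
    simp
    field_simp
  rw [← hs]
  refine integral_mono
    ((integrable_finsetSum _ fun j _ => integrable_observation hgi j).const_mul _).abs
    ((integrable_finsetSum _ fun j _ => (integrable_observation hgi j).abs).const_mul _) fun x => ?_
  dsimp only
  rw [abs_mul, abs_of_pos (by positivity : 0 < 1 / (l : ℝ))]
  gcongr
  exact Finset.abs_sum_le_sum_abs _ _

end Sampling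

/-! ### Centred errors act to second order -/

namespace RegularDensity

set_option linter.unusedSectionVars false

variable {S : Type*} [MeasurableSpace S] {ν : Measure S} [IsProbabilityMeasure ν]
  {κ : Kernel S (ℝ × ℝ)} [IsMarkovKernel κ]
  {l : ℕ} {φ : ℝ → ℝ → ℝ → ℝ → ℝ} {p : ℝ → ℝ → ℝ} {B : ℝ} (R : RegularDensity ν κ l φ p B)

include R

theorem abs_weight_mul_le {k : ℝ × ℝ → ℝ} (hk : ∀ w, |k w| ≤ 1 + |w.1| + |w.2|) {x a : ℝ}
    {w : ℝ × ℝ} (hx : |x| ≤ a * p w.1 w.2) :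
    |k w * x| ≤ a * ((1 + |w.1| + |w.2|) ^ 2 * p w.1 w.2) := by
  have hp := R.p_nonneg w.1 w.2
  rw [abs_mul]
  calc _ ≤ (1 + |w.1| + |w.2|) ^ 2 * (a * p w.1 w.2) := by
        gcongr
        exact (hk w).trans (add_abs_le_weight w)
    _ = _ := by ring

/-- A statistic of the scaled errors with conditional mean zero integrates to zero against the
partial integral of the density. -/
theorem integral_weight_mul_lower {k : ℝ × ℝ → ℝ} (hkm : Measurable k)
    (hk : ∀ w, |k w| ≤ 1 + |w.1| + |w.2|)
    (hki : Integrable (fun x => k (scaledErrors κ x).2.2) (scenarioLaw ν κ l))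
    (hk0 : ∀ C : Set S, MeasurableSet C →
      ∫ x in Prod.fst ⁻¹' C, k (scaledErrors κ x).2.2 ∂(scenarioLaw ν κ l) = 0) (s t : ℝ) :
    ∫ w : ℝ × ℝ, k w * lowerMass φ s t w.1 w.2 = 0 := by
  have hse := measurable_scaledErrors κ l
  have hE : MeasurableSet {e : ℝ × ℝ × ℝ × ℝ | e.2.1 ≤ t} :=
    measurableSet_le (by fun_prop) (by fun_prop)
  have hpr : Measurable fun e : ℝ × ℝ × ℝ × ℝ => (e.1, e.2.2) := by fun_prop
  have hK := R.map_restrict_eq (c := fun _ => t) measurable_const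
  have hd : Measurable fun z : ℝ × ℝ × ℝ => ENNReal.ofReal (lowerMass φ z.1 t z.2.1 z.2.2) :=
    (R.measurable_lower_comp measurable_fst measurable_const measurable_snd).ennreal_ofReal
  set Λ := (((scenarioLaw ν κ l).map (scaledErrors κ)).restrict
      {e : ℝ × ℝ × ℝ × ℝ | e.2.1 ≤ t}).map (fun e => (e.1, e.2.2)) with hΛ
  have hkz : Measurable fun z : ℝ × ℝ × ℝ => k z.2 := hkm.comp measurable_snd
  have i1 : Integrable (fun z : ℝ × ℝ × ℝ => k z.2) Λ := by
    rw [hΛ, integrable_map_measure hkz.aestronglyMeasurable hpr.aemeasurable]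
    refine Integrable.restrict ?_
    rw [integrable_map_measure (hkz.comp hpr).aestronglyMeasurable hse.aemeasurable]
    exact hki
  have i2 : Integrable (fun z : ℝ × ℝ × ℝ => k z.2 * lowerMass φ z.1 t z.2.1 z.2.2) := by
    rw [hK, integrable_withDensity_iff hd (by simp)] at i1
    simpa [ENNReal.toReal_ofReal (R.lower_nonneg _ _ _ _)] using i1
  set J : ℝ → ℝ := fun s => ∫ w : ℝ × ℝ, k w * lowerMass φ s t w.1 w.2 with hJ
  have hJi : Integrable J := i2.integral_prod_left
  have hint : ∀ s, Integrable fun w : ℝ × ℝ => k w * lowerMass φ s t w.1 w.2 := fun s =>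
    R.integrable_of_le (K := 1) (hkm.mul (R.measurable_lower_comp measurable_const measurable_const
      measurable_id)).aestronglyMeasurable fun w => R.abs_weight_mul_le hk
        (by rw [one_mul]; exact R.abs_lower_le _ _ _ _)
  -- Conditional centring only gives `J = 0` almost everywhere; continuity in `s` gives it at every
  -- point.
  have hJc : Continuous J := by
    refine (LipschitzWith.of_dist_le_mul (K := ⟨B, R.B_nonneg⟩) fun s s' => ?_).continuous
    rw [Real.dist_eq, Real.dist_eq, hJ]
    dsimp only
    rw [← integral_sub (hint s) (hint s')]
    simp only [← mul_sub]
    change _ ≤ B * _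
    rw [mul_comm B]
    refine R.abs_integral_le (abs_nonneg _) fun w => R.abs_weight_mul_le hk ?_
    rw [mul_comm]
    exact R.abs_lower_sub_s_le s' s t w.1 w.2
  have hJ0 : J =ᵐ[volume] 0 := by
    refine hJi.ae_eq_zero_of_forall_setIntegral_eq_zero fun A hA _ => ?_
    have e1 : ∫ s in A, J s = ∫ z in A ×ˢ univ, k z.2 * lowerMass φ z.1 t z.2.1 z.2.2 := by
      rw [Measure.volume_eq_prod, setIntegral_prod _ i2.integrableOn]
      simp [hJ]
    have e2 : ∫ z in A ×ˢ univ, k z.2 * lowerMass φ z.1 t z.2.1 z.2.2 =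
        ∫ z in A ×ˢ univ, k z.2 ∂Λ := by
      rw [hK, setIntegral_withDensity_eq_setIntegral_toReal_smul hd (by simp) _
        (hA.prod MeasurableSet.univ)]
      simp [ENNReal.toReal_ofReal (R.lower_nonneg _ _ _ _), mul_comm]
    have e3 : ∫ z in A ×ˢ univ, k z.2 ∂Λ =
        -- The event is determined by `Z`, so the conditional mean zero hypothesis applies to it.
        ∫ x in Prod.fst ⁻¹' (muFun κ ⁻¹' A ∩ piFun κ ⁻¹' Iic t), k (scaledErrors κ x).2.2
          ∂(scenarioLaw ν κ l) := by
      rw [hΛ, setIntegral_map (hA.prod MeasurableSet.univ) hkz.aestronglyMeasurable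
        hpr.aemeasurable, Measure.restrict_restrict (hpr (hA.prod MeasurableSet.univ)),
        setIntegral_map ((hpr (hA.prod MeasurableSet.univ)).inter hE)
          (f := fun e : ℝ × ℝ × ℝ × ℝ => k e.2.2) (hkz.comp hpr).aestronglyMeasurable
          hse.aemeasurable]
      congr 2
      ext x
      simp [scaledErrors]
    rw [e1, e2, e3]
    exact hk0 _ ((measurable_muFun κ hA).inter (measurable_piFun κ measurableSet_Iic))
  have := (Continuous.ae_eq_iff_eq volume hJc continuous_const).1 hJ0
  exact congrFun this s

end RegularDensity

/-- A linear term of quadratic size vanishes. This differentiates identities under the integral sign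
and identifies first-order coefficients. -/
theorem eq_zero_of_abs_mul_le {X K : ℝ} (h : ∀ a : ℝ, 0 < a → |a * X| ≤ K * a ^ 2) : X = 0 := by
  have h2 : ∀ a : ℝ, 0 < a → |X| ≤ K * a := by
    intro a ha
    have := h a ha
    rw [abs_mul, abs_of_pos ha] at this
    have h3 : a * |X| ≤ a * (K * a) := by linarith
    exact le_of_mul_le_mul_left h3 ha
  have h3 : Tendsto (fun a : ℝ => K * a) (𝓝[>] 0) (𝓝 0) := by
    have : Tendsto (fun a : ℝ => K * a) (𝓝 0) (𝓝 (K * 0)) := tendsto_id.const_mul K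
    rw [mul_zero] at this
    exact this.mono_left nhdsWithin_le_nhds
  have := ge_of_tendsto h3 (eventually_mem_nhdsWithin.mono fun a ha => h2 a ha)
  exact abs_eq_zero.1 (le_antisymm this (abs_nonneg _))

theorem integral_sub_sub_mul {Ω : Type*} [MeasurableSpace Ω] {m : Measure Ω} {f g h : Ω → ℝ}
    (hf : Integrable f m) (hg : Integrable g m) (hh : Integrable h m) (c : ℝ) :
    ∫ w, (f w - g w - c * h w) ∂m = ∫ w, f w ∂m - ∫ w, g w ∂m - c * ∫ w, h w ∂m := by
  have e1 := integral_sub (hf.sub hg) (hh.const_mul c)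
  have e2 := integral_sub hf hg
  rw [integral_const_mul] at e1
  simp only [Pi.sub_apply] at e1
  rw [e1, e2]

theorem integral_sub_add_mul_add_mul {Ω : Type*} [MeasurableSpace Ω] {m : Measure Ω}
    {f g h k : Ω → ℝ} (hf : Integrable f m) (hg : Integrable g m) (hh : Integrable h m)
    (hk : Integrable k m) (c d : ℝ) :
    ∫ w, (f w - g w + (c * h w + d * k w)) ∂m =
      ∫ w, f w ∂m - ∫ w, g w ∂m + (c * ∫ w, h w ∂m + d * ∫ w, k w ∂m) := by
  have e1 := integral_add (hf.sub hg) ((hh.const_mul c).add (hk.const_mul d))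
  have e2 := integral_sub hf hg
  have e3 := integral_add (hh.const_mul c) (hk.const_mul d)
  rw [integral_const_mul, integral_const_mul] at e3
  simp only [Pi.sub_apply, Pi.add_apply] at e1
  rw [e1, e2, e3]

namespace RegularDensity

set_option linter.unusedSectionVars false

variable {S : Type*} [MeasurableSpace S] {ν : Measure S} [IsProbabilityMeasure ν]
  {κ : Kernel S (ℝ × ℝ)} [IsMarkovKernel κ]
  {l : ℕ} {φ : ℝ → ℝ → ℝ → ℝ → ℝ} {p : ℝ → ℝ → ℝ} {B : ℝ} (R : RegularDensity ν κ l φ p B)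

omit [IsProbabilityMeasure ν] [IsMarkovKernel κ] R in
theorem abs_fst_le_weight (w : ℝ × ℝ) : |w.1| ≤ 1 + |w.1| + |w.2| := by
  linarith [abs_nonneg w.2]

omit [IsProbabilityMeasure ν] [IsMarkovKernel κ] R in
theorem abs_snd_le_weight (w : ℝ × ℝ) : |w.2| ≤ 1 + |w.1| + |w.2| := by
  linarith [abs_nonneg w.1]

include R

theorem abs_weight_mul_le_one {k : ℝ × ℝ → ℝ} (hk : ∀ w, |k w| ≤ 1 + |w.1| + |w.2|) {x : ℝ}
    {w : ℝ × ℝ} (hx : |x| ≤ p w.1 w.2) :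
    |k w * x| ≤ 1 * ((1 + |w.1| + |w.2|) ^ 2 * p w.1 w.2) :=
  R.abs_weight_mul_le hk (by rwa [one_mul])

theorem integrable_weight_mul {k : ℝ × ℝ → ℝ} (hkm : Measurable k)
    (hk : ∀ w, |k w| ≤ 1 + |w.1| + |w.2|) {G : ℝ × ℝ → ℝ} (hG : Measurable G)
    (hGp : ∀ w, |G w| ≤ p w.1 w.2) : Integrable fun w => k w * G w :=
  R.integrable_of_le (hkm.mul hG).aestronglyMeasurable fun w => R.abs_weight_mul_le_one hk (hGp w)

theorem abs_density_le (s t u v : ℝ) : |φ s t u v| ≤ p u v := by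
  rw [abs_of_nonneg (R.nonneg _ _ _ _)]; exact R.le_dom _ _ _ _

/-- Differentiate the vanishing moment in `s`: the Taylor remainder, weighted by the error, is
dominated by `(1 + |u| + |v|)² p` and so is of order `a²`. -/
theorem integral_fst_mul_deriv (hU : ∀ s t, ∫ w : ℝ × ℝ, w.1 * lowerMass φ s t w.1 w.2 = 0)
    (s t : ℝ) : ∫ w : ℝ × ℝ, w.1 * deriv (fun s' => lowerMass φ s' t w.1 w.2) s = 0 := by
  have i0 : ∀ s, Integrable fun w : ℝ × ℝ => w.1 * lowerMass φ s t w.1 w.2 := fun s =>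
    R.integrable_weight_mul measurable_fst abs_fst_le_weight
      (R.measurable_lower_comp measurable_const measurable_const measurable_id)
      fun w => R.abs_lower_le _ _ _ _
  have i1 : Integrable fun w : ℝ × ℝ => w.1 * deriv (fun s' => lowerMass φ s' t w.1 w.2) s :=
    R.integrable_weight_mul measurable_fst abs_fst_le_weight (R.measurable_deriv_lower s t)
      fun w => R.lower_ds_le_dom s t w.1 w.2
  refine eq_zero_of_abs_mul_le (K := B) fun a _ => ?_
  have e : a * (∫ w : ℝ × ℝ, w.1 * deriv (fun s' => lowerMass φ s' t w.1 w.2) s) =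
      -∫ w : ℝ × ℝ, w.1 * (lowerMass φ (s + a) t w.1 w.2 - lowerMass φ s t w.1 w.2 -
        a * deriv (fun s' => lowerMass φ s' t w.1 w.2) s) := by
    have e2 : (fun w : ℝ × ℝ => w.1 * (lowerMass φ (s + a) t w.1 w.2 - lowerMass φ s t w.1 w.2 -
        a * deriv (fun s' => lowerMass φ s' t w.1 w.2) s)) = fun w =>
        (w.1 * lowerMass φ (s + a) t w.1 w.2 - w.1 * lowerMass φ s t w.1 w.2) -
        a * (w.1 * deriv (fun s' => lowerMass φ s' t w.1 w.2) s) := by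
      ext w; ring
    rw [e2, integral_sub_sub_mul (i0 _) (i0 _) i1, hU, hU]
    ring
  rw [e, abs_neg, mul_comm B]
  refine R.abs_integral_le (sq_nonneg a) fun w => R.abs_weight_mul_le abs_fst_le_weight ?_
  exact (R.abs_lower_taylor_s_le s a t w.1 w.2).trans_eq (mul_comm _ _)

/-- The same differentiation in `t`, where the derivative of `lowerMass` is the density itself. -/
theorem integral_snd_mul_density (hV : ∀ s t, ∫ w : ℝ × ℝ, w.2 * lowerMass φ s t w.1 w.2 = 0)
    (s t : ℝ) : ∫ w : ℝ × ℝ, w.2 * φ s t w.1 w.2 = 0 := by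
  have i0 : ∀ t, Integrable fun w : ℝ × ℝ => w.2 * lowerMass φ s t w.1 w.2 := fun t =>
    R.integrable_weight_mul measurable_snd abs_snd_le_weight
      (R.measurable_lower_comp measurable_const measurable_const measurable_id)
      fun w => R.abs_lower_le _ _ _ _
  have i1 : Integrable fun w : ℝ × ℝ => w.2 * φ s t w.1 w.2 :=
    R.integrable_weight_mul measurable_snd abs_snd_le_weight
      (R.measurable_density_comp measurable_const measurable_const measurable_id)
      fun w => R.abs_density_le s t w.1 w.2
  refine eq_zero_of_abs_mul_le (K := B) fun a _ => ?_
  have e : a * (∫ w : ℝ × ℝ, w.2 * φ s t w.1 w.2) =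
      -∫ w : ℝ × ℝ, w.2 * (lowerMass φ s (t + a) w.1 w.2 - lowerMass φ s t w.1 w.2 -
        a * φ s t w.1 w.2) := by
    have e2 : (fun w : ℝ × ℝ => w.2 * (lowerMass φ s (t + a) w.1 w.2 - lowerMass φ s t w.1 w.2 -
        a * φ s t w.1 w.2)) = fun w =>
        (w.2 * lowerMass φ s (t + a) w.1 w.2 - w.2 * lowerMass φ s t w.1 w.2) -
        a * (w.2 * φ s t w.1 w.2) := by
      ext w; ring
    rw [e2, integral_sub_sub_mul (i0 _) (i0 _) i1, hV, hV]
    ring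
  rw [e, abs_neg, mul_comm B]
  refine R.abs_integral_le (sq_nonneg a) fun w => R.abs_weight_mul_le abs_snd_le_weight ?_
  exact (R.abs_lower_taylor_t_le s t a w.1 w.2).trans_eq (mul_comm _ _)

/-- Perturbing by centred errors changes `smoothLower` to second order only. -/
theorem abs_smoothLower_sub_zero_le
    (hU : ∀ s t, ∫ w : ℝ × ℝ, w.1 * lowerMass φ s t w.1 w.2 = 0)
    (hV : ∀ s t, ∫ w : ℝ × ℝ, w.2 * lowerMass φ s t w.1 w.2 = 0) {e₁ e₂ E : ℝ}
    (he₁ : |e₁| ≤ E) (he₂ : |e₂| ≤ E) (x y : ℝ) :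
    |smoothLower φ e₁ e₂ x y - smoothLower φ 0 0 x y| ≤ B * E ^ 2 := by
  have he : 0 ≤ E := (abs_nonneg _).trans he₁
  have i1 : Integrable fun w : ℝ × ℝ => w.1 * deriv (fun s' => lowerMass φ s' y w.1 w.2) x :=
    R.integrable_weight_mul measurable_fst abs_fst_le_weight (R.measurable_deriv_lower x y)
      fun w => R.lower_ds_le_dom x y w.1 w.2
  have i2 : Integrable fun w : ℝ × ℝ => w.2 * φ x y w.1 w.2 :=
    R.integrable_weight_mul measurable_snd abs_snd_le_weight
      (R.measurable_density_comp measurable_const measurable_const measurable_id)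
      fun w => R.abs_density_le x y w.1 w.2
  have i3 := R.smoothLower_integrable e₁ e₂ x y
  have i4 := R.smoothLower_integrable 0 0 x y
  -- The first-order terms have zero integral and may be inserted freely, which leaves the Taylor
  -- remainder.
  have e : smoothLower φ e₁ e₂ x y - smoothLower φ 0 0 x y =
      ∫ w : ℝ × ℝ, (lowerMass φ (x + -(e₁ * w.1)) (y + -(e₂ * w.2)) w.1 w.2 -
        lowerMass φ x y w.1 w.2 - -(e₁ * w.1) * deriv (fun s' => lowerMass φ s' y w.1 w.2) x -
        -(e₂ * w.2) * φ x y w.1 w.2) := by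
    have e2 : (fun w : ℝ × ℝ => lowerMass φ (x + -(e₁ * w.1)) (y + -(e₂ * w.2)) w.1 w.2 -
        lowerMass φ x y w.1 w.2 - -(e₁ * w.1) * deriv (fun s' => lowerMass φ s' y w.1 w.2) x -
        -(e₂ * w.2) * φ x y w.1 w.2) = fun w =>
        (lowerMass φ (x - e₁ * w.1) (y - e₂ * w.2) w.1 w.2 -
          lowerMass φ (x - 0 * w.1) (y - 0 * w.2) w.1 w.2) +
        (e₁ * (w.1 * deriv (fun s' => lowerMass φ s' y w.1 w.2) x) +
        e₂ * (w.2 * φ x y w.1 w.2)) := by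
      ext w
      simp only [zero_mul, sub_zero, ← sub_eq_add_neg]
      ring
    rw [e2, integral_sub_add_mul_add_mul i3 i4 i1 i2, R.integral_fst_mul_deriv hU, R.integral_snd_mul_density hV]
    simp [smoothLower]
  rw [e, mul_comm B]
  refine R.abs_integral_le (by positivity) fun w => ?_
  refine (R.abs_lower_taylor_le x _ y _ w.1 w.2).trans ?_
  have hp := R.p_nonneg w.1 w.2
  rw [abs_neg, abs_neg, abs_mul, abs_mul]
  calc _ ≤ p w.1 w.2 * (E * |w.1| + E * |w.2|) ^ 2 := by gcongr
    _ ≤ p w.1 w.2 * (E * (1 + |w.1| + |w.2|)) ^ 2 := by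
        gcongr
        nlinarith
    _ = _ := by ring

/-- The density of the perturbed pair. -/
theorem abs_smoothLower_add_sub_le (e₁ e₂ x y b : ℝ) :
    |smoothLower φ e₁ e₂ x (y + b) - smoothLower φ e₁ e₂ x y -
      b * ∫ w : ℝ × ℝ, φ (x - e₁ * w.1) (y - e₂ * w.2) w.1 w.2| ≤ B * b ^ 2 := by
  have i1 : Integrable fun w : ℝ × ℝ => φ (x - e₁ * w.1) (y - e₂ * w.2) w.1 w.2 :=
    R.integrable_density (by fun_prop) (by fun_prop)
  unfold smoothLower
  rw [← integral_sub_sub_mul (R.smoothLower_integrable _ _ _ _)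
    (R.smoothLower_integrable _ _ _ _) i1, mul_comm]
  refine R.abs_integral_le (sq_nonneg b) fun w => R.abs_le_of_le_p (sq_nonneg b) ?_
  have := R.abs_lower_taylor_t_le (x - e₁ * w.1) (y - e₂ * w.2) b w.1 w.2
  rw [show y - e₂ * w.2 + b = y + b - e₂ * w.2 by ring] at this
  linarith

/-- Lipschitz continuity in both variables. First order in the noise suffices here, since it only
serves to keep the joint density positive near the target point. -/
theorem abs_density_sub_marginal_le {e₁ e₂ e : ℝ} (he₁ : |e₁| ≤ e) (he₂ : |e₂| ≤ e)
    (x q y : ℝ) :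
    |(∫ w : ℝ × ℝ, φ (x - e₁ * w.1) (y - e₂ * w.2) w.1 w.2) - marginalDensity φ q y| ≤
      B * (|x - q| + e) := by
  have he : 0 ≤ e := (abs_nonneg _).trans he₁
  have i1 : Integrable fun w : ℝ × ℝ => φ (x - e₁ * w.1) (y - e₂ * w.2) w.1 w.2 :=
    R.integrable_density (by fun_prop) (by fun_prop)
  have i2 : Integrable fun w : ℝ × ℝ => φ q y w.1 w.2 :=
    R.integrable_density measurable_const measurable_const
  unfold marginalDensity
  rw [← integral_sub i1 i2, mul_comm]
  refine R.abs_integral_le (by positivity) fun w => ?_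
  have hp := R.p_nonneg w.1 w.2
  have h1 := R.abs_sub_t_le (x - e₁ * w.1) y (y - e₂ * w.2) w.1 w.2
  have h2 := R.abs_sub_s_le q (x - e₁ * w.1) y w.1 w.2
  have h3 : |y - e₂ * w.2 - y| ≤ e * |w.2| := by
    rw [sub_sub_cancel_left, abs_neg, abs_mul]; gcongr
  have h4 : |x - e₁ * w.1 - q| ≤ |x - q| + e * |w.1| := by
    rw [show x - e₁ * w.1 - q = (x - q) - e₁ * w.1 by ring]
    refine (abs_sub _ _).trans ?_
    rw [abs_mul]; gcongr
  calc _ = |(φ (x - e₁ * w.1) (y - e₂ * w.2) w.1 w.2 - φ (x - e₁ * w.1) y w.1 w.2) +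
        (φ (x - e₁ * w.1) y w.1 w.2 - φ q y w.1 w.2)| := by congr 1; ring
    _ ≤ p w.1 w.2 * (e * |w.2|) + p w.1 w.2 * (|x - q| + e * |w.1|) :=
        (abs_add_le _ _).trans (add_le_add (h1.trans (by gcongr)) (h2.trans (by gcongr)))
    _ = p w.1 w.2 * (|x - q| + e * (|w.1| + |w.2|)) := by ring
    _ ≤ p w.1 w.2 * ((|x - q| + e) * (1 + |w.1| + |w.2|)) := by
        gcongr
        have a1 := abs_nonneg w.1
        have a2 := abs_nonneg w.2
        have a3 := mul_nonneg (abs_nonneg (x - q)) (add_nonneg a1 a2)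
        nlinarith
    _ ≤ p w.1 w.2 * ((|x - q| + e) * (1 + |w.1| + |w.2|) ^ 2) := by
        gcongr
        exact add_abs_le_weight w
    _ = _ := by ring

theorem exists_taylor_smoothLower (x y : ℝ) : ∃ d, |d| ≤ B ∧ ∀ x',
    |smoothLower φ 0 0 x' y - smoothLower φ 0 0 x y - d * (x' - x)| ≤ B * (x' - x) ^ 2 := by
  have i1 : Integrable fun w : ℝ × ℝ => deriv (fun s' => lowerMass φ s' y w.1 w.2) x :=
    R.integrable_of_le (K := 1) (R.measurable_deriv_lower x y).aestronglyMeasurable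
      fun w => R.abs_le_of_le_p zero_le_one (by rw [one_mul]; exact R.lower_ds_le_dom _ _ _ _)
  have i2 : ∀ x, Integrable fun w : ℝ × ℝ => lowerMass φ x y w.1 w.2 := fun x =>
    R.integrable_lower measurable_const measurable_const
  refine ⟨∫ w : ℝ × ℝ, deriv (fun s' => lowerMass φ s' y w.1 w.2) x, ?_, fun x' => ?_⟩
  · have := R.abs_integral_le (G := fun w => deriv (fun s' => lowerMass φ s' y w.1 w.2) x)
      zero_le_one
      fun w => R.abs_le_of_le_p zero_le_one (by rw [one_mul]; exact R.lower_ds_le_dom _ _ _ _)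
    rwa [one_mul] at this
  · simp only [smoothLower, zero_mul, sub_zero]
    rw [mul_comm _ (x' - x), ← integral_sub_sub_mul (i2 _) (i2 _) i1, mul_comm]
    refine R.abs_integral_le (sq_nonneg _) fun w => R.abs_le_of_le_p (sq_nonneg _) ?_
    have := R.abs_lower_taylor_s_le x (x' - x) y w.1 w.2
    rw [add_sub_cancel] at this
    linarith

theorem iSup_smoothLower_nonneg (e₁ e₂ x : ℝ) : 0 ≤ ⨆ n : ℕ, smoothLower φ e₁ e₂ x n :=
  Real.iSup_nonneg fun _ => R.smoothLower_nonneg _ _ _ _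

theorem iSup_smoothLower_le (e₁ e₂ x : ℝ) : ⨆ n : ℕ, smoothLower φ e₁ e₂ x n ≤ B :=
  ciSup_le fun _ => R.smoothLower_le _ _ _ _

theorem abs_iSup_smoothLower_sub_le (e₁ e₂ x x' : ℝ) :
    |(⨆ n : ℕ, smoothLower φ e₁ e₂ x' n) - ⨆ n : ℕ, smoothLower φ e₁ e₂ x n| ≤ B * |x' - x| :=
  le_of_tendsto ((R.tendsto_smoothLower e₁ e₂ x').sub (R.tendsto_smoothLower e₁ e₂ x)).abs
    (Eventually.of_forall fun _ => R.abs_smoothLower_sub_le _ _ _ _ _)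

theorem abs_iSup_smoothLower_sub_zero_le
    (hU : ∀ s t, ∫ w : ℝ × ℝ, w.1 * lowerMass φ s t w.1 w.2 = 0)
    (hV : ∀ s t, ∫ w : ℝ × ℝ, w.2 * lowerMass φ s t w.1 w.2 = 0) {e₁ e₂ e : ℝ}
    (he₁ : |e₁| ≤ e) (he₂ : |e₂| ≤ e) (x : ℝ) :
    |(⨆ n : ℕ, smoothLower φ e₁ e₂ x n) - ⨆ n : ℕ, smoothLower φ 0 0 x n| ≤ B * e ^ 2 :=
  le_of_tendsto ((R.tendsto_smoothLower e₁ e₂ x).sub (R.tendsto_smoothLower 0 0 x)).abs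
    (Eventually.of_forall fun _ => R.abs_smoothLower_sub_zero_le hU hV he₁ he₂ _ _)

/-- The slopes at the levels `n` lie in the compact interval `[-B, B]`; the limit of a convergent
subsequence serves as slope for the supremum, with no derivative of the supremum required. -/
theorem exists_taylor_iSup_smoothLower (x : ℝ) : ∃ d, |d| ≤ B ∧ ∀ x',
    |(⨆ n : ℕ, smoothLower φ 0 0 x' n) - (⨆ n : ℕ, smoothLower φ 0 0 x n) - d * (x' - x)| ≤
      B * (x' - x) ^ 2 := by
  choose d hd hT using fun n : ℕ => R.exists_taylor_smoothLower x n
  obtain ⟨d', hd', ψ, hψ, hlim⟩ := isCompact_Icc.tendsto_subseq (x := d) (s := Icc (-B) B)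
    fun n => abs_le.1 (hd n)
  refine ⟨d', abs_le.2 hd', fun x' => ?_⟩
  have t1 := (R.tendsto_smoothLower 0 0 x').comp hψ.tendsto_atTop
  have t2 := (R.tendsto_smoothLower 0 0 x).comp hψ.tendsto_atTop
  exact le_of_tendsto ((t1.sub t2).sub (hlim.mul_const _)).abs
    (Eventually.of_forall fun n => hT (ψ n) x')

end RegularDensity

/-- A nonnegative Lipschitz function is bounded by the square root of its integral. -/
theorem le_sqrt_of_lipschitz {g : ℝ → ℝ} {K m : ℝ} (hK : 0 < K) (hg : ∀ x, 0 ≤ g x)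
    (hgi : Integrable g) (hL : ∀ x y, |g x - g y| ≤ K * |x - y|) (hm : ∫ x, g x ≤ m) (x : ℝ) :
    g x ≤ 2 * √(K * m) := by
  -- On an interval of length `r` the function stays above half its value at `x`, so its integral is
  -- at least `(g x)² / (4 K)`.
  set r := g x / (2 * K) with hr
  have hr0 : 0 ≤ r := div_nonneg (hg x) (by positivity)
  have h1 : r * (g x / 2) ≤ m := by
    calc r * (g x / 2) = ∫ _ in Icc x (x + r), g x / 2 := by
          simp [hr0]
      _ ≤ ∫ t in Icc x (x + r), g t := by
          refine setIntegral_mono_on (by simp) hgi.integrableOn measurableSet_Icc fun t ht => ?_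
          have h2 := abs_le.1 (hL t x)
          have h3 : |t - x| ≤ r := by
            rw [abs_le]; constructor <;> linarith [ht.1, ht.2]
          have h4 : K * |t - x| ≤ g x / 2 := by
            calc _ ≤ K * r := by gcongr
              _ = _ := by rw [hr]; field_simp
          linarith
      _ ≤ ∫ t, g t := setIntegral_le_integral hgi (Eventually.of_forall hg)
      _ ≤ m := hm
  have h2 : (g x / 2) ^ 2 ≤ K * m := by
    calc (g x / 2) ^ 2 = K * (r * (g x / 2)) := by rw [hr]; field_simp
      _ ≤ K * m := by gcongr
  have h3 := Real.le_sqrt_of_sq_le h2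
  linarith

namespace RegularDensity

set_option linter.unusedSectionVars false

variable {S : Type*} [MeasurableSpace S] {ν : Measure S} [IsProbabilityMeasure ν]
  {κ : Kernel S (ℝ × ℝ)} [IsMarkovKernel κ]
  {l : ℕ} {φ : ℝ → ℝ → ℝ → ℝ → ℝ} {p : ℝ → ℝ → ℝ} {B : ℝ} (R : RegularDensity ν κ l φ p B)

include R

theorem integrable_lower_prod (t : ℝ) :
    Integrable fun z : ℝ × ℝ × ℝ => lowerMass φ z.1 t z.2.1 z.2.2 := by
  have hm : Measurable fun z : ℝ × ℝ × ℝ => lowerMass φ z.1 t z.2.1 z.2.2 :=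
    R.measurable_lower_comp measurable_fst measurable_const measurable_snd
  refine ⟨hm.aestronglyMeasurable, ?_⟩
  rw [hasFiniteIntegral_iff_ofReal (Eventually.of_forall fun z => R.lower_nonneg _ _ _ _)]
  have h := congrArg (fun m => m univ) (R.map_restrict_eq (c := fun _ => t) measurable_const)
  simp only [withDensity_apply _ MeasurableSet.univ, Measure.restrict_univ] at h
  rw [← h]
  have := Measure.isProbabilityMeasure_map (μ := scenarioLaw ν κ l)
    (measurable_scaledErrors κ l).aemeasurable
  exact measure_lt_top _ _

theorem integrable_lower_indicator (e q t : ℝ) :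
    Integrable ({z : ℝ × ℝ × ℝ | z.1 + e * z.2.1 < q}.indicator
      fun z => lowerMass φ z.1 t z.2.1 z.2.2) :=
  (R.integrable_lower_prod t).indicator (measurableSet_lt (by fun_prop) (by fun_prop))

omit R in
theorem integral_lower_indicator (e q t : ℝ) (w : ℝ × ℝ) :
    ∫ s, {z : ℝ × ℝ × ℝ | z.1 + e * z.2.1 < q}.indicator
      (fun z => lowerMass φ z.1 t z.2.1 z.2.2) (s, w) =
      ∫ s in Iic (q - e * w.1), lowerMass φ s t w.1 w.2 := by
  rw [integral_Iic_eq_integral_Iio, ← integral_indicator measurableSet_Iio]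
  refine integral_congr_ae (Eventually.of_forall fun s => ?_)
  simp [indicator, lt_sub_iff_add_lt]

theorem prob_perturbed_lt (e q t : ℝ) :
    (scenarioLaw ν κ l).real {x | (scaledErrors κ x).1 + e * (scaledErrors κ x).2.2.1 < q ∧
      (scaledErrors κ x).2.1 ≤ t} =
      ∫ w : ℝ × ℝ, ∫ s in Iic (q - e * w.1), lowerMass φ s t w.1 w.2 := by
  have hse := measurable_scaledErrors κ l
  have hA : MeasurableSet {z : ℝ × ℝ × ℝ | z.1 + e * z.2.1 < q} :=
    measurableSet_lt (by fun_prop) (by fun_prop)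
  have hE : MeasurableSet {e : ℝ × ℝ × ℝ × ℝ | e.2.1 ≤ t} :=
    measurableSet_le (by fun_prop) (by fun_prop)
  have hpr : Measurable fun e : ℝ × ℝ × ℝ × ℝ => (e.1, e.2.2) := by fun_prop
  have h := congrArg (fun m => m {z : ℝ × ℝ × ℝ | z.1 + e * z.2.1 < q})
    (R.map_restrict_eq (c := fun _ => t) measurable_const)
  simp only [withDensity_apply _ hA] at h
  rw [Measure.map_apply hpr hA, Measure.restrict_apply (hpr hA),
    Measure.map_apply hse ((hpr hA).inter hE)] at h
  simp only [← integral_lower_indicator]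
  rw [← integral_prod_symm _ (R.integrable_lower_indicator e q t), ← Measure.volume_eq_prod,
    integral_indicator hA, integral_eq_lintegral_of_nonneg_ae
      (Eventually.of_forall fun z => R.lower_nonneg _ _ _ _)
      (R.integrable_lower_prod t).aestronglyMeasurable.restrict, ← h]
  rfl

/-- For fixed errors the noise moves the endpoint from `q` to `q - e U`. The first-order change is
proportional to `U` times the mass at `q` and integrates to zero; the rest is quadratic in `e U`. -/
theorem abs_prob_perturbed_sub_le
    (hU : ∀ s t, ∫ w : ℝ × ℝ, w.1 * lowerMass φ s t w.1 w.2 = 0) (e q t : ℝ) :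
    |(scenarioLaw ν κ l).real {x | (scaledErrors κ x).1 + e * (scaledErrors κ x).2.2.1 < q ∧
      (scaledErrors κ x).2.1 ≤ t} -
      (scenarioLaw ν κ l).real {x | (scaledErrors κ x).1 < q ∧ (scaledErrors κ x).2.1 ≤ t}| ≤
      B * e ^ 2 := by
  have h0 := R.prob_perturbed_lt 0 q t
  simp only [zero_mul, add_zero, sub_zero] at h0
  rw [R.prob_perturbed_lt e q t, h0]
  have hi : ∀ e, Integrable fun w : ℝ × ℝ =>
      ∫ s in Iic (q - e * w.1), lowerMass φ s t w.1 w.2 := by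
    intro e
    simp only [← integral_lower_indicator]
    exact (R.integrable_lower_indicator e q t).integral_prod_right
  have hi0 := hi 0
  simp only [zero_mul, sub_zero] at hi0
  have i1 : Integrable fun w : ℝ × ℝ => w.1 * lowerMass φ q t w.1 w.2 :=
    R.integrable_weight_mul measurable_fst abs_fst_le_weight
      (R.measurable_lower_comp measurable_const measurable_const measurable_id)
      fun w => R.abs_lower_le _ _ _ _
  have hz := integral_sub_sub_mul (hi e) hi0 i1 (-e)
  rw [hU, mul_zero, sub_zero] at hz
  rw [← hz, mul_comm B, ← Real.norm_eq_abs]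
  refine (norm_integral_le_of_norm_le (R.integrable_dom.const_mul (e ^ 2)) ?_).trans ?_
  · filter_upwards [(R.integrable_lower_prod t).prod_left_ae] with w hw
    have hc : Continuous fun s => lowerMass φ s t w.1 w.2 := (R.lower_diff_s t w.1 w.2).continuous
    rw [intervalIntegral.integral_Iic_sub_Iic hw.integrableOn hw.integrableOn]
    have e1 : (∫ s in q..(q - e * w.1), lowerMass φ s t w.1 w.2) -
        -e * (w.1 * lowerMass φ q t w.1 w.2) =
        ∫ s in q..(q - e * w.1), (lowerMass φ s t w.1 w.2 - lowerMass φ q t w.1 w.2) := by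
      rw [intervalIntegral.integral_sub (hc.intervalIntegrable _ _) (by simp)]
      simp
      ring
    rw [e1]
    have hp := R.p_nonneg w.1 w.2
    have h2 := intervalIntegral.norm_integral_le_of_norm_le_const (a := q) (b := q - e * w.1)
      (f := fun s => lowerMass φ s t w.1 w.2 - lowerMass φ q t w.1 w.2)
      (C := p w.1 w.2 * |e * w.1|) fun s hs => by
        refine (R.abs_lower_sub_s_le q s t w.1 w.2).trans (mul_le_mul_of_nonneg_left ?_ hp)
        have := abs_sub_left_of_mem_uIcc (uIoc_subset_uIcc hs)
        simpa [abs_mul] using this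
    refine h2.trans ?_
    rw [sub_sub_cancel_left, abs_neg, mul_assoc, abs_mul_abs_self]
    have a1 : w.1 * w.1 ≤ (1 + |w.1| + |w.2|) ^ 2 := by
      rw [← abs_mul_abs_self]
      have := abs_nonneg w.1
      have := abs_nonneg w.2
      nlinarith
    calc _ = e ^ 2 * (p w.1 w.2 * (w.1 * w.1)) := by ring
      _ ≤ e ^ 2 * (p w.1 w.2 * (1 + |w.1| + |w.2|) ^ 2) := by gcongr
      _ = _ := by ring
  · rw [integral_const_mul]
    exact mul_le_mul_of_nonneg_left R.integral_dom_le (sq_nonneg e)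

/-- Centred errors change the distribution function of the first coordinate to second order. -/
theorem abs_cdf_perturbed_sub_le
    (hU : ∀ s t, ∫ w : ℝ × ℝ, w.1 * lowerMass φ s t w.1 w.2 = 0) (e q : ℝ) :
    |(scenarioLaw ν κ l).real {x | (scaledErrors κ x).1 + e * (scaledErrors κ x).2.2.1 < q} -
      (scenarioLaw ν κ l).real {x | (scaledErrors κ x).1 < q}| ≤ B * e ^ 2 := by
  have hlim : ∀ e : ℝ, Tendsto (fun n : ℕ => (scenarioLaw ν κ l).real
      {x | (scaledErrors κ x).1 + e * (scaledErrors κ x).2.2.1 < q ∧ (scaledErrors κ x).2.1 ≤ n})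
      atTop (𝓝 ((scenarioLaw ν κ l).real
        {x | (scaledErrors κ x).1 + e * (scaledErrors κ x).2.2.1 < q})) := by
    intro e
    have hU : {x : S × (Fin l → ℝ × ℝ) |
        (scaledErrors κ x).1 + e * (scaledErrors κ x).2.2.1 < q} = ⋃ n : ℕ,
        {x | (scaledErrors κ x).1 + e * (scaledErrors κ x).2.2.1 < q ∧
          (scaledErrors κ x).2.1 ≤ n} := by
      ext x
      simp only [mem_iUnion, mem_ofPred_eq, exists_and_left]
      exact ⟨fun h => ⟨h, exists_nat_ge _⟩, fun h => h.1⟩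
    rw [hU]
    refine (ENNReal.tendsto_toReal (measure_ne_top _ _)).comp
      (tendsto_measure_iUnion_atTop fun n m hnm x hx => ?_)
    exact ⟨hx.1, hx.2.trans (by exact_mod_cast hnm)⟩
  have h0 := hlim 0
  simp only [zero_mul, add_zero] at h0
  exact le_of_tendsto ((hlim e).sub h0).abs
    (Eventually.of_forall fun n => R.abs_prob_perturbed_sub_le hU e q n)

end RegularDensity

/-! ### The noise-free pair, VaR and CoVaR -/

theorem eq_of_withDensity_ofReal_eq {g₁ g₂ : ℝ → ℝ} (h₁ : Continuous g₁) (h₂ : Continuous g₂)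
    (p₁ : ∀ x, 0 ≤ g₁ x) (p₂ : ∀ x, 0 ≤ g₂ x)
    (hfin : ∫⁻ x, ENNReal.ofReal (g₁ x) ≠ ⊤)
    (h : (volume.withDensity fun x => ENNReal.ofReal (g₁ x)) =
      volume.withDensity fun x => ENNReal.ofReal (g₂ x)) : g₁ = g₂ := by
  have h3 := (withDensity_eq_iff (h₁.measurable.ennreal_ofReal.aemeasurable)
    (h₂.measurable.ennreal_ofReal.aemeasurable) hfin).1 h
  refine (Continuous.ae_eq_iff_eq (volume : Measure ℝ) h₁ h₂).1 ?_
  filter_upwards [h3] with x hx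
  exact (ENNReal.ofReal_eq_ofReal_iff (p₁ x) (p₂ x)).1 hx

/-- Averages of a Lipschitz function over shrinking intervals converge to its value. -/
theorem tendsto_average_Icc {g : ℝ → ℝ} {K : ℝ} (q : ℝ)
    (hL : ∀ x x', |g x' - g x| ≤ K * |x' - x|) (hg : Continuous g) :
    Tendsto (fun ε : ℝ => (∫ x in Icc (q - ε) (q + ε), g x) / (2 * ε)) (𝓝[>] 0) (𝓝 (g q)) := by
  have hK : Tendsto (fun ε : ℝ => K * ε) (𝓝[>] 0) (𝓝 0) := by
    have : Tendsto (fun a : ℝ => K * a) (𝓝 0) (𝓝 (K * 0)) := tendsto_id.const_mul K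
    rw [mul_zero] at this
    exact this.mono_left nhdsWithin_le_nhds
  rw [tendsto_iff_dist_tendsto_zero]
  refine squeeze_zero' (Eventually.of_forall fun _ => dist_nonneg) ?_ hK
  filter_upwards [self_mem_nhdsWithin] with ε hε
  have hε0 : (0 : ℝ) < ε := hε
  have hK0 : 0 ≤ K := by
    have := (abs_nonneg _).trans (hL 0 1)
    simpa using this
  have h1 : ‖∫ x in Icc (q - ε) (q + ε), (g x - g q)‖ ≤
      K * ε * volume.real (Icc (q - ε) (q + ε)) := by
    refine norm_setIntegral_le_of_norm_le_const (by simp) fun x hx => ?_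
    refine (hL q x).trans (mul_le_mul_of_nonneg_left ?_ hK0)
    rw [abs_le]; constructor <;> linarith [hx.1, hx.2]
  have e1 : ∫ x in Icc (q - ε) (q + ε), (g x - g q) =
      (∫ x in Icc (q - ε) (q + ε), g x) - 2 * ε * g q := by
    rw [integral_sub hg.continuousOn.integrableOn_Icc (by simp)]
    simp only [setIntegral_const, Real.volume_real_Icc, smul_eq_mul]
    rw [max_eq_left (by linarith)]
    ring
  rw [e1, Real.volume_real_Icc, max_eq_left (by linarith), Real.norm_eq_abs] at h1
  rw [Real.dist_eq]
  have e2 : (∫ x in Icc (q - ε) (q + ε), g x) / (2 * ε) - g q =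
      ((∫ x in Icc (q - ε) (q + ε), g x) - 2 * ε * g q) / (2 * ε) := by
    field_simp
  rw [e2, abs_div, abs_of_pos (by positivity : 0 < 2 * ε), div_le_iff₀ (by positivity)]
  linarith

section

variable {S : Type*} [MeasurableSpace S] (ν : Measure S) [IsProbabilityMeasure ν]
  (κ : Kernel S (ℝ × ℝ)) [IsMarkovKernel κ]

theorem map_perturbedPair_zero (l : ℕ) :
    (scenarioLaw ν κ l).map (perturbedPair κ 0 0) =
      ν.map fun z => (muFun κ z, piFun κ z) := by
  have h : Measurable fun z => (muFun κ z, piFun κ z) :=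
    (measurable_muFun κ).prodMk (measurable_piFun κ)
  conv_rhs => rw [← scenarioLaw_map_fst ν κ l]
  rw [Measure.map_map h measurable_fst]
  congr 1
  ext x <;> simp [perturbedPair, scaledErrors]

omit [IsMarkovKernel κ] in
theorem perturbedPair_inv_sqrt {l : ℕ} (hl : 1 ≤ l) :
    perturbedPair κ (√(l : ℝ))⁻¹ (√(l : ℝ))⁻¹ (l := l) = fun x => (meanX x, meanY x) := by
  have h0 : (0 : ℝ) < √(l : ℝ) := Real.sqrt_pos.2 (by exact_mod_cast hl)
  ext x <;> simp [perturbedPair, scaledErrors, h0.ne']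

end

namespace RegularDensity

set_option linter.unusedSectionVars false

variable {S : Type*} [MeasurableSpace S] {ν : Measure S} [IsProbabilityMeasure ν]
  {κ : Kernel S (ℝ × ℝ)} [IsMarkovKernel κ]
  {l : ℕ} {φ : ℝ → ℝ → ℝ → ℝ → ℝ} {p : ℝ → ℝ → ℝ} {B : ℝ} (R : RegularDensity ν κ l φ p B)

include R

theorem lintegral_smoothLower (e₁ e₂ y : ℝ) :
    ∫⁻ x, ENNReal.ofReal (smoothLower φ e₁ e₂ x y) =
      ((scenarioLaw ν κ l).map (perturbedPair κ e₁ e₂)) {w | w.2 ≤ y} := by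
  have h := congrArg (fun m => m univ) (R.map_fst_restrict_eq e₁ e₂ y)
  simp only [withDensity_apply _ MeasurableSet.univ, Measure.restrict_univ] at h
  rw [← h, Measure.map_apply measurable_fst MeasurableSet.univ]
  simp

theorem lintegral_iSup_smoothLower (e₁ e₂ : ℝ) :
    ∫⁻ x, ENNReal.ofReal (⨆ n : ℕ, smoothLower φ e₁ e₂ x n) = 1 := by
  have h := congrArg (fun m => m univ) (R.map_fst_eq e₁ e₂)
  simp only [withDensity_apply _ MeasurableSet.univ, Measure.restrict_univ] at h
  have := Measure.isProbabilityMeasure_map (μ := scenarioLaw ν κ l)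
    (measurable_perturbedPair κ e₁ e₂ l).aemeasurable
  rw [← h, Measure.map_apply measurable_fst MeasurableSet.univ]
  simp

theorem integrable_smoothLower (e₁ e₂ y : ℝ) :
    Integrable fun x => smoothLower φ e₁ e₂ x y := by
  refine ⟨(R.continuous_smoothLower e₁ e₂ y).aestronglyMeasurable, ?_⟩
  rw [hasFiniteIntegral_iff_ofReal (Eventually.of_forall fun x => R.smoothLower_nonneg _ _ _ _),
    R.lintegral_smoothLower]
  have := Measure.isProbabilityMeasure_map (μ := scenarioLaw ν κ l)
    (measurable_perturbedPair κ e₁ e₂ l).aemeasurable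
  exact measure_lt_top _ _

theorem continuous_iSup_smoothLower (e₁ e₂ : ℝ) :
    Continuous fun x => ⨆ n : ℕ, smoothLower φ e₁ e₂ x n :=
  (LipschitzWith.of_dist_le_mul (K := ⟨B, R.B_nonneg⟩) fun x x' =>
    R.abs_iSup_smoothLower_sub_le e₁ e₂ x' x).continuous

theorem integrable_iSup_smoothLower (e₁ e₂ : ℝ) :
    Integrable fun x => ⨆ n : ℕ, smoothLower φ e₁ e₂ x n := by
  refine ⟨(R.continuous_iSup_smoothLower e₁ e₂).aestronglyMeasurable, ?_⟩
  rw [hasFiniteIntegral_iff_ofReal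
    (Eventually.of_forall fun x => R.iSup_smoothLower_nonneg _ _ _),
    R.lintegral_iSup_smoothLower]
  simp

theorem integral_smoothLower (e₁ e₂ y : ℝ) :
    ∫ x, smoothLower φ e₁ e₂ x y =
      ((scenarioLaw ν κ l).map (perturbedPair κ e₁ e₂)).real {w | w.2 ≤ y} := by
  rw [integral_eq_lintegral_of_nonneg_ae
    (Eventually.of_forall fun x => R.smoothLower_nonneg _ _ _ _)
    (R.continuous_smoothLower e₁ e₂ y).aestronglyMeasurable, R.lintegral_smoothLower]
  rfl

theorem integral_iSup_smoothLower_sub (e₁ e₂ y : ℝ) :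
    ∫ x, ((⨆ n : ℕ, smoothLower φ e₁ e₂ x n) - smoothLower φ e₁ e₂ x y) =
      ((scenarioLaw ν κ l).map (perturbedPair κ e₁ e₂)).real {w | y < w.2} := by
  have := Measure.isProbabilityMeasure_map (μ := scenarioLaw ν κ l)
    (measurable_perturbedPair κ e₁ e₂ l).aemeasurable
  rw [integral_sub (R.integrable_iSup_smoothLower e₁ e₂) (R.integrable_smoothLower e₁ e₂ y),
    R.integral_smoothLower, integral_eq_lintegral_of_nonneg_ae
      (Eventually.of_forall fun x => R.iSup_smoothLower_nonneg _ _ _)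
      (R.continuous_iSup_smoothLower e₁ e₂).aestronglyMeasurable, R.lintegral_iSup_smoothLower]
  have h : {w : ℝ × ℝ | y < w.2} = {w | w.2 ≤ y}ᶜ := by ext w; simp
  rw [h, probReal_compl_eq_one_sub (measurableSet_le measurable_snd measurable_const)]
  simp

/-- The density of the noise-free pair does not depend on the inner sample size. -/
theorem smoothLower_zero_eq {l' : ℕ} {φ' : ℝ → ℝ → ℝ → ℝ → ℝ} {p' : ℝ → ℝ → ℝ} {B' : ℝ}
    (R' : RegularDensity ν κ l' φ' p' B') (x y : ℝ) :
    smoothLower φ 0 0 x y = smoothLower φ' 0 0 x y := by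
  have h1 := R.map_fst_restrict_eq 0 0 y
  rw [map_perturbedPair_zero, ← map_perturbedPair_zero ν κ l', R'.map_fst_restrict_eq] at h1
  refine congrFun (eq_of_withDensity_ofReal_eq (R.continuous_smoothLower 0 0 y)
    (R'.continuous_smoothLower 0 0 y) (fun _ => R.smoothLower_nonneg _ _ _ _)
    (fun _ => R'.smoothLower_nonneg _ _ _ _) ?_ h1.symm) x
  rw [R.lintegral_smoothLower]
  have := Measure.isProbabilityMeasure_map (μ := scenarioLaw ν κ l)
    (measurable_perturbedPair κ 0 0 l).aemeasurable
  exact measure_ne_top _ _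

/-- Both sides are the first-order coefficient in `y` of the same noise-free function. The joint
density at the target point, and with it every constant below, is thus independent of `l`. -/
theorem marginalDensity_eq {l' : ℕ} {φ' : ℝ → ℝ → ℝ → ℝ → ℝ} {p' : ℝ → ℝ → ℝ} {B' : ℝ}
    (R' : RegularDensity ν κ l' φ' p' B') (x y : ℝ) :
    marginalDensity φ x y = marginalDensity φ' x y := by
  rw [← sub_eq_zero]
  refine eq_zero_of_abs_mul_le (K := B + B') fun b _ => ?_
  have h1 := R.abs_smoothLower_add_sub_le 0 0 x y b
  have h2 := R'.abs_smoothLower_add_sub_le 0 0 x y b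
  simp only [zero_mul, sub_zero] at h1 h2
  rw [R.smoothLower_zero_eq R', R.smoothLower_zero_eq R'] at h1
  change |_ - b * marginalDensity φ x y| ≤ _ at h1
  change |_ - b * marginalDensity φ' x y| ≤ _ at h2
  rw [abs_le] at h1 h2 ⊢
  constructor <;> nlinarith [h1.1, h1.2, h2.1, h2.2]

theorem measureReal_pi_le_mu_near (q y ε : ℝ) :
    ν.real {z | piFun κ z ≤ y ∧ |muFun κ z - q| ≤ ε} =
      ∫ x in Icc (q - ε) (q + ε), smoothLower φ 0 0 x y := by
  have hm : Measurable fun z => (muFun κ z, piFun κ z) :=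
    (measurable_muFun κ).prodMk (measurable_piFun κ)
  have hy : MeasurableSet {w : ℝ × ℝ | w.2 ≤ y} := measurableSet_le measurable_snd measurable_const
  have h := congrArg (fun m => m (Icc (q - ε) (q + ε))) (R.map_fst_restrict_eq 0 0 y)
  simp only [map_perturbedPair_zero, withDensity_apply _ measurableSet_Icc] at h
  rw [Measure.map_apply measurable_fst measurableSet_Icc,
    Measure.restrict_apply (measurable_fst measurableSet_Icc),
    Measure.map_apply hm ((measurable_fst measurableSet_Icc).inter hy)] at h
  rw [integral_eq_lintegral_of_nonneg_ae
    (Eventually.of_forall fun x => R.smoothLower_nonneg _ _ _ _)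
    (R.continuous_smoothLower 0 0 y).aestronglyMeasurable, ← h, Measure.real]
  congr 2
  ext z
  simp only [mem_ofPred_eq, mem_preimage, mem_inter_iff, mem_Icc, abs_le]
  constructor
  · rintro ⟨a, b, c⟩; exact ⟨⟨by linarith, by linarith⟩, a⟩
  · rintro ⟨⟨b, c⟩, a⟩; exact ⟨a, by linarith, by linarith⟩

theorem measureReal_mu_near (q ε : ℝ) :
    ν.real {z | |muFun κ z - q| ≤ ε} =
      ∫ x in Icc (q - ε) (q + ε), ⨆ n : ℕ, smoothLower φ 0 0 x n := by
  have hm : Measurable fun z => (muFun κ z, piFun κ z) :=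
    (measurable_muFun κ).prodMk (measurable_piFun κ)
  have h := congrArg (fun m => m (Icc (q - ε) (q + ε))) (R.map_fst_eq 0 0)
  simp only [map_perturbedPair_zero, withDensity_apply _ measurableSet_Icc] at h
  rw [Measure.map_apply measurable_fst measurableSet_Icc,
    Measure.map_apply hm (measurable_fst measurableSet_Icc)] at h
  rw [integral_eq_lintegral_of_nonneg_ae
    (Eventually.of_forall fun x => R.iSup_smoothLower_nonneg _ _ _)
    (R.continuous_iSup_smoothLower 0 0).aestronglyMeasurable, ← h, Measure.real]
  congr 2
  ext z
  simp only [mem_ofPred_eq, mem_preimage, mem_Icc, abs_le]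
  constructor
  · rintro ⟨b, c⟩; exact ⟨by linarith, by linarith⟩
  · rintro ⟨b, c⟩; exact ⟨by linarith, by linarith⟩

/-- The CoVaR equation in terms of densities. -/
theorem smoothLower_eq_of_hasCondCDFAt {q θ β : ℝ}
    (hθ : HasCondCDFAt ν (muFun κ) (piFun κ) q θ β)
    (hq : 0 < ⨆ n : ℕ, smoothLower φ 0 0 q n) :
    smoothLower φ 0 0 q θ = β * ⨆ n : ℕ, smoothLower φ 0 0 q n := by
  have h1 := tendsto_average_Icc q (fun x x' => R.abs_smoothLower_sub_le 0 0 x x' θ)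
    (R.continuous_smoothLower 0 0 θ)
  have h2 := tendsto_average_Icc q (fun x x' => R.abs_iSup_smoothLower_sub_le 0 0 x x')
    (R.continuous_iSup_smoothLower 0 0)
  have h3 := h1.div h2 hq.ne'
  have h4 : smoothLower φ 0 0 q θ / (⨆ n : ℕ, smoothLower φ 0 0 q n) = β := by
    refine tendsto_nhds_unique (h3.congr' ?_) hθ
    filter_upwards [self_mem_nhdsWithin] with ε hε
    have hε0 : (0 : ℝ) < ε := hε
    rw [R.measureReal_pi_le_mu_near, R.measureReal_mu_near]
    exact div_div_div_cancel_right₀ (by positivity) _ _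
  rw [← h4, div_mul_cancel₀ _ hq.ne']

/-- The law of `μ(Z)` has a density and no atom at `q`. The strict form matches `cdfFst`, which
counts strictly smaller entries. -/
theorem measureReal_mu_lt {q α : ℝ} (hq : IsVaR ν (muFun κ) α q) :
    ν.real {z | muFun κ z < q} = α := by
  have h0 : ν.real {z | muFun κ z = q} = 0 := by
    have h := R.measureReal_mu_near q 0
    simp only [abs_nonpos_iff, sub_eq_zero, sub_zero, add_zero, Icc_self] at h
    rw [h]
    simp
  rw [← hq]
  have : {z | muFun κ z ≤ q} = {z | muFun κ z < q} ∪ {z | muFun κ z = q} := by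
    ext z; simp [le_iff_lt_or_eq]
  refine le_antisymm (measureReal_mono fun z (hz : muFun κ z < q) => hz.le) ?_
  rw [this]
  refine (measureReal_union_le _ _).trans ?_
  rw [h0, add_zero]

theorem integral_fst_mul_lower (hl : 1 ≤ l)
    (hX : Integrable (fun x : S × (ℝ × ℝ) => x.2.1) (ν ⊗ₘ κ)) (s t : ℝ) :
    ∫ w : ℝ × ℝ, w.1 * lowerMass φ s t w.1 w.2 = 0 := by
  refine R.integral_weight_mul_lower (k := Prod.fst) measurable_fst abs_fst_le_weight
    ((integrable_meanError (g := Prod.fst) hX l).const_mul √(l : ℝ)) (fun C hC => ?_) s t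
  have := setIntegral_meanError (g := Prod.fst) hX hl hC
  change ∫ x in Prod.fst ⁻¹' C, √(l : ℝ) * _ ∂_ = 0
  rw [integral_const_mul]
  exact mul_eq_zero_of_right _ this

theorem integral_snd_mul_lower (hl : 1 ≤ l)
    (hY : Integrable (fun x : S × (ℝ × ℝ) => x.2.2) (ν ⊗ₘ κ)) (s t : ℝ) :
    ∫ w : ℝ × ℝ, w.2 * lowerMass φ s t w.1 w.2 = 0 := by
  refine R.integral_weight_mul_lower (k := Prod.snd) measurable_snd abs_snd_le_weight
    ((integrable_meanError (g := Prod.snd) hY l).const_mul √(l : ℝ)) (fun C hC => ?_) s t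
  have := setIntegral_meanError (g := Prod.snd) hY hl hC
  change ∫ x in Prod.fst ⁻¹' C, √(l : ℝ) * _ ∂_ = 0
  rw [integral_const_mul]
  exact mul_eq_zero_of_right _ this

end RegularDensity

/-! ### The sample means as noisy pairs -/

section

variable {S : Type*} [MeasurableSpace S] {ν : Measure S} [IsProbabilityMeasure ν]
  {κ : Kernel S (ℝ × ℝ)} [IsMarkovKernel κ]

/-- Markov's inequality for the sample mean of `Y`. -/
theorem measureReal_meanY_tail {l : ℕ} (hl : 1 ≤ l)
    (hY : Integrable (fun x : S × (ℝ × ℝ) => x.2.2) (ν ⊗ₘ κ)) {θ M y : ℝ}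
    (hM : ∫ x, |x.2.2| ∂(ν ⊗ₘ κ) + |θ| ≤ M) (hy : 0 < y) :
    (scenarioLaw ν κ l).real {x | y ≤ |meanY x - θ|} ≤ M / y := by
  have hi : Integrable (fun x : S × (Fin l → ℝ × ℝ) => meanY x) (scenarioLaw ν κ l) :=
    (integrable_finsetSum _ fun j _ =>
      integrable_observation (g := Prod.snd) hY j).const_mul _
  have h1 := mul_meas_ge_le_integral_of_nonneg (μ := scenarioLaw ν κ l)
    (f := fun x => |meanY x - θ|)
    (Eventually.of_forall fun x => abs_nonneg _) (hi.sub (integrable_const θ)).abs y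
  have h2 : ∫ x, |meanY x - θ| ∂(scenarioLaw ν κ l) ≤ M := by
    calc ∫ x, |meanY x - θ| ∂(scenarioLaw ν κ l)
        ≤ ∫ x, (|meanY x| + |θ|) ∂(scenarioLaw ν κ l) :=
          integral_mono (hi.sub (integrable_const θ)).abs (hi.abs.add (integrable_const |θ|))
            fun x => abs_sub _ _
      _ = ∫ x, |meanY x| ∂(scenarioLaw ν κ l) + |θ| := by
          rw [integral_add hi.abs (integrable_const _)]; simp
      _ ≤ M := by
          have := integral_abs_mean_le (g := Prod.snd) hY hl
          exact (add_le_add_left this _).trans hM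
  rw [le_div_iff₀ hy, mul_comm]
  exact h1.trans h2

namespace RegularDensity

variable {l : ℕ} {φ : ℝ → ℝ → ℝ → ℝ → ℝ} {p : ℝ → ℝ → ℝ} {B : ℝ}

/-- Two-sided linear growth of the smoothed conditional mass near `(q, θ)`. -/
theorem slope_smoothLower (R : RegularDensity ν κ l φ p B) {q θ e ε : ℝ}
    (hε : B * ε ≤ marginalDensity φ q θ / 8) (he0 : 0 ≤ e)
    (he : B * e ≤ marginalDensity φ q θ / 8) {x b : ℝ} (hx : |x - q| ≤ ε) (hb0 : 0 ≤ b)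
    (hb : b ≤ ε) :
    marginalDensity φ q θ / 2 * b ≤
        smoothLower φ e e x (θ + b) - smoothLower φ e e x θ ∧
      marginalDensity φ q θ / 2 * b ≤
        smoothLower φ e e x θ - smoothLower φ e e x (θ - b) := by
  set G := marginalDensity φ q θ
  have hB := R.B_nonneg
  have he' : |e| ≤ e := (abs_of_nonneg he0).le
  have h0 := R.abs_density_sub_marginal_le he' he' x q θ
  have h1 := R.abs_smoothLower_add_sub_le e e x θ b
  have h2 := R.abs_smoothLower_add_sub_le e e x θ (-b)
  rw [← sub_eq_add_neg, neg_sq] at h2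
  set D := ∫ w : ℝ × ℝ, φ (x - e * w.1) (θ - e * w.2) w.1 w.2
  have h3 : B * (|x - q| + e) ≤ G / 4 := by
    have : B * |x - q| ≤ B * ε := by gcongr
    linarith
  -- A quarter of `G` is lost to the displacement of `x` and the noise, an eighth to the quadratic
  -- remainder in `b`; more than half remains.
  have hD : 3 / 4 * G ≤ D := by linarith [(abs_le.1 h0).1]
  have hbB : B * b ^ 2 ≤ G / 8 * b := by
    have : B * b ≤ B * ε := by gcongr
    nlinarith
  have hDb : 3 / 4 * G * b ≤ D * b := by gcongr
  have hG0 : 0 ≤ G := by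
    have : 0 ≤ B * e := by positivity
    linarith
  have hGb : 0 ≤ G * b := by positivity
  rw [abs_le] at h1 h2
  constructor <;> linarith [h1.1, h2.2]

/-- The sample means of one scenario form a noisy pair at scale `1 / l`. -/
theorem noisyPair (R : RegularDensity ν κ l φ p B) (hB : 0 < B) (hl : 1 ≤ l) {α β q θ : ℝ}
    (hβ : β ∈ Ioo (0 : ℝ) 1)
    (hX : Integrable (fun x : S × (ℝ × ℝ) => x.2.1) (ν ⊗ₘ κ))
    (hY : Integrable (fun x : S × (ℝ × ℝ) => x.2.2) (ν ⊗ₘ κ))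
    (hθ : IsCoVaR ν (muFun κ) (piFun κ) α β q θ) {ε M : ℝ} (hε0 : 0 < ε)
    (hG : 0 < marginalDensity φ q θ)
    (hε : B * ε ≤ marginalDensity φ q θ / 8)
    (he : B * (√(l : ℝ))⁻¹ ≤ marginalDensity φ q θ / 8)
    (hM : ∫ x, |x.2.2| ∂(ν ⊗ₘ κ) + |θ| ≤ M) :
    NoisyPair ((scenarioLaw ν κ l).map fun x => (meanX x, meanY x))
      (fun x => ⨆ n : ℕ, smoothLower φ (√(l : ℝ))⁻¹ (√(l : ℝ))⁻¹ x n)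
      (smoothLower φ (√(l : ℝ))⁻¹ (√(l : ℝ))⁻¹) α β q θ
      (2 * B + M + 2 * √(2 * B * M))
      (min (marginalDensity φ q θ / 2) (marginalDensity φ q θ / 2 * ε)) ε (1 / l) := by
  have hl0 : (0 : ℝ) < l := by exact_mod_cast hl
  have hM0 : 0 ≤ M := by
    have : 0 ≤ ∫ x, |x.2.2| ∂(ν ⊗ₘ κ) := integral_nonneg fun _ => abs_nonneg _
    linarith [abs_nonneg θ]
  have hs0 := Real.sqrt_nonneg (2 * B * M)
  -- One summand for each kind of bound: densities and expansions, tail masses, and pointwise tails.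
  set C := 2 * B + M + 2 * √(2 * B * M) with hC
  have hBC : 2 * B ≤ C := by linarith
  have hMC : M ≤ C := by linarith
  have hSC : 2 * √(2 * B * M) ≤ C := by linarith
  have hpair := perturbedPair_inv_sqrt (S := S) κ hl
  set e := (√(l : ℝ))⁻¹ with hedef
  have he0 : 0 ≤ e := by positivity
  have he2 : e ^ 2 = 1 / l := by rw [hedef, inv_pow, Real.sq_sqrt hl0.le, one_div]
  have heabs : |e| ≤ e := (abs_of_nonneg he0).le
  have hU := R.integral_fst_mul_lower hl hX
  have hV := R.integral_snd_mul_lower hl hY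
  have hslope := fun (x b : ℝ) (hx : |x - q| ≤ ε) (hb0 : 0 ≤ b) (hb : b ≤ ε) =>
    R.slope_smoothLower hε he0 he hx hb0 hb
  have hmeas : Measurable fun x : S × (Fin l → ℝ × ℝ) => (meanX x, meanY x) :=
    (measurable_meanX l).prodMk (measurable_meanY l)
  set G := marginalDensity φ q θ with hGdef
  have htm : ∀ y, 1 ≤ y →
      ((scenarioLaw ν κ l).map fun x => (meanX x, meanY x)).real {w | w.2 ≤ θ - y} ≤ M / y ∧
      ((scenarioLaw ν κ l).map fun x => (meanX x, meanY x)).real {w | θ + y < w.2} ≤ M / y := by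
    intro y hy
    have h1 := measureReal_meanY_tail (θ := θ) hl hY hM (by linarith : 0 < y)
    constructor
    · rw [map_measureReal_apply hmeas (measurableSet_le measurable_snd measurable_const)]
      refine (measureReal_mono fun x (hx : meanY x ≤ θ - y) => ?_).trans h1
      change y ≤ |meanY x - θ|
      rw [le_abs]; right; linarith
    · rw [map_measureReal_apply hmeas (measurableSet_lt measurable_const measurable_snd)]
      refine (measureReal_mono fun x (hx : θ + y < meanY x) => ?_).trans h1
      change y ≤ |meanY x - θ|
      rw [le_abs]; left; linarith
  have hroot : ∀ y : ℝ, 1 ≤ y → ∀ K, 0 ≤ K → K ≤ 2 * B → 2 * √(K * (M / y)) ≤ C / √y := by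
    intro y hy K hK0 hK
    have hy0 : 0 < √y := Real.sqrt_pos.2 (by linarith)
    rw [← mul_div_assoc, Real.sqrt_div (by positivity), ← mul_div_assoc]
    gcongr
    refine le_trans ?_ hSC
    gcongr
  refine
    { measurable_H := fun y => (R.continuous_smoothLower e e y).measurable
      H_nonneg := fun x y => R.smoothLower_nonneg e e x y
      H_mono := fun x => R.smoothLower_mono e e x
      H_le := fun x y => R.smoothLower_le_iSup e e x y
      f_le := fun x => (R.iSup_smoothLower_le e e x).trans (by linarith)
      law_H := fun y => by rw [← hpair]; exact R.map_fst_restrict_eq e e y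
      law_f := by rw [← hpair]; exact R.map_fst_eq e e
      lower := fun x hx => ?_
      lipschitz := fun x y => (R.abs_iSup_smoothLower_sub_le e e y x).trans
        (mul_le_mul_of_nonneg_right (by linarith) (abs_nonneg _))
      slope := fun x b hx hb0 hb => ?_
      taylor := ?_
      level := ?_
      tail := fun x y hy => ?_
      tail_mass := fun y hy => ?_ }
  -- The marginal density dominates the mass density on a strip of width `ε` just below `θ`, which
  -- is at least `G / 2 * ε`.
  · have h1 := (hslope x ε hx hε0.le le_rfl).2
    have h2 := R.smoothLower_nonneg e e x (θ - ε)
    have h3 := R.smoothLower_le_iSup e e x θ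
    exact (min_le_right _ _).trans (by linarith)
  · have h1 := hslope x b hx hb0 hb
    have h2 : min (G / 2) (G / 2 * ε) * b ≤ G / 2 * b :=
      mul_le_mul_of_nonneg_right (min_le_left _ _) hb0
    exact ⟨h2.trans h1.1, h2.trans h1.2⟩
  · have hf0 : 0 < ⨆ n : ℕ, smoothLower φ 0 0 q n := by
      have h1 := (R.slope_smoothLower (θ := θ) (q := q) (e := 0) (x := q) hε le_rfl
        (by rw [mul_zero]; positivity) (by simpa using hε0.le) hε0.le le_rfl).2
      have h2 := R.smoothLower_nonneg 0 0 q (θ - ε)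
      have h3 := R.smoothLower_le_iSup 0 0 q θ
      have : 0 < G / 2 * ε := by positivity
      linarith
    -- The CoVaR equation cancels the constant term of the noise-free expansion; the noise adds only
    -- terms of order `1 / l`.
    have hq := R.smoothLower_eq_of_hasCondCDFAt hθ.2 hf0
    obtain ⟨d₁, hd₁, hT₁⟩ := R.exists_taylor_smoothLower q θ
    obtain ⟨d₂, hd₂, hT₂⟩ := R.exists_taylor_iSup_smoothLower q
    have hmul : ∀ {a b : ℝ}, |a| ≤ b → |β * a| ≤ b := fun {a b} h => by
      rw [abs_mul, abs_of_pos hβ.1]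
      have := abs_nonneg a
      nlinarith [hβ.2]
    refine ⟨d₁ - β * d₂, ?_, fun x => ?_⟩
    · exact (abs_sub _ _).trans (by linarith [hmul hd₂])
    · have a1 := R.abs_smoothLower_sub_zero_le hU hV heabs heabs x θ
      have a2 := hmul (R.abs_iSup_smoothLower_sub_zero_le hU hV heabs heabs x)
      have a3 := hT₁ x
      have a4 := hmul (hT₂ x)
      rw [he2] at a1 a2
      have hpos : 0 ≤ (x - q) ^ 2 + 1 / (l : ℝ) := by positivity
      have hfin : 2 * B * ((x - q) ^ 2 + 1 / (l : ℝ)) ≤ C * ((x - q) ^ 2 + 1 / (l : ℝ)) :=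
        mul_le_mul_of_nonneg_right hBC hpos
      refine le_trans ?_ hfin
      rw [abs_le] at a1 a2 a3 a4 ⊢
      constructor <;> linarith [a1.1, a2.1, a3.1, a4.1, a1.2, a2.2, a3.2, a4.2]
  · have h1 := R.abs_cdf_perturbed_sub_le hU e q
    have hlt : MeasurableSet {w : ℝ × ℝ | w.1 < q} :=
      measurableSet_lt measurable_fst measurable_const
    have h2 : (scenarioLaw ν κ l).real {x | (scaledErrors κ x).1 < q} = α := by
      rw [← R.measureReal_mu_lt hθ.1]
      conv_rhs => rw [← scenarioLaw_map_fst ν κ l]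
      rw [map_measureReal_apply measurable_fst
        (measurableSet_lt (measurable_muFun κ) measurable_const)]
      rfl
    rw [h2, he2] at h1
    rw [← hpair, map_measureReal_apply (measurable_perturbedPair κ e e l) hlt]
    exact h1.trans (mul_le_mul_of_nonneg_right (by linarith) (by positivity))
  -- Markov's inequality bounds the integral of each tail function by `M / y`, and its Lipschitz
  -- property turns this into a pointwise bound of order `1 / √y`.
  · have hy0 : 0 < y := by linarith
    have ht := htm y hy
    rw [← hpair] at ht
    constructor
    · refine (le_sqrt_of_lipschitz hB (fun x => R.smoothLower_nonneg e e x (θ - y))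
        (R.integrable_smoothLower e e _)
        (fun x x' => R.abs_smoothLower_sub_le e e x' x _) (m := M / y) ?_ x).trans
        (hroot y hy B hB.le (by linarith))
      rw [R.integral_smoothLower]
      exact ht.1
    · refine (le_sqrt_of_lipschitz (g := fun x => (⨆ n : ℕ, smoothLower φ e e x n) -
          smoothLower φ e e x (θ + y)) (K := 2 * B) (by positivity)
        (fun x => sub_nonneg.2 (R.smoothLower_le_iSup e e x _))
        ((R.integrable_iSup_smoothLower e e).sub (R.integrable_smoothLower e e _))
        (fun x x' => ?_) (m := M / y) ?_ x).trans (hroot y hy (2 * B) (by positivity) le_rfl)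
      · have b1 := R.abs_smoothLower_sub_le e e x' x (θ + y)
        have b2 := R.abs_iSup_smoothLower_sub_le e e x' x
        rw [abs_le] at b1 b2 ⊢
        constructor <;> linarith [b1.1, b2.1, b1.2, b2.2]
      · rw [R.integral_iSup_smoothLower_sub]
        exact ht.2
  · have hy0 : 0 < y := by linarith
    have : M / y ≤ C / y := by gcongr
    exact ⟨(htm y hy).1.trans this, (htm y hy).2.trans this⟩

end RegularDensity

/-- For large inner sample sizes the sample means form noisy pairs with common constants. -/
theorem exists_noisyPair {α β q θ : ℝ} (hβ : β ∈ Ioo (0 : ℝ) 1)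
    (hX : Integrable (fun x : S × (ℝ × ℝ) => x.2.1) (ν ⊗ₘ κ))
    (hY : Integrable (fun x : S × (ℝ × ℝ) => x.2.2) (ν ⊗ₘ κ))
    (hθ : IsCoVaR ν (muFun κ) (piFun κ) α β q θ)
    {φ : ℕ → ℝ → ℝ → ℝ → ℝ → ℝ} {p : ℕ → ℝ → ℝ → ℝ} {B : ℝ}
    (hreg : ∀ᶠ l : ℕ in atTop, RegularDensity ν κ l (φ l) (p l) B)
    (hpos : ∀ᶠ l : ℕ in atTop, 0 < marginalDensity (φ l) q θ) :
    ∃ C c ε : ℝ, 0 < C ∧ 0 < c ∧ 0 < ε ∧ ∀ᶠ l : ℕ in atTop, ∃ f H,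
      NoisyPair ((scenarioLaw ν κ l).map fun x => (meanX x, meanY x)) f H α β q θ C c ε
        (1 / l) := by
  have hreg' : ∀ᶠ l : ℕ in atTop, RegularDensity ν κ l (φ l) (p l) (max B 1) :=
    hreg.mono fun l R => R.mono_bound (le_max_left _ _)
  have hB : 0 < max B 1 := lt_max_of_lt_right one_pos
  set B' := max B 1
  -- One admissible inner sample size fixes `G`, hence the constants for all larger ones.
  obtain ⟨l₀, R₀, hG⟩ := (hreg'.and hpos).exists
  set G := marginalDensity (φ l₀) q θ
  set M := ∫ x, |x.2.2| ∂(ν ⊗ₘ κ) + |θ| with hM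
  have hM0 : 0 ≤ M := add_nonneg (integral_nonneg fun _ => abs_nonneg _) (abs_nonneg _)
  refine ⟨2 * B' + M + 2 * √(2 * B' * M), min (G / 2) (G / 2 * (G / (8 * B'))), G / (8 * B'),
    by positivity, lt_min (by positivity) (by positivity), by positivity, ?_⟩
  have hlim : Tendsto (fun l : ℕ => B' * (√(l : ℝ))⁻¹) atTop (𝓝 0) := by
    have h1 : Tendsto (fun l : ℕ => √(l : ℝ)) atTop atTop :=
      Real.tendsto_sqrt_atTop.comp tendsto_natCast_atTop_atTop
    have := h1.inv_tendsto_atTop.const_mul B'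
    rwa [mul_zero] at this
  filter_upwards [hreg', eventually_ge_atTop 1, hlim.eventually_le_const (by positivity : 0 < G / 8)]
    with l R hl he
  have hGl : marginalDensity (φ l) q θ = G := R.marginalDensity_eq R₀ q θ
  have := R.noisyPair hB hl (ε := G / (8 * B')) hβ hX hY hθ (by positivity)
    (by rwa [hGl]) (by rw [hGl]; exact le_of_eq (by field_simp)) (by rwa [hGl]) hM.ge
  rw [hGl] at this
  exact ⟨_, _, this⟩

end

/-! ### Arithmetic of the rates -/

section Rates

/-- With `a`, `b`, `c` the three summands of the rate, the inverse effort is `a² b c`, which is at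
most `(a + b + c)⁴`. -/
theorem effort_rpow_le_errorRate {k h l : ℕ} (hk : 0 < k) (hh : 0 < h) (hl : 0 < l) :
    effort k h l ^ (-(1 / 4) : ℝ) ≤ errorRate k h l := by
  have hk0 : (0 : ℝ) < k := by exact_mod_cast hk
  have hh0 : (0 : ℝ) < h := by exact_mod_cast hh
  have hl0 : (0 : ℝ) < l := by exact_mod_cast hl
  unfold effort errorRate
  set a := (k : ℝ) ^ (-(1 / 2) : ℝ) with ha
  set b := (h : ℝ)⁻¹ with hb
  set c := (l : ℝ)⁻¹ with hc
  have ha0 : 0 < a := by positivity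
  have hb0 : 0 < b := by positivity
  have hc0 : 0 < c := by positivity
  have ha2 : a ^ 2 = (k : ℝ)⁻¹ := by
    rw [ha, ← Real.rpow_natCast, ← Real.rpow_mul hk0.le]
    norm_num [Real.rpow_neg_one]
  have he : ((k : ℝ) * h * l)⁻¹ = a ^ 2 * b * c := by
    rw [ha2, hb, hc]; field_simp
  have hle : a ^ 2 * b * c ≤ (a + b + c) ^ 4 := by
    calc a ^ 2 * b * c ≤ (a + b + c) ^ 2 * (a + b + c) * (a + b + c) := by
          gcongr <;> linarith
      _ = _ := by ring
  rw [Real.rpow_neg (by positivity), ← Real.inv_rpow (by positivity), he]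
  calc (a ^ 2 * b * c) ^ (1 / 4 : ℝ) ≤ ((a + b + c) ^ 4) ^ (1 / 4 : ℝ) := by gcongr
    _ = a + b + c := by
      rw [← Real.rpow_natCast, ← Real.rpow_mul (by positivity)]
      norm_num

theorem errorRate_nonneg (k h l : ℕ) : 0 ≤ errorRate k h l := by
  unfold errorRate; positivity

theorem errorRate_pos {k : ℕ} (hk : 0 < k) (h l : ℕ) : 0 < errorRate k h l := by
  have hk0 : (0 : ℝ) < k := by exact_mod_cast hk
  unfold errorRate; positivity

variable {c₁ c₂ : ℝ} (hc₁ : 0 < c₁) (hc₂ : 0 < c₂) {k h l : ℕ → ℕ}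
  (hΓ : Tendsto (fun m => effort (k m) (h m) (l m)) atTop atTop)
  (hl : Tendsto (fun m => (l m : ℝ) / effort (k m) (h m) (l m) ^ (1 / 4 : ℝ)) atTop (𝓝 c₁))
  (hh : Tendsto (fun m => (h m : ℝ) / effort (k m) (h m) (l m) ^ (1 / 4 : ℝ)) atTop (𝓝 c₂))
  (hk : Tendsto (fun m => (k m : ℝ) / effort (k m) (h m) (l m) ^ (1 / 2 : ℝ)) atTop
    (𝓝 (1 / (c₁ * c₂))))

theorem tendsto_atTop_of_div_rpow {n : ℕ → ℕ} {g : ℕ → ℝ} {c r : ℝ} (hc : 0 < c) (hr : 0 < r)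
    (hg : Tendsto g atTop atTop) (hn : Tendsto (fun m => (n m : ℝ) / g m ^ r) atTop (𝓝 c)) :
    Tendsto n atTop atTop := by
  rw [← tendsto_natCast_atTop_iff (R := ℝ)]
  refine (hn.pos_mul_atTop hc ((tendsto_rpow_atTop hr).comp hg)).congr' ?_
  filter_upwards [hg.eventually_gt_atTop 0] with m hm
  exact div_mul_cancel₀ _ (Real.rpow_pos_of_pos hm r).ne'

include hc₁ hc₂ hΓ hl hh hk in
theorem tendsto_allocation : Tendsto (fun m => (k m, h m, l m)) atTop atTop := by
  have h1 := tendsto_atTop_of_div_rpow hc₁ (by norm_num) hΓ hl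
  have h2 := tendsto_atTop_of_div_rpow hc₂ (by norm_num) hΓ hh
  have h3 := tendsto_atTop_of_div_rpow (by positivity) (by norm_num) hΓ hk
  rw [← prod_atTop_atTop_eq, ← prod_atTop_atTop_eq]
  exact h3.prodMk (h2.prodMk h1)

-- The ratio of the rate to `Γ^{-1/4}` converges to `√(c₁ c₂) + 1 / c₂ + 1 / c₁`, a positive number.
include hc₁ hc₂ hΓ hl hh hk in
theorem errorRate_isTheta :
    (fun m => errorRate (k m) (h m) (l m)) =Θ[atTop]
      fun m => effort (k m) (h m) (l m) ^ (-(1 / 4) : ℝ) := by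
  have hkpos : 0 < 1 / (c₁ * c₂) := by positivity
  have t1 := (hk.rpow_const (p := -(1 / 2)) (Or.inl hkpos.ne'))
  have t2 := (t1.add (hh.inv₀ hc₂.ne')).add (hl.inv₀ hc₁.ne')
  have hpos : 0 < (1 / (c₁ * c₂)) ^ (-(1 / 2) : ℝ) + c₂⁻¹ + c₁⁻¹ := by positivity
  refine (isTheta_of_div_tendsto_nhds_ne_zero (t2.congr' ?_) hpos.ne').symm
  filter_upwards [hΓ.eventually_gt_atTop 0] with m hm
  have hx : 0 < effort (k m) (h m) (l m) ^ (1 / 4 : ℝ) := Real.rpow_pos_of_pos hm _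
  have hk0 : (0 : ℝ) ≤ k m := Nat.cast_nonneg _
  have e1 : (effort (k m) (h m) (l m) ^ (1 / 2 : ℝ)) ^ (-(1 / 2) : ℝ) =
      (effort (k m) (h m) (l m) ^ (1 / 4 : ℝ))⁻¹ := by
    rw [← Real.rpow_mul hm.le, ← Real.rpow_neg hm.le]; norm_num
  unfold errorRate
  rw [Real.div_rpow hk0 (Real.rpow_nonneg hm.le _), e1, Real.rpow_neg hm.le]
  field_simp

end Rates

/-! ### Mean squared error of the nested estimator -/

section MeanSquare

theorem measureReal_lt_abs_le {Ω : Type*} [MeasurableSpace Ω] {P : Measure Ω}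
    [IsProbabilityMeasure P] {E : Ω → ℝ} (hE : Integrable (fun ω => E ω ^ 2) P) {K r M : ℝ}
    (hr : 0 < r) (hM : 0 < M) (h : ∫ ω, E ω ^ 2 ∂P ≤ K * r ^ 2) :
    P.real {ω | M * r < |E ω|} ≤ K / M ^ 2 := by
  have h1 := mul_meas_ge_le_integral_of_nonneg (μ := P) (f := fun ω => E ω ^ 2)
    (Eventually.of_forall fun ω => sq_nonneg _) hE ((M * r) ^ 2)
  have h2 : P.real {ω | M * r < |E ω|} ≤ P.real {ω | (M * r) ^ 2 ≤ E ω ^ 2} :=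
    measureReal_mono fun ω (hω : M * r < |E ω|) => by
      change (M * r) ^ 2 ≤ E ω ^ 2
      rw [← sq_abs (E ω)]
      gcongr
  have hMr : 0 < M * r := by positivity
  rw [le_div_iff₀ (by positivity)]
  have h3 : (M * r) ^ 2 * P.real {ω | M * r < |E ω|} ≤ K * r ^ 2 :=
    (mul_le_mul_of_nonneg_left h2 (by positivity)).trans (h1.trans h)
  have h4 : r ^ 2 * (P.real {ω | M * r < |E ω|} * M ^ 2) ≤ r ^ 2 * K := by linarith
  exact le_of_mul_le_mul_left h4 (by positivity)

theorem isBigOP_of_integral_sq_le {ι : Type*} {L : Filter ι} {Ω : ι → Type*}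
    [∀ a, MeasurableSpace (Ω a)] {P : ∀ a, Measure (Ω a)} [∀ a, IsProbabilityMeasure (P a)]
    {E : ∀ a, Ω a → ℝ} {r : ι → ℝ} {K : ℝ} (hK : 0 < K)
    (h : ∀ᶠ a in L, 0 < r a ∧ Integrable (fun ω => E a ω ^ 2) (P a) ∧
      ∫ ω, E a ω ^ 2 ∂(P a) ≤ K * r a ^ 2) : IsBigOP L P E r := by
  intro ε hε
  refine ⟨√(K / ε), h.mono fun a ⟨hr, hi, hle⟩ => ?_⟩
  refine (measureReal_lt_abs_le hi hr (Real.sqrt_pos.2 (by positivity)) hle).trans ?_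
  rw [Real.sq_sqrt (by positivity)]
  exact le_of_eq (by field_simp)

variable {S : Type*} [MeasurableSpace S]

theorem measurable_nestedEstimator (α β : ℝ) (k h l : ℕ) :
    Measurable fun ω : Sample S k h l => nestedEstimator α β ω := by
  have hX := measurable_meanX (S := S) l
  have hY := measurable_meanY (S := S) l
  have hT : Measurable fun (ω : Sample S k h l) (i : Fin k) =>
      concomitant (fun j => meanX (ω i j)) (fun j => meanY (ω i j)) ⌈α * h⌉₊ :=
    measurable_pi_lambda _ fun i => measurable_concomitant (by fun_prop) (by fun_prop) _
  exact measurable_concomitant hT hT _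

variable (ν : Measure S) [IsProbabilityMeasure ν] (κ : Kernel S (ℝ × ℝ)) [IsMarkovKernel κ]

/-- The concomitants of the batches are independent with law `concomitantLaw`. -/
theorem map_batch_concomitants (k h l r : ℕ) :
    (sampleLaw ν κ k h l).map (fun ω i =>
      concomitant (fun j => meanX (ω i j)) (fun j => meanY (ω i j)) r) =
    Measure.pi fun _ : Fin k =>
      concomitantLaw ((scenarioLaw ν κ l).map fun x => (meanX x, meanY x)) h r := by
  have hX := measurable_meanX (S := S) l
  have hY := measurable_meanY (S := S) l
  have hmean : Measurable fun x : S × (Fin l → ℝ × ℝ) => (meanX x, meanY x) := hX.prodMk hY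
  have hT : Measurable fun w : Fin h → S × (Fin l → ℝ × ℝ) =>
      concomitant (fun j => meanX (w j)) (fun j => meanY (w j)) r :=
    measurable_concomitant (by fun_prop) (by fun_prop) r
  have := Measure.isProbabilityMeasure_map (μ := scenarioLaw ν κ l) hmean.aemeasurable
  have := Measure.isProbabilityMeasure_map
    (μ := Measure.pi fun _ : Fin h => scenarioLaw ν κ l) hT.aemeasurable
  have hpairs := Measure.pi_map_pi (μ := fun _ : Fin h => scenarioLaw ν κ l)
    (f := fun _ x => (meanX x, meanY x)) fun _ => hmean.aemeasurable
  have hbatch : (Measure.pi fun _ : Fin h => scenarioLaw ν κ l).map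
      (fun w => concomitant (fun j => meanX (w j)) (fun j => meanY (w j)) r) =
      concomitantLaw ((scenarioLaw ν κ l).map fun x => (meanX x, meanY x)) h r := by
    have hcomp := Measure.map_map (μ := Measure.pi fun _ : Fin h => scenarioLaw ν κ l)
      (measurable_concomitant_pairs h r)
      (measurable_pi_lambda _ fun j => hmean.comp (measurable_pi_apply j))
    unfold concomitantLaw
    rw [← hpairs]
    exact hcomp.symm
  have hall := Measure.pi_map_pi
    (μ := fun _ : Fin k => Measure.pi fun _ : Fin h => scenarioLaw ν κ l)
    (f := fun _ w => concomitant (fun j => meanX (w j)) (fun j => meanY (w j)) r)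
    fun _ => hT.aemeasurable
  rw [hbatch] at hall
  exact hall

theorem lintegral_nestedEstimator (α β θ : ℝ) (k h l : ℕ) :
    ∫⁻ ω, ENNReal.ofReal ((nestedEstimator α β ω - θ) ^ 2) ∂(sampleLaw ν κ k h l) =
      ∫⁻ T, ENNReal.ofReal ((orderStat T ⌈β * k⌉₊ - θ) ^ 2) ∂(Measure.pi fun _ : Fin k =>
        concomitantLaw ((scenarioLaw ν κ l).map fun x => (meanX x, meanY x)) h ⌈α * h⌉₊) := by
  have hX := measurable_meanX (S := S) l
  have hY := measurable_meanY (S := S) l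
  have hT : Measurable fun (ω : Sample S k h l) (i : Fin k) =>
      concomitant (fun j => meanX (ω i j)) (fun j => meanY (ω i j)) ⌈α * h⌉₊ :=
    measurable_pi_lambda _ fun i => measurable_concomitant (by fun_prop) (by fun_prop) _
  have ho : Measurable fun T : Fin k → ℝ => ENNReal.ofReal ((orderStat T ⌈β * k⌉₊ - θ) ^ 2) :=
    (((measurable_concomitant measurable_id measurable_id _).sub_const _).pow_const 2).ennreal_ofReal
  rw [← map_batch_concomitants, lintegral_map ho hT]
  rfl

variable {ν κ}

/-- The extended integral can be bounded before integrability is known, so finiteness of the second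
moment and its bound come together. -/
theorem integrable_sq_and_integral_le {α β θ K : ℝ} (hK : 0 ≤ K) {k h l : ℕ}
    (H : ∫⁻ ω, ENNReal.ofReal ((nestedEstimator α β ω - θ) ^ 2) ∂(sampleLaw ν κ k h l) ≤
      ENNReal.ofReal K) :
    Integrable (fun ω => (nestedEstimator α β ω - θ) ^ 2) (sampleLaw ν κ k h l) ∧
      ∫ ω, (nestedEstimator α β ω - θ) ^ 2 ∂(sampleLaw ν κ k h l) ≤ K := by
  have hm : Measurable fun ω : Sample S k h l => (nestedEstimator α β ω - θ) ^ 2 :=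
    ((measurable_nestedEstimator α β k h l).sub_const θ).pow_const 2
  have h0 : ∀ ω : Sample S k h l, 0 ≤ (nestedEstimator α β ω - θ) ^ 2 := fun _ => sq_nonneg _
  constructor
  · refine ⟨hm.aestronglyMeasurable, ?_⟩
    rw [hasFiniteIntegral_iff_ofReal (Eventually.of_forall h0)]
    exact H.trans_lt ENNReal.ofReal_lt_top
  · rw [integral_eq_lintegral_of_nonneg_ae (Eventually.of_forall h0) hm.aestronglyMeasurable]
    exact ENNReal.toReal_le_of_le_ofReal hK H

theorem memLp_nestedEstimator {α β θ : ℝ} {k h l : ℕ}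
    (H : Integrable (fun ω => (nestedEstimator α β ω - θ) ^ 2) (sampleLaw ν κ k h l)) :
    MemLp (fun ω : Sample S k h l => nestedEstimator α β ω) 2 (sampleLaw ν κ k h l) := by
  have h1 : MemLp (fun ω : Sample S k h l => nestedEstimator α β ω - θ) 2
      (sampleLaw ν κ k h l) :=
    (memLp_two_iff_integrable_sq
      ((measurable_nestedEstimator α β k h l).sub_const θ).aestronglyMeasurable).2 H
  have h2 := h1.add (memLp_const (μ := sampleLaw ν κ k h l) (p := 2) θ)
  refine h2.ae_eq (Eventually.of_forall fun ω => ?_)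
  simp

/-- The mean squared error of the nested estimator. -/
theorem exists_mse_bound {α β q θ : ℝ} (hα : α ∈ Ioo (0 : ℝ) 1) (hβ : β ∈ Ioo (0 : ℝ) 1)
    (hX : Integrable (fun x : S × (ℝ × ℝ) => x.2.1) (ν ⊗ₘ κ))
    (hY : Integrable (fun x : S × (ℝ × ℝ) => x.2.2) (ν ⊗ₘ κ))
    (hθ : IsCoVaR ν (muFun κ) (piFun κ) α β q θ)
    {φ : ℕ → ℝ → ℝ → ℝ → ℝ → ℝ} {p : ℕ → ℝ → ℝ → ℝ} {B : ℝ}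
    (hreg : ∀ᶠ l : ℕ in atTop, RegularDensity ν κ l (φ l) (p l) B)
    (hpos : ∀ᶠ l : ℕ in atTop, 0 < marginalDensity (φ l) q θ) :
    ∃ K : ℝ, 0 < K ∧ ∀ᶠ a : ℕ × ℕ × ℕ in atTop, 0 < a.1 ∧
      Integrable (fun ω => (nestedEstimator α β ω - θ) ^ 2) (sampleLaw ν κ a.1 a.2.1 a.2.2) ∧
      ∫ ω, (nestedEstimator α β ω - θ) ^ 2 ∂(sampleLaw ν κ a.1 a.2.1 a.2.2) ≤
        K * errorRate a.1 a.2.1 a.2.2 ^ 2 := by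
  obtain ⟨C, c, ε, hC, hc, hε, hN⟩ := exists_noisyPair hβ hX hY hθ hreg hpos
  obtain ⟨A, a, hA, ha, h₀, δ₀, hδ₀, hbatch⟩ :=
    NoisyPair.exists_batchLaw (q := q) (θ := θ) hα hβ hε hc hC
  obtain ⟨K, hK, k₀, s₀, hs₀, hmse⟩ := exists_orderStat_mse (θ := θ) hβ hA ha hε
  have hinv : Tendsto (fun n : ℕ => 1 / (n : ℝ)) atTop (𝓝 0) := tendsto_one_div_atTop_nhds_zero_nat
  -- Half of `s₀` is reserved for `1 / h` and half for `1 / l`, whose sum is the bias level.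
  have hlarge : ∀ᶠ h : ℕ in atTop, h₀ ≤ h ∧ 1 / (h : ℝ) ≤ s₀ / 2 :=
    (eventually_ge_atTop h₀).and (hinv.eventually_le_const (by positivity))
  have hlarge' := (hN.and (hinv.eventually_le_const hδ₀)).and
    (hinv.eventually_le_const (by positivity : 0 < s₀ / 2))
  refine ⟨K, hK, ?_⟩
  rw [← prod_atTop_atTop_eq, ← prod_atTop_atTop_eq]
  filter_upwards [(eventually_ge_atTop k₀).prod_mk (hlarge.prod_mk hlarge')]
  rintro ⟨k, h, l⟩ ⟨hk, ⟨hh, hhs⟩, ⟨⟨f, H, hP⟩, hl⟩, hls⟩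
  obtain ⟨hk1, hk2⟩ := hmse k hk
  have hk0 : (0 : ℝ) < k := by exact_mod_cast hk1
  have hh0 : (0 : ℝ) ≤ 1 / h := by positivity
  have hl0 : (0 : ℝ) ≤ 1 / l := by positivity
  have := Measure.isProbabilityMeasure_map (μ := scenarioLaw ν κ l)
    ((measurable_meanX (S := S) l).prodMk (measurable_meanY l)).aemeasurable
  have hb := hbatch h hh (1 / l) hl0 hl _ f H hP
  have h1 := hk2 (1 / h + 1 / l) (by positivity) (by dsimp only at *; linarith) _ hb
  rw [← lintegral_nestedEstimator] at h1
  obtain ⟨h2, h3⟩ := integrable_sq_and_integral_le (by positivity) h1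
  refine ⟨hk1, h2, h3.trans (mul_le_mul_of_nonneg_left ?_ hK.le)⟩
  unfold errorRate
  have hr2 : ((k : ℝ) ^ (-(1 / 2) : ℝ)) ^ 2 = 1 / k := by
    rw [← Real.rpow_natCast, ← Real.rpow_mul hk0.le]
    norm_num [Real.rpow_neg_one]
  have hr0 : 0 ≤ (k : ℝ) ^ (-(1 / 2) : ℝ) := by positivity
  have e1 : (h : ℝ)⁻¹ = 1 / h := (one_div _).symm
  have e2 : (l : ℝ)⁻¹ = 1 / l := (one_div _).symm
  dsimp only
  rw [← hr2, e1, e2]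
  -- The cross terms in the square of the rate are nonnegative, so it dominates `(1 / h + 1 / l)² +
  -- 1 / k`.
  nlinarith [mul_nonneg hr0 hh0, mul_nonneg hr0 hl0]

end MeanSquare

end NestedCoVaR

/-! ### The proposition -/

theorem proposition1 {S : Type*} [MeasurableSpace S]
    (ν : MeasureTheory.Measure S) [MeasureTheory.IsProbabilityMeasure ν]
    (κ : ProbabilityTheory.Kernel S (ℝ × ℝ)) [ProbabilityTheory.IsMarkovKernel κ]
    (α β q θ : ℝ) (hα : α ∈ Set.Ioo (0 : ℝ) 1) (hβ : β ∈ Set.Ioo (0 : ℝ) 1)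
    -- `X` and `Y` have a finite mean
    (hX : Integrable (fun x : S × (ℝ × ℝ) => x.2.1) (ν ⊗ₘ κ))
    (hY : Integrable (fun x : S × (ℝ × ℝ) => x.2.2) (ν ⊗ₘ κ))
    -- `θ` is the CoVaR and `q` the VaR
    (hθ : NestedCoVaR.IsCoVaR ν (NestedCoVaR.muFun κ) (NestedCoVaR.piFun κ) α β q θ)
    -- regularity conditions, uniformly over all large inner sample sizes
    (φ : ℕ → ℝ → ℝ → ℝ → ℝ → ℝ) (p : ℕ → ℝ → ℝ → ℝ) (B : ℝ)
    (hreg : ∀ᶠ l : ℕ in atTop, NestedCoVaR.RegularDensity ν κ l (φ l) (p l) B)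
    (hpos : ∀ᶠ l : ℕ in atTop, 0 < NestedCoVaR.marginalDensity (φ l) q θ) :
    -- the RMSE is finite and of order `k^{-1/2} + h^{-1} + l^{-1}` as `k, h, l → ∞`
    (∀ᶠ a : ℕ × ℕ × ℕ in atTop,
      MemLp (fun ω : NestedCoVaR.Sample S a.1 a.2.1 a.2.2 => NestedCoVaR.nestedEstimator α β ω) 2
        (NestedCoVaR.sampleLaw ν κ a.1 a.2.1 a.2.2)) ∧
    ((fun a : ℕ × ℕ × ℕ => NestedCoVaR.rmse ν κ α β θ a.1 a.2.1 a.2.2) =O[atTop]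
      fun a => NestedCoVaR.errorRate a.1 a.2.1 a.2.2) ∧
    -- and so is the error, in probability
    NestedCoVaR.IsBigOP (atTop : Filter (ℕ × ℕ × ℕ))
      (fun a => NestedCoVaR.sampleLaw ν κ a.1 a.2.1 a.2.2)
      (fun _ ω => NestedCoVaR.nestedEstimator α β ω - θ)
      (fun a => NestedCoVaR.errorRate a.1 a.2.1 a.2.2) ∧
    -- no allocation of the effort makes this order smaller than `Γ^{-1/4}`
    (∀ k h l : ℕ, 0 < k → 0 < h → 0 < l →
      (NestedCoVaR.effort k h l) ^ (-(1 / 4) : ℝ) ≤ NestedCoVaR.errorRate k h l) ∧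
    -- and `Γ^{-1/4}` is attained with `l ∼ c₁ Γ^{1/4}`, `h ∼ c₂ Γ^{1/4}`, `k ∼ Γ^{1/2} / (c₁ c₂)`
    (∀ c₁ c₂ : ℝ, 0 < c₁ → 0 < c₂ → ∀ k h l : ℕ → ℕ,
      Tendsto (fun m => NestedCoVaR.effort (k m) (h m) (l m)) atTop atTop →
      Tendsto (fun m => (l m : ℝ) / (NestedCoVaR.effort (k m) (h m) (l m)) ^ (1 / 4 : ℝ))
        atTop (𝓝 c₁) →
      Tendsto (fun m => (h m : ℝ) / (NestedCoVaR.effort (k m) (h m) (l m)) ^ (1 / 4 : ℝ))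
        atTop (𝓝 c₂) →
      Tendsto (fun m => (k m : ℝ) / (NestedCoVaR.effort (k m) (h m) (l m)) ^ (1 / 2 : ℝ))
        atTop (𝓝 (1 / (c₁ * c₂))) →
      ((fun m => NestedCoVaR.errorRate (k m) (h m) (l m)) =Θ[atTop]
        fun m => (NestedCoVaR.effort (k m) (h m) (l m)) ^ (-(1 / 4) : ℝ)) ∧
      ((fun m => NestedCoVaR.rmse ν κ α β θ (k m) (h m) (l m)) =O[atTop]
        fun m => (NestedCoVaR.effort (k m) (h m) (l m)) ^ (-(1 / 4) : ℝ)) ∧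
      NestedCoVaR.IsBigOP (atTop : Filter ℕ)
        (fun m => NestedCoVaR.sampleLaw ν κ (k m) (h m) (l m))
        (fun _ ω => NestedCoVaR.nestedEstimator α β ω - θ)
        (fun m => (NestedCoVaR.effort (k m) (h m) (l m)) ^ (-(1 / 4) : ℝ))) := by
  obtain ⟨K, hK, hmse⟩ := NestedCoVaR.exists_mse_bound hα hβ hX hY hθ hreg hpos
  have hrmse : (fun a : ℕ × ℕ × ℕ => NestedCoVaR.rmse ν κ α β θ a.1 a.2.1 a.2.2) =O[atTop]
      fun a => NestedCoVaR.errorRate a.1 a.2.1 a.2.2 := by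
    refine IsBigO.of_bound √K (hmse.mono fun a ⟨_, _, h⟩ => ?_)
    have h0 : 0 ≤ NestedCoVaR.rmse ν κ α β θ a.1 a.2.1 a.2.2 := Real.sqrt_nonneg _
    rw [Real.norm_of_nonneg h0,
      Real.norm_of_nonneg (NestedCoVaR.errorRate_nonneg _ _ _)]
    refine (Real.sqrt_le_sqrt h).trans ?_
    rw [Real.sqrt_mul hK.le, Real.sqrt_sq (NestedCoVaR.errorRate_nonneg _ _ _)]
  refine ⟨hmse.mono fun a h => NestedCoVaR.memLp_nestedEstimator h.2.1, hrmse, ?_,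
    fun k h l hk hh hl => NestedCoVaR.effort_rpow_le_errorRate hk hh hl, ?_⟩
  · exact NestedCoVaR.isBigOP_of_integral_sq_le hK
      (hmse.mono fun a ⟨h1, h2, h3⟩ => ⟨NestedCoVaR.errorRate_pos h1 _ _, h2, h3⟩)
  · intro c₁ c₂ hc₁ hc₂ k h l hΓ hl hh hk
    have hT := NestedCoVaR.tendsto_allocation hc₁ hc₂ hΓ hl hh hk
    have hΘ := NestedCoVaR.errorRate_isTheta hc₁ hc₂ hΓ hl hh hk
    refine ⟨hΘ, (hrmse.comp_tendsto hT).trans hΘ.1, ?_⟩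
    -- The mean square bound is restated relative to `Γ^{-1/4}` with constant `K D²`, so the same
    -- Chebyshev argument applies along the sequence.
    obtain ⟨D, hD, hbound⟩ := hΘ.1.exists_pos
    have hKD : 0 < K * D ^ 2 := by positivity
    refine NestedCoVaR.isBigOP_of_integral_sq_le hKD ?_
    filter_upwards [hT.eventually hmse, hbound.bound, hΓ.eventually_gt_atTop 0]
      with m ⟨_, h2, h3⟩ hm hpos
    have hr := Real.rpow_pos_of_pos hpos (-(1 / 4))
    refine ⟨hr, h2, h3.trans ?_⟩
    rw [Real.norm_of_nonneg (NestedCoVaR.errorRate_nonneg _ _ _), Real.norm_of_nonneg hr.le] at hm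
    rw [mul_assoc, ← mul_pow]
    have h0 := NestedCoVaR.errorRate_nonneg (k m) (h m) (l m)
    gcongr
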